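/- **Setting.** Let $d\in\{2,3\}$ and let $\mathfrak M$ be a finite conforming simplicial mesh in $\mathbb R^d$ (closed elements are disjoint or share exactly a common face); $\Omega$ is the interior of the union of the elements and $\mathfrak N$ the set of nodes. Assume that $\mathfrak M$ is shape regular with constant $\kappa$ (diameter of each element $\le\kappa\,\times$ diameter of an inscribed ball) and that any two elements containing a node $p$ can be joined by a chain of elements containing $p$ in which consecutive elements share a side (as is the case for Lipschitz domains). The boundary sides are split into Dirichlet and Neumann sides, with unions $\Gamma^D,\Gamma^N$. For $p\in\mathfrak N$ let $\omega_p$ be the interior of the union of the elements containing $p$, $h_p=\operatorname{diam}\omega_p$, $\gamma_p^I$ the union of the interior sides containing $p$, $\gamma_p^N$ the union of the Neumann sides containing $p$, $\phi_p$ the nodal basis function, and $\tilde\omega_p$ the patch of $p$ in the mesh obtained by two uniform red refinements (the image of $\omega_p$ under the homothety with centre $p$ and ratio $1/4$). Let $\varepsilon>0$, $f\in L^2(\Omega)$, $\pi\in L^2(\Gamma^N)$, let $\varphi^D$ be continuous on $\Gamma^D$ and affine on each Dirichlet side, let $g\in H^1(\Omega)$ with $\varphi^D\le g$ on $\Gamma^D$,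 and let $g_{\mathfrak m}$ be continuous and piecewise affine with $\varphi^D\le g_{\mathfrak m}$ on $\Gamma^D$. Put $a_\varepsilon(u,v)=\langle\varepsilon^2\nabla u,\nabla v\rangle+\langle u,v\rangle$, $\mathcal H_0=\{\psi\in H^1(\Omega):\psi=0\text{ on }\Gamma^D\}$, $\mathcal K=\{\psi\in H^1(\Omega):\psi=\varphi^D\text{ on }\Gamma^D,\ \psi\le g\}$, and let $\mathcal K_{\mathfrak m}$ be the set of continuous piecewise affine $\psi$ with $\psi=\varphi^D$ on $\Gamma^D$ and $\psi\le g_{\mathfrak m}$. Let $\varphi\in\mathcal K$ satisfy $a_\varepsilon(\varphi,\varphi-\psi)\le\langle f,\varphi-\psi\rangle+\langle\pi,\varphi-\psi\rangle_{\Gamma^N}$ for all $\psi\in\mathcal K$, and let $\varphi_{\mathfrak m}\in\mathcal K_{\mathfrak m}$ satisfy the same inequality for all $\psi\in\mathcal K_{\mathfrak m}$. Define $$\langle\lambda,\psi\rangle=\langle f,\psi\rangle+\langle\pi,\psi\rangle_{\Gamma^N}-a_\varepsilon(\varphi,\psi),\qquad \langle\mathcal R,\psi\rangle=\langle f,\psi\rangle+\langle\pi,\psi\rangle_{\Gamma^N}-a_\varepsilon(\varphi_{\mathfrak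 m},\psi).$$ A node $p$ is a *full-contact node* ($p\in\mathfrak N^{fC}$) if $\varphi_{\mathfrak m}=g_{\mathfrak m}$ on $\omega_p$ and $\langle\mathcal R,\psi\rangle\ge0$ for all $\psi\in\mathcal H_0$ with $\psi\ge0$ and $\psi=0$ outside $\omega_p$; it is a *semi-contact node* ($p\in\mathfrak N^{sC}$) if $\varphi_{\mathfrak m}(p)=g_{\mathfrak m}(p)$ and $p\notin\mathfrak N^{fC}$. The quasi-discrete constraining force is $$\langle\tilde\lambda_{\mathfrak m},\psi\rangle=\sum_{p\in\mathfrak N^{sC}}\langle\mathcal R,\phi_p\rangle\,c_p(\psi)+\sum_{p\in\mathfrak N^{fC}}\langle\mathcal R,\psi\phi_p\rangle,$$ with $c_p(\psi)=0$ if $p$ lies on $\Gamma^D$ and $c_p(\psi)=\int_{\tilde\omega_p}\psi\phi_p\big/\int_{\tilde\omega_p}\phi_p$ otherwise. With $\|u\|_{\varepsilon,\omega}=(\varepsilon^2\|\nabla u\|_\omega^2+\|u\|_\omega^2)^{1/2}$, let $\|\ell\|_{*,\varepsilon,\omega_p}$ be the supremum of $\langle\ell,\psi\rangle/\|\psi\|_{\varepsilon}$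 over all $\psi\in\mathcal H_0$, $\psi\neq0$, that vanish outside $\omega_p$. Let $\bar f$ and $\bar\pi$ be the mean values of $f$ on elements and of $\pi$ on Neumann sides, $[\nabla\varphi_{\mathfrak m}]$ the jump of the normal derivative across interior sides, $\boldsymbol n$ the outward unit normal, $\alpha_p=\min\{h_p/\varepsilon,1\}$, and $$\eta_{1,p}=\alpha_p\|f-\varphi_{\mathfrak m}\|_{\omega_p},\quad \eta_{2,p}=\alpha_p^{1/2}\varepsilon^{-1/2}\|\varepsilon^2[\nabla\varphi_{\mathfrak m}]\|_{\gamma_p^I},\quad \eta_{3,p}=\alpha_p^{1/2}\varepsilon^{-1/2}\|\pi-\varepsilon^2\nabla\varphi_{\mathfrak m}\cdot\boldsymbol n\|_{\gamma_p^N},$$ $$\mathrm{osc}_p(f)=\alpha_p\|\bar f-f\|_{\omega_p},\qquad \mathrm{osc}_p(\pi)=\alpha_p^{1/2}\varepsilon^{-1/2}\|\bar\pi-\pi\|_{\gamma_p^N}.$$ **Theorem (robust local lower bounds by $\eta_{1,p},\eta_{2,p},\eta_{3,p}$).** There is a constant $C>0$ depending only on $d$ and $\kappa$ (in particular not on $\varepsilon$)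 such that in the above setting, for every node $p\in\mathfrak N\setminus\mathfrak N^{fC}$ and $k=1,2,3$, $$\eta_{k,p}\le C\left(\|\varphi-\varphi_{\mathfrak m}\|_{\varepsilon,\omega_p}+\|\lambda-\tilde\lambda_{\mathfrak m}\|_{*,\varepsilon,\omega_p}+\mathrm{osc}_p(f)+\mathrm{osc}_p(\pi)\right).$$ -/

import Mathlib

open Set Filter Topology MeasureTheory
open scoped ENNReal NNReal

noncomputable section

namespace ObstacleFEM

/-- Points of `ℝᵈ` with the Euclidean norm. -/
abbrev Pt (d : ℕ) := EuclideanSpace ℝ (Fin d)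

/-! ### Meshes -/

/-- A finite conforming simplicial mesh. An element is given by the finite set of its `d + 1`
vertices; two closed elements meet exactly in the convex hull of their common vertices. A set of
boundary sides (sides of exactly one element) is marked as Dirichlet sides; all other boundary
sides are Neumann sides. Any two elements that contain a node `p` are joined by a chain of elements
containing `p` in which neighbours share a side (the usual local connectedness of a Lipschitz
domain near `p`: the mesh has no elements that touch around `p` only in lower-dimensional
faces). -/
structure Mesh (d : ℕ) where
  elements : Finset (Finset (Pt d))
  card_eq : ∀ e ∈ elements, e.card = d + 1
  affineIndependent : ∀ e ∈ elements, AffineIndependent ℝ ((↑) : e → Pt d)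
  conforming : ∀ e ∈ elements, ∀ e' ∈ elements,
    convexHull ℝ (e : Set (Pt d)) ∩ convexHull ℝ (e' : Set (Pt d)) =
      convexHull ℝ ((e : Set (Pt d)) ∩ (e' : Set (Pt d)))
  dirichletSides : Finset (Finset (Pt d))
  dirichletSides_card : ∀ s ∈ dirichletSides, s.card = d
  dirichletSides_boundary : ∀ s ∈ dirichletSides, ∃! e, e ∈ elements ∧ s ⊆ e
  chain : ∀ p : Pt d, ∀ e ∈ elements, ∀ e' ∈ elements, p ∈ e → p ∈ e' →
    Relation.ReflTransGen
      (fun a b => b ∈ elements ∧ p ∈ b ∧ ∃ s : Finset (Pt d), s.card = d ∧ s ⊆ a ∧ s ⊆ b) e e'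

variable {d : ℕ}

/-- The closed simplex with the given vertices. -/
abbrev hull (e : Finset (Pt d)) : Set (Pt d) := convexHull ℝ (e : Set (Pt d))

/-- Surface measure, i.e. `(d-1)`-dimensional Hausdorff measure normalised such that it is
`(d-1)`-dimensional Lebesgue measure on hyperplanes. -/
abbrev surf (d : ℕ) : Measure (Pt d) := Measure.euclideanHausdorffMeasure (d - 1)

namespace Mesh

variable (M : Mesh d)

/-- Shape regularity: the ratio of the diameter of every element and the diameter of a ball
inscribed in it is at most `κ`. -/
def ShapeRegular (κ : ℝ) : Prop :=
  ∀ e ∈ M.elements, ∃ (c : Pt d) (r : ℝ), 0 < r ∧ Metric.closedBall c r ⊆ hull e ∧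
    Metric.diam (hull e) ≤ κ * (2 * r)

/-- The closure of the domain. -/
def closedDomain : Set (Pt d) := ⋃ e ∈ M.elements, hull e

/-- The (open) domain `Ω`. -/
def Ω : Set (Pt d) := interior M.closedDomain

open Classical in
/-- The nodes. -/
def nodes : Finset (Pt d) := M.elements.biUnion id

open Classical in
/-- The elements that contain a given finite set of nodes. -/
def elementsAt (s : Finset (Pt d)) : Finset (Finset (Pt d)) := M.elements.filter (s ⊆ ·)

open Classical in
/-- The sides: the `(d-1)`-dimensional faces of elements. -/
def sides : Finset (Finset (Pt d)) := M.elements.biUnion (·.powersetCard d)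

open Classical in
/-- Sides shared by two elements. -/
def interiorSides : Finset (Finset (Pt d)) := M.sides.filter fun s => (M.elementsAt s).card = 2

open Classical in
/-- Sides of a single element. -/
def boundarySides : Finset (Finset (Pt d)) := M.sides.filter fun s => (M.elementsAt s).card = 1

open Classical in
/-- Boundary sides that are not Dirichlet sides. -/
def neumannSides : Finset (Finset (Pt d)) := M.boundarySides.filter (· ∉ M.dirichletSides)

def Γ : Set (Pt d) := ⋃ s ∈ M.boundarySides, hull s
def ΓD : Set (Pt d) := ⋃ s ∈ M.dirichletSides, hull s
def ΓN : Set (Pt d) := ⋃ s ∈ M.neumannSides, hull s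

/-- Nodes on the Dirichlet boundary. -/
def IsDirichletNode (p : Pt d) : Prop := ∃ s ∈ M.dirichletSides, p ∈ s

open Classical in
/-- Elements sharing the node `p`. -/
def star (p : Pt d) : Finset (Finset (Pt d)) := M.elements.filter (p ∈ ·)

/-- The patch `ω_p`. -/
def patch (p : Pt d) : Set (Pt d) := interior (⋃ e ∈ M.star p, hull e)

/-- `h_p`, the diameter of the patch. -/
def hp (p : Pt d) : ℝ := Metric.diam (M.patch p)

/-- The patch of `p` in the mesh obtained by two uniform red refinements. Every red refinement
cuts off, at each vertex `p` of a simplex, the copy of this simplex under the homothety with centre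
`p` and ratio `1/2`, and this copy is the only subelement containing `p`. -/
def refinedPatch (p : Pt d) : Set (Pt d) := AffineMap.homothety p (1 / 4 : ℝ) '' M.patch p

open Classical in
/-- Sides that form the skeleton `γ_p^I` of the patch: interior sides containing `p`. -/
def skeletonSides (p : Pt d) : Finset (Finset (Pt d)) := M.interiorSides.filter (p ∈ ·)

open Classical in
/-- Sides that form `γ_p^N`: Neumann sides containing `p`. -/
def neumannSidesAt (p : Pt d) : Finset (Finset (Pt d)) := M.neumannSides.filter (p ∈ ·)

/-! ### Finite elements -/

/-- Continuous functions on the closed domain that are affine on every element. -/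
def IsP1 (v : Pt d → ℝ) : Prop :=
  ContinuousOn v M.closedDomain ∧
    ∀ e ∈ M.elements, ∃ A : Pt d →ᵃ[ℝ] ℝ, EqOn v A (hull e)

/-- The nodal basis function `φ_p`: on an element containing `p`, its value at `x` is the
barycentric coordinate of `x` that belongs to the vertex `p`; off the star of `p` it is zero (the
supremum of the empty set). The set below has at most one member. -/
def hat (p : Pt d) (x : Pt d) : ℝ :=
  sSup {t : ℝ | ∃ e ∈ M.elements, p ∈ e ∧ ∃ w : Pt d → ℝ, (∀ q ∈ e, 0 ≤ w q) ∧
    ∑ q ∈ e, w q = 1 ∧ ∑ q ∈ e, w q • q = x ∧ t = w p}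

end Mesh

/-- The barycentre of an element or a side. -/
def barycentre (e : Finset (Pt d)) : Pt d := e.centroid ℝ id

/-- The constant gradient on the element `e` of a piecewise affine function. -/
def elemGrad (v : Pt d → ℝ) (e : Finset (Pt d)) : Pt d := gradient v (barycentre e)

/-- The unit outward normal of the element `e` on its side `s`: the normalised component,
orthogonal to `s`, of the vector from the barycentre of `e` to that of `s`. -/
def outerNormal (e s : Finset (Pt d)) : Pt d :=
  let v := (vectorSpan ℝ (s : Set (Pt d)))ᗮ.starProjection (barycentre s - barycentre e)
  ‖v‖⁻¹ • v

/-- For a piecewise affine `v`: on a side of two elements `e₁`, `e₂` the jump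
`∇v|_{e₁} ⬝ n - ∇v|_{e₂} ⬝ n`, with `n` the outward normal of `e₁` (so that `-n` is the outward
normal of `e₂`); on a boundary side, the outward normal derivative. -/
def normalJump (M : Mesh d) (v : Pt d → ℝ) (s : Finset (Pt d)) : ℝ :=
  ∑ e ∈ M.elementsAt s, inner ℝ (elemGrad v e) (outerNormal e s)

/-! ### The space `H¹(Ω)` -/

/-- A function together with its (weak) gradient and its boundary values (trace). -/
structure Jet (d : ℕ) where
  val : Pt d → ℝ
  grad : Pt d → Pt d
  tr : Pt d → ℝ

namespace Jet

instance : Sub (Jet d) := ⟨fun u v => ⟨u.val - v.val, u.grad - v.grad, u.tr - v.tr⟩⟩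

/-- A finite element function with its piecewise gradient and its boundary values. -/
def ofFun (v : Pt d → ℝ) : Jet d := ⟨v, fun x => gradient v x, v⟩

/-- The product with a finite element function (product rule). -/
def mulFun (u : Jet d) (v : Pt d → ℝ) : Jet d :=
  ⟨fun x => u.val x * v x, fun x => v x • u.grad x + u.val x • gradient v x,
    fun x => u.tr x * v x⟩

end Jet

/-- `G` is the weak gradient of `u` on the open set `Ω`. -/
def IsWeakGradient (Ω : Set (Pt d)) (u : Pt d → ℝ) (G : Pt d → Pt d) : Prop :=
  ∀ η : Pt d → ℝ, ContDiff ℝ (⊤ : ℕ∞) η → HasCompactSupport η → tsupport η ⊆ Ω →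
    ∀ v : Pt d, ∫ x in Ω, u x * fderiv ℝ η x v = -∫ x in Ω, inner ℝ (G x) v * η x

namespace Mesh

variable (M : Mesh d)

/-- `u.tr` is the trace of `u` on `Γ`: the trace operator is the extension, continuous from
`H¹(Ω)` to `L²(Γ)`, of the restriction to `Γ` of Lipschitz functions. -/
def HasTrace (u : Jet d) : Prop :=
  MemLp u.tr 2 ((surf d).restrict M.Γ) ∧
  ∃ v : ℕ → Pt d → ℝ, (∀ n, ∃ K : ℝ≥0, LipschitzWith K (v n)) ∧
    Tendsto (fun n => eLpNorm (v n - u.val) 2 (volume.restrict M.Ω)) atTop (𝓝 0) ∧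
    Tendsto (fun n => eLpNorm (fun x => gradient (v n) x - u.grad x) 2 (volume.restrict M.Ω))
      atTop (𝓝 0) ∧
    Tendsto (fun n => eLpNorm (v n - u.tr) 2 ((surf d).restrict M.Γ)) atTop (𝓝 0)

/-- `u ∈ H¹(Ω)`, with gradient `u.grad` and trace `u.tr`. -/
def IsH1 (u : Jet d) : Prop :=
  MemLp u.val 2 (volume.restrict M.Ω) ∧ MemLp u.grad 2 (volume.restrict M.Ω) ∧
    IsWeakGradient M.Ω u.val u.grad ∧ M.HasTrace u

/-- The space `𝓗₀` of functions in `H¹(Ω)` with zero trace on the Dirichlet boundary. -/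
def IsTest (u : Jet d) : Prop :=
  M.IsH1 u ∧ ∀ᵐ x ∂(surf d).restrict M.ΓD, u.tr x = 0

/-- `u` vanishes outside `ω`. -/
def VanishesOff (ω : Set (Pt d)) (u : Jet d) : Prop :=
  ∀ᵐ x ∂volume.restrict M.Ω, x ∉ ω → u.val x = 0

/-! ### The obstacle problem -/

/-- Dirichlet data: continuous and piecewise affine on `Γ^D`. -/
def IsDirichletDatum (φD : Pt d → ℝ) : Prop :=
  ContinuousOn φD M.ΓD ∧ ∀ s ∈ M.dirichletSides, ∃ A : Pt d →ᵃ[ℝ] ℝ, EqOn φD A (hull s)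

/-- The bilinear form `a_ε(u,v) = ⟨ε² ∇u, ∇v⟩ + ⟨u, v⟩`. -/
def bilin (ε : ℝ) (u v : Jet d) : ℝ :=
  (∫ x in M.Ω, ε ^ 2 * inner ℝ (u.grad x) (v.grad x)) + ∫ x in M.Ω, u.val x * v.val x

/-- The load `⟨f, v⟩ + ⟨π, v⟩_{Γ^N}`. -/
def load (f π : Pt d → ℝ) (v : Jet d) : ℝ :=
  (∫ x in M.Ω, f x * v.val x) + ∫ x in M.ΓN, π x * v.tr x ∂surf d

/-- The functional `v ↦ ⟨f, v⟩ + ⟨π, v⟩_{Γ^N} - a_ε(u, v)`. For the solution `φ` of the continuous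
problem this is the constraining force `λ`; for the discrete solution `φ_m` it is the linear
residual `R^lin`, and its restriction to finite element functions is the discrete constraining
force `λ_m`. -/
def residual (ε : ℝ) (f π : Pt d → ℝ) (u v : Jet d) : ℝ := M.load f π v - M.bilin ε u v

/-- The admissible set `𝓚`. -/
def Admissible (φD : Pt d → ℝ) (g u : Jet d) : Prop :=
  M.IsH1 u ∧ (∀ᵐ x ∂(surf d).restrict M.ΓD, u.tr x = φD x) ∧
    ∀ᵐ x ∂volume.restrict M.Ω, u.val x ≤ g.val x

/-- `φ` solves the variational inequality with obstacle `g`. -/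
def IsSolution (ε : ℝ) (f π φD : Pt d → ℝ) (g φ : Jet d) : Prop :=
  M.Admissible φD g φ ∧
    ∀ ψ, M.Admissible φD g ψ → M.bilin ε φ (φ - ψ) ≤ M.load f π (φ - ψ)

/-- The discrete admissible set `𝓚_m`. -/
def DiscreteAdmissible (φD gm u : Pt d → ℝ) : Prop :=
  M.IsP1 u ∧ (∀ x ∈ M.ΓD, u x = φD x) ∧ ∀ x ∈ M.closedDomain, u x ≤ gm x

/-- `φm` solves the discrete variational inequality with obstacle `gm`. -/
def IsDiscreteSolution (ε : ℝ) (f π φD gm φm : Pt d → ℝ) : Prop :=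
  M.DiscreteAdmissible φD gm φm ∧
    ∀ ψ, M.DiscreteAdmissible φD gm ψ →
      M.bilin ε (.ofFun φm) (.ofFun φm - .ofFun ψ) ≤ M.load f π (.ofFun φm - .ofFun ψ)

/-! ### The quasi-discrete constraining force -/

/-- Full-contact nodes: `φ_m = g_m` on `ω_p`, and the linear residual is nonnegative on the
nonnegative functions of `𝓗₀` that vanish outside `ω_p`. -/
def IsFullContact (ε : ℝ) (f π gm φm : Pt d → ℝ) (p : Pt d) : Prop :=
  (∀ x ∈ M.patch p, φm x = gm x) ∧
    ∀ ψ, M.IsTest ψ → M.VanishesOff (M.patch p) ψ →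
      (∀ᵐ x ∂volume.restrict M.Ω, 0 ≤ ψ.val x) → 0 ≤ M.residual ε f π (.ofFun φm) ψ

/-- Semi-contact nodes. -/
def IsSemiContact (ε : ℝ) (f π gm φm : Pt d → ℝ) (p : Pt d) : Prop :=
  φm p = gm p ∧ ¬ M.IsFullContact ε f π gm φm p

open Classical in
/-- The weighted mean value `c_p(ψ)`; zero at Dirichlet nodes. -/
def weightedMean (p : Pt d) (ψ : Jet d) : ℝ :=
  if M.IsDirichletNode p then 0
  else (∫ x in M.refinedPatch p, ψ.val x * M.hat p x) / ∫ x in M.refinedPatch p, M.hat p x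

open Classical in
/-- The quasi-discrete constraining force `λ̃_m`. -/
def quasiForce (ε : ℝ) (f π gm φm : Pt d → ℝ) (ψ : Jet d) : ℝ :=
  (∑ p ∈ M.nodes.filter (M.IsSemiContact ε f π gm φm),
      M.residual ε f π (.ofFun φm) (.ofFun (M.hat p)) * M.weightedMean p ψ) +
    ∑ p ∈ M.nodes.filter (M.IsFullContact ε f π gm φm),
      M.residual ε f π (.ofFun φm) (ψ.mulFun (M.hat p))

/-! ### Norms and estimator contributions -/

/-- The local energy norm `‖u‖_{ε,ω}`. -/
def _root_.ObstacleFEM.energyNorm (ε : ℝ) (ω : Set (Pt d)) (u : Jet d) : ℝ :=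
  Real.sqrt (ε ^ 2 * (∫ x in ω, ‖u.grad x‖ ^ 2) + ∫ x in ω, u.val x ^ 2)

/-- The local dual norm `‖ℓ‖_{*,ε,ω}`: the supremum of `ℓ(ψ) / ‖ψ‖_ε` over all `ψ ∈ 𝓗₀` that vanish
outside `ω`. -/
def dualNorm (ε : ℝ) (ω : Set (Pt d)) (ℓ : Jet d → ℝ) : ℝ≥0∞ :=
  ⨆ (ψ : Jet d) (_ : M.IsTest ψ ∧ M.VanishesOff ω ψ),
    ENNReal.ofReal (ℓ ψ / energyNorm ε M.Ω ψ)

/-- The error measure on the patch,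
`‖φ - φ_m‖_{ε,ω_p} + ‖λ - λ̃_m‖_{*,ε,ω_p}`. -/
def localError (ε : ℝ) (f π gm φm : Pt d → ℝ) (φ : Jet d) (p : Pt d) : ℝ≥0∞ :=
  ENNReal.ofReal (energyNorm ε (M.patch p) (φ - .ofFun φm)) +
    M.dualNorm ε (M.patch p)
      (fun ψ => M.residual ε f π φ ψ - M.quasiForce ε f π gm φm ψ)

/-- The weight `min {h_p / ε, 1}`. -/
def weight (ε : ℝ) (p : Pt d) : ℝ := min (M.hp p / ε) 1

/-- `η_{1,p}`, the interior residual. -/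
def η₁ (ε : ℝ) (f φm : Pt d → ℝ) (p : Pt d) : ℝ :=
  M.weight ε p * Real.sqrt (∫ x in M.patch p, (f x - φm x) ^ 2)

/-- `η_{2,p}`, the jump contribution. -/
def η₂ (ε : ℝ) (φm : Pt d → ℝ) (p : Pt d) : ℝ :=
  Real.sqrt (M.weight ε p) * (Real.sqrt ε)⁻¹ *
    Real.sqrt (∑ s ∈ M.skeletonSides p,
      ∫ _ in hull s, (ε ^ 2 * normalJump M φm s) ^ 2 ∂surf d)

/-- `η_{3,p}`, the Neumann contribution. -/
def η₃ (ε : ℝ) (π φm : Pt d → ℝ) (p : Pt d) : ℝ :=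
  Real.sqrt (M.weight ε p) * (Real.sqrt ε)⁻¹ *
    Real.sqrt (∑ s ∈ M.neumannSidesAt p,
      ∫ x in hull s, (π x - ε ^ 2 * normalJump M φm s) ^ 2 ∂surf d)

/-- The oscillation of `f` on the patch: distance to the elementwise mean values. -/
def oscForce (ε : ℝ) (f : Pt d → ℝ) (p : Pt d) : ℝ :=
  M.weight ε p *
    Real.sqrt (∑ e ∈ M.star p, ∫ x in hull e, ((⨍ y in hull e, f y) - f x) ^ 2)

/-- The oscillation of the Neumann data: distance to the mean values on the sides. -/
def oscNeumann (ε : ℝ) (π : Pt d → ℝ) (p : Pt d) : ℝ :=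
  Real.sqrt (M.weight ε p) * (Real.sqrt ε)⁻¹ *
    Real.sqrt (∑ s ∈ M.neumannSidesAt p,
      ∫ x in hull s, ((⨍ y in hull s, π y ∂surf d) - π x) ^ 2 ∂surf d)

end Mesh

end ObstacleFEM

end

noncomputable section

namespace ObstacleFEM

variable {d : ℕ}

/-! Write R for the residual of φ_m, and let θ = 1 − Σ φ_q, summed over the full-contact nodes q
(`contactWeight`). If a test function ψ vanishes on every refined patch, all weighted means c_q(ψ)
are zero, so the semi-contact part of the quasi-discrete force does not see ψ, and R(ψ) minus the
full-contact part Σ R(ψ φ_q) is R(ψθ). Since R − λ = a_ε(φ − φ_m, ·), this gives R(ψθ) = a_ε(φ −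
φ_m, ψ) + ⟨λ − λ̃_m, ψ⟩. For ψ supported in the patch of p the right-hand side is at most the local
error times ‖ψ‖_ε (`LocalTest.test_bound`). Contact thus costs only the weight θ with values in [0,
1]; as p is not a full-contact node, θ ≥ φ_p, and φ_p is bounded below near the barycentre of every
element or side containing p.

What remains is the bubble-function technique for singularly perturbed problems. The bubbles are
cones supported near a barycentre, where all barycentric coordinates are below 3/4; on a refined
patch some coordinate is at least 3/4. In an element, `exists_ball_affine` finds a ball on which the
mean of f minus φ_m has one sign and is comparable to its maximum; a cone on that ball controls the
element residual up to oscillation (`element_test`, `exists_element_bound`). For a side, the cone is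
squeezed in the normal direction to width δ ~ α_p ε; the balance of ε² δ⁻² against the volume δ
makes the constants independent of ε (`side_test`, `sqrt_weight_mul_sqrt`, `exists_side_bound`). The
side bound contains η₁, which the element bound has already controlled.

Two ingredients support this. First, R(ψw) for Lipschitz ψ and piecewise affine w is rewritten as
volume and side integrals. Near the barycentre of a side the elements sharing it look like half
spaces, so the divergence theorem is needed only for half spaces
(`integral_inner_gradient_halfSpace`, `residual_mulFun_side`). Secondly, shape regularity and local
connectedness bound the number of elements at p and make their inradii comparable to h_p
(`exists_patchRegular`). -/

/-! ### Barycentric coordinates -/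

/-- A nondegenerate `d`-simplex, given by its vertices. -/
structure IsSimplex (e : Finset (Pt d)) : Prop where
  card : e.card = d + 1
  indep : AffineIndependent ℝ ((↑) : e → Pt d)

/-- The vertices of a simplex form an affine basis. -/
def IsSimplex.basis {e : Finset (Pt d)} (h : IsSimplex e) : AffineBasis e ℝ (Pt d) where
  toFun := (↑)
  ind' := h.indep
  tot' := by
    rw [h.indep.affineSpan_eq_top_iff_card_eq_finrank_add_one]
    simp [h.card]

open Classical in
/-- The barycentric coordinate of the simplex `e` belonging to the vertex `q` (zero if `q` is not a
vertex). -/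
def coord (e : Finset (Pt d)) (q : Pt d) : Pt d →ᵃ[ℝ] ℝ :=
  if h : IsSimplex e ∧ q ∈ e then h.1.basis.coord ⟨q, h.2⟩ else 0

theorem coord_of_notMem {e : Finset (Pt d)} {q : Pt d} (hq : q ∉ e) : coord e q = 0 := by
  simp [coord, hq]

theorem affine_sum {e : Finset (Pt d)} (A : Pt d →ᵃ[ℝ] ℝ) {w : Pt d → ℝ}
    (hw : ∑ q ∈ e, w q = 1) : A (∑ q ∈ e, w q • q) = ∑ q ∈ e, w q * A q := by
  have h1 := Finset.affineCombination_eq_linear_combination e id w hw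
  simp only [id] at h1
  rw [← h1, Finset.map_affineCombination e id w hw,
    Finset.affineCombination_eq_linear_combination _ _ _ hw]
  simp

namespace IsSimplex

variable {e : Finset (Pt d)} (h : IsSimplex e)
include h

theorem coord_eq {q : Pt d} (hq : q ∈ e) : coord e q = h.basis.coord ⟨q, hq⟩ := by
  simp [coord, h, hq]

theorem coord_self {q : Pt d} (hq : q ∈ e) : coord e q q = 1 := by
  rw [h.coord_eq hq]
  exact h.basis.coord_apply_eq ⟨q, hq⟩

theorem coord_ne {q q' : Pt d} (hq' : q' ∈ e) (hne : q ≠ q') : coord e q q' = 0 := by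
  by_cases hq : q ∈ e
  · rw [h.coord_eq hq]
    exact h.basis.coord_apply_ne (i := ⟨q, hq⟩) (j := ⟨q', hq'⟩) (by simpa using hne)
  · simp [coord_of_notMem hq]

theorem sum_coord (x : Pt d) : ∑ q ∈ e, coord e q x = 1 := by
  rw [← h.basis.sum_coord_apply_eq_one x, ← Finset.sum_coe_sort]
  exact Finset.sum_congr rfl fun q _ => by rw [h.coord_eq q.2]

theorem sum_coord_smul (x : Pt d) : ∑ q ∈ e, coord e q x • q = x := by
  rw [← Finset.sum_coe_sort]
  conv_rhs => rw [← h.basis.linear_combination_coord_eq_self x]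
  exact Finset.sum_congr rfl fun q _ => by rw [h.coord_eq q.2]; rfl

theorem coord_sum {w : Pt d → ℝ} (hw : ∑ q ∈ e, w q = 1) {q : Pt d} (hq : q ∈ e) :
    coord e q (∑ q ∈ e, w q • q) = w q := by
  rw [affine_sum _ hw, Finset.sum_eq_single q]
  · simp [h.coord_self hq]
  · intro q' hq' hne
    simp [h.coord_ne hq' hne.symm]
  · exact fun hq' => absurd hq hq'

theorem mem_hull_iff {x : Pt d} : x ∈ hull e ↔ ∀ q ∈ e, 0 ≤ coord e q x := by
  have : (e : Set (Pt d)) = range h.basis := by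
    change _ = range ((↑) : e → Pt d)
    simp
  rw [hull, this, h.basis.convexHull_eq_nonneg_coord]
  constructor
  · intro hx q hq
    rw [h.coord_eq hq]
    exact hx _
  · rintro hx ⟨q, hq⟩
    have := hx q hq
    rwa [h.coord_eq hq] at this

theorem mem_interior_iff {x : Pt d} : x ∈ interior (hull e) ↔ ∀ q ∈ e, 0 < coord e q x := by
  have : (e : Set (Pt d)) = range h.basis := by
    change _ = range ((↑) : e → Pt d)
    simp
  rw [hull, this, h.basis.interior_convexHull]
  constructor
  · intro hx q hq
    rw [h.coord_eq hq]
    exact hx _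
  · rintro hx ⟨q, hq⟩
    have := hx q hq
    rwa [h.coord_eq hq] at this

theorem coord_nonneg {x : Pt d} (hx : x ∈ hull e) (q : Pt d) : 0 ≤ coord e q x := by
  by_cases hq : q ∈ e
  · exact h.mem_hull_iff.1 hx q hq
  · simp [coord_of_notMem hq]

theorem coord_le_one {x : Pt d} (hx : x ∈ hull e) (q : Pt d) : coord e q x ≤ 1 := by
  by_cases hq : q ∈ e
  · rw [← h.sum_coord x]
    exact Finset.single_le_sum (f := fun q => coord e q x) (fun q _ => h.coord_nonneg hx q) hq
  · simp [coord_of_notMem hq]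

/-- Convex weights on a face, extended by zero, are barycentric coordinates for the whole simplex by
uniqueness. -/
theorem exists_weights {t : Finset (Pt d)} (ht : t ⊆ e) {x : Pt d} (hx : x ∈ hull t) :
    ∃ w : Pt d → ℝ, (∀ q ∈ t, coord e q x = w q) ∧ (∀ q, q ∉ t → coord e q x = 0) ∧
      ∑ q ∈ t, w q = 1 ∧ ∑ q ∈ t, w q • q = x := by
  classical
  obtain ⟨w, hw0, hw1, hwx⟩ := Finset.mem_convexHull'.1 hx
  set w' : Pt d → ℝ := fun q => if q ∈ t then w q else 0
  have h1 : ∑ q ∈ e, w' q = 1 := by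
    rw [← hw1, ← Finset.sum_subset ht]
    · exact Finset.sum_congr rfl fun q hq => by simp [w', hq]
    · intro q _ hq; simp [w', hq]
  have h2 : ∑ q ∈ e, w' q • q = x := by
    rw [← hwx, ← Finset.sum_subset ht]
    · exact Finset.sum_congr rfl fun q hq => by simp [w', hq]
    · intro q _ hq; simp [w', hq]
  refine ⟨w, fun q hq => ?_, fun q hq => ?_, hw1, hwx⟩
  · rw [← h2, h.coord_sum h1 (ht hq)]; simp [w', hq]
  · by_cases hqe : q ∈ e
    · rw [← h2, h.coord_sum h1 hqe]; simp [w', hq]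
    · simp [coord_of_notMem hqe]

theorem coord_eq_zero_of_mem_face {t : Finset (Pt d)} (ht : t ⊆ e) {x : Pt d} (hx : x ∈ hull t)
    {q : Pt d} (hq : q ∉ t) : coord e q x = 0 := by
  obtain ⟨w, -, h2, -⟩ := h.exists_weights ht hx
  exact h2 q hq

theorem mem_face {t : Finset (Pt d)} (ht : t ⊆ e) {x : Pt d} (hx : ∀ q ∈ t, 0 ≤ coord e q x)
    (hx' : ∀ q ∈ e, q ∉ t → coord e q x = 0) : x ∈ hull t := by
  refine Finset.mem_convexHull'.2 ⟨fun q => coord e q x, hx, ?_, ?_⟩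
  · rw [← h.sum_coord x]
    exact Finset.sum_subset ht fun q hq hqt => hx' q hq hqt
  · conv_rhs => rw [← h.sum_coord_smul x]
    exact Finset.sum_subset ht fun q hq hqt => by simp [hx' q hq hqt]

/-- Both sides are determined by the convex weights of the point on the common face, so the
coordinates do not depend on which simplex they are computed in. -/
theorem coord_eq_of_mem_face {e' : Finset (Pt d)} (h' : IsSimplex e') {t : Finset (Pt d)}
    (ht : t ⊆ e) (ht' : t ⊆ e') {x : Pt d} (hx : x ∈ hull t) (q : Pt d) :
    coord e q x = coord e' q x := by
  classical
  by_cases hq : q ∈ t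
  · obtain ⟨w, h1, h2, h3, h4⟩ := h.exists_weights ht hx
    set w' : Pt d → ℝ := fun q => if q ∈ t then w q else 0
    have k1 : ∑ q ∈ e', w' q = 1 := by
      rw [← h3, ← Finset.sum_subset ht']
      · exact Finset.sum_congr rfl fun q hq => by simp [w', hq]
      · intro q _ hq; simp [w', hq]
    have k2 : ∑ q ∈ e', w' q • q = x := by
      rw [← h4, ← Finset.sum_subset ht']
      · exact Finset.sum_congr rfl fun q hq => by simp [w', hq]
      · intro q _ hq; simp [w', hq]
    rw [h1 q hq]
    conv_rhs => rw [← k2, h'.coord_sum k1 (ht' hq)]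
    simp [w', hq]
  · rw [h.coord_eq_zero_of_mem_face ht hx hq, h'.coord_eq_zero_of_mem_face ht' hx hq]

theorem nonempty : e.Nonempty := Finset.card_pos.1 (by rw [h.card]; omega)

end IsSimplex

/-! ### Barycentres, interiors and boundaries of simplices -/

theorem barycentre_eq {t : Finset (Pt d)} (ht : t.Nonempty) :
    barycentre t = ∑ q ∈ t, (t.card : ℝ)⁻¹ • q := by
  rw [barycentre, Finset.centroid_def,
    Finset.affineCombination_eq_linear_combination _ _ _
      (t.sum_centroidWeights_eq_one_of_nonempty ℝ ht)]
  simp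

theorem barycentre_mem_hull {t : Finset (Pt d)} (ht : t.Nonempty) : barycentre t ∈ hull t := by
  rw [barycentre_eq ht]
  refine Finset.mem_convexHull'.2 ⟨fun _ => (t.card : ℝ)⁻¹, fun _ _ => by positivity, ?_, rfl⟩
  have : (t.card : ℝ) ≠ 0 := by exact_mod_cast ht.card_ne_zero
  simp [this]

theorem IsSimplex.coord_barycentre {e : Finset (Pt d)} (h : IsSimplex e) {t : Finset (Pt d)}
    (ht : t ⊆ e) (htne : t.Nonempty) {q : Pt d} (hq : q ∈ t) :
    coord e q (barycentre t) = (t.card : ℝ)⁻¹ := by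
  classical
  have h0 : (t.card : ℝ) ≠ 0 := by exact_mod_cast htne.card_ne_zero
  set w' : Pt d → ℝ := fun q => if q ∈ t then (t.card : ℝ)⁻¹ else 0
  have k1 : ∑ q ∈ e, w' q = 1 := by
    rw [← Finset.sum_subset ht (f := w')]
    · rw [Finset.sum_congr rfl (g := fun _ => (t.card : ℝ)⁻¹) fun q hq => by simp [w', hq]]
      simp [h0]
    · intro q _ hq; simp [w', hq]
  have k2 : ∑ q ∈ e, w' q • q = barycentre t := by
    rw [barycentre_eq htne, ← Finset.sum_subset ht (f := fun q => w' q • q)]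
    · exact Finset.sum_congr rfl fun q hq => by simp [w', hq]
    · intro q _ hq; simp [w', hq]
  rw [← k2, h.coord_sum k1 (ht hq)]
  simp [w', hq]

theorem isCompact_hull (e : Finset (Pt d)) : IsCompact (hull e) :=
  Set.Finite.isCompact_convexHull (𝕜 := ℝ) (Finset.finite_toSet e)

theorem isClosed_hull (e : Finset (Pt d)) : IsClosed (hull e) := (isCompact_hull e).isClosed

theorem convex_hull' (e : Finset (Pt d)) : Convex ℝ (hull e) := convex_convexHull ℝ _

theorem measurableSet_hull (e : Finset (Pt d)) : MeasurableSet (hull e) :=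
  (isClosed_hull e).measurableSet

theorem IsSimplex.barycentre_mem_interior {e : Finset (Pt d)} (h : IsSimplex e) :
    barycentre e ∈ interior (hull e) := by
  rw [h.mem_interior_iff]
  intro q hq
  rw [h.coord_barycentre subset_rfl h.nonempty hq, h.card]
  positivity

theorem IsSimplex.closure_interior {e : Finset (Pt d)} (h : IsSimplex e) :
    closure (interior (hull e)) = hull e := by
  have hne : (interior (hull e)).Nonempty := ⟨_, h.barycentre_mem_interior⟩
  rw [Convex.closure_interior_eq_closure_of_nonempty_interior (𝕜 := ℝ) (convex_hull' e) hne,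
    (isClosed_hull e).closure_eq]

theorem volume_hull_diff_interior (e : Finset (Pt d)) :
    volume (hull e \ interior (hull e)) = 0 := by
  have := (convex_hull' e).addHaar_frontier volume
  rwa [frontier, (isClosed_hull e).closure_eq] at this

/-- An affine function whose values on a ball of radius `r` lie in `[0, 1]` has Lipschitz constant
`1 / (2 r)`. -/
theorem affine_lipschitz_of_ball {A : Pt d →ᵃ[ℝ] ℝ} {c : Pt d} {r : ℝ} (hr : 0 < r)
    (hA : ∀ x ∈ Metric.closedBall c r, 0 ≤ A x ∧ A x ≤ 1) (x y : Pt d) :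
    |A x - A y| ≤ (2 * r)⁻¹ * ‖x - y‖ := by
  by_cases hxy : x - y = 0
  · rw [sub_eq_zero.1 hxy]; simp
  have hn : 0 < ‖x - y‖ := norm_pos_iff.2 hxy
  -- Both c + v and c − v lie in the ball, so the linear part of A takes values in [−1/2, 1/2] at v,
  -- a vector of length r parallel to x − y.
  set v := (r / ‖x - y‖) • (x - y)
  have hv : ‖v‖ = r := by
    rw [norm_smul, Real.norm_of_nonneg (by positivity)]
    field_simp
  have hl : A.linear (x - y) = A x - A y := by
    have := A.linearMap_vsub x y
    simpa using this
  have h1 := hA (v + c) (by simp [hv])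
  have h2 := hA (-v + c) (by simp [hv])
  have e1 : A (v + c) = A.linear v + A c := A.map_vadd c v
  have e2 : A (-v + c) = A.linear (-v) + A c := A.map_vadd c (-v)
  have ev : A.linear v = (r / ‖x - y‖) * (A x - A y) := by
    rw [← hl]; simp [v]
  rw [e1, ev] at h1
  rw [e2, map_neg, ev] at h2
  have : |(r / ‖x - y‖) * (A x - A y)| ≤ 1 / 2 := by
    rw [abs_le]; constructor <;> linarith [h1.1, h1.2, h2.1, h2.2]
  rw [abs_mul, abs_of_pos (by positivity : 0 < r / ‖x - y‖)] at this
  rw [inv_mul_eq_div, le_div_iff₀ (by positivity)]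
  rw [div_mul_eq_mul_div, div_le_iff₀ hn] at this
  linarith

/-! ### Hyperplanes, surface measure and integration by parts on half spaces -/

section Hyperplane

variable {d : ℕ}

/-- The signed distance of `x` to the hyperplane through `m` with normal `ν`. -/
def signedDist (m ν x : Pt d) : ℝ := inner ℝ ν (x - m)

/-- The hyperplane through `m` with normal `ν`. -/
def plane (m ν : Pt d) : Set (Pt d) := {x | signedDist m ν x = 0}

/-- The orthogonal projection to the hyperplane through `m` with unit normal `ν`. -/
def planeProj (m ν x : Pt d) : Pt d := x - signedDist m ν x • ν

theorem mem_plane {m ν x : Pt d} : x ∈ plane m ν ↔ signedDist m ν x = 0 := Iff.rfl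

theorem continuous_signedDist (m ν : Pt d) : Continuous (signedDist m ν) := by
  unfold signedDist; fun_prop

theorem continuous_planeProj (m ν : Pt d) : Continuous (planeProj m ν) :=
  continuous_id.sub ((continuous_signedDist m ν).smul continuous_const)

theorem isClosed_plane (m ν : Pt d) : IsClosed (plane m ν) :=
  isClosed_eq (continuous_signedDist m ν) continuous_const

theorem measurableSet_plane (m ν : Pt d) : MeasurableSet (plane m ν) :=
  (isClosed_plane m ν).measurableSet

theorem signedDist_add (m ν x y : Pt d) : signedDist m ν (x + y) = signedDist m ν x + inner ℝ ν y := by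
  rw [signedDist, signedDist, ← inner_add_right]; congr 1; abel

theorem signedDist_self (m ν : Pt d) : signedDist m ν m = 0 := by simp [signedDist]

variable {m ν : Pt d} (hν : ‖ν‖ = 1)
include hν

theorem inner_self_unit : inner ℝ ν ν = 1 := by
  rw [real_inner_self_eq_norm_sq, hν, one_pow]

theorem signedDist_planeProj (x : Pt d) : signedDist m ν (planeProj m ν x) = 0 := by
  rw [planeProj, sub_eq_add_neg, signedDist_add, inner_neg_right, inner_smul_right,
    inner_self_unit hν]
  ring

theorem abs_signedDist_sub_le (x y : Pt d) :
    |signedDist m ν x - signedDist m ν y| ≤ ‖x - y‖ := by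
  have : signedDist m ν x - signedDist m ν y = inner ℝ ν (x - y) := by
    rw [signedDist, signedDist, ← inner_sub_right]; congr 1; abel
  rw [this]
  simpa [hν] using abs_real_inner_le_norm ν (x - y)

theorem norm_planeProj_sub (x : Pt d) : ‖x - planeProj m ν x‖ = |signedDist m ν x| := by
  simp [planeProj, norm_smul, hν]

/-- Pythagoras: the projected difference and the normal component are orthogonal. -/
theorem norm_planeProj_sub_le {c : Pt d} (hc : c ∈ plane m ν) (x : Pt d) :
    ‖planeProj m ν x - c‖ ≤ ‖x - c‖ := by
  have h1 : inner ℝ (planeProj m ν x - c) (signedDist m ν x • ν) = 0 := by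
    have h2 := signedDist_planeProj (m := m) hν x
    have h3 : signedDist m ν c = 0 := hc
    rw [inner_smul_right, real_inner_comm]
    have : inner ℝ ν (planeProj m ν x - c) =
        signedDist m ν (planeProj m ν x) - signedDist m ν c := by
      rw [signedDist, signedDist, ← inner_sub_right]; congr 1; abel
    rw [this, h2, h3]; simp
  have h4 : x - c = (planeProj m ν x - c) + signedDist m ν x • ν := by
    simp only [planeProj]; abel
  have h5 := norm_add_sq_eq_norm_sq_add_norm_sq_of_inner_eq_zero _ _ h1
  rw [← h4] at h5
  nlinarith [norm_nonneg (planeProj m ν x - c), norm_nonneg (x - c),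
    mul_self_nonneg ‖signedDist m ν x • ν‖]

end Hyperplane

/-! ### Fubini in slabs and the surface measure of discs -/

section Fubini

variable {n : ℕ} {m ν : Pt (n + 1)} (hν : ‖ν‖ = 1)
include hν

-- Fubini along ν: every slice of the set by a parallel hyperplane inside the slab is a translate of
-- the same part of the plane, and the other slices are empty.
open scoped Pointwise in
theorem volume_slab_inter (a b : ℝ) {A : Set (Pt (n + 1))} (hA : MeasurableSet A) :
    volume (signedDist m ν ⁻¹' Ioo a b ∩ planeProj m ν ⁻¹' A) =
      ENNReal.ofReal (b - a) * surf (n + 1) (plane m ν ∩ A) := by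
  have hν0 : ν ≠ 0 := by rintro rfl; simp at hν
  have hmeas : MeasurableSet (signedDist m ν ⁻¹' Ioo a b ∩ planeProj m ν ⁻¹' A) :=
    ((continuous_signedDist m ν).measurable measurableSet_Ioo).inter
      ((continuous_planeProj m ν).measurable hA)
  have key := EuclideanGeometry.euclideanHausdorffMeasure_eq_lintegral m hν0 hmeas
  rw [InnerProductSpace.euclideanHausdorffMeasure_eq_volume] at key
  rw [key]
  have hfr : Module.finrank ℝ (Pt (n + 1)) = n + 1 := by simp
  have hnorm : ‖ν‖ₑ = 1 := by rw [← ofReal_norm, hν]; simp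
  have hsec : ∀ x : ℝ, Measure.euclideanHausdorffMeasure (Module.finrank ℝ (Pt (n + 1)) - 1)
      (signedDist m ν ⁻¹' Ioo a b ∩ planeProj m ν ⁻¹' A ∩
        (AffineSubspace.mk' (x • ν +ᵥ m) (Submodule.span ℝ {ν})ᗮ : Set (Pt (n + 1)))) =
      (Ioo a b).indicator (fun _ => surf (n + 1) (plane m ν ∩ A)) x := by
    intro x
    rw [hfr]
    have hmem : ∀ y : Pt (n + 1), y ∈ (AffineSubspace.mk' (x • ν +ᵥ m) (Submodule.span ℝ {ν})ᗮ :
        Set (Pt (n + 1))) ↔ signedDist m ν y = x := by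
      intro y
      rw [SetLike.mem_coe, AffineSubspace.mem_mk', Submodule.mem_orthogonal_singleton_iff_inner_right]
      simp only [signedDist, vsub_eq_sub, vadd_eq_add]
      rw [show y - (x • ν + m) = (y - m) - x • ν by abel, inner_sub_right, inner_smul_right,
        inner_self_unit hν]
      constructor <;> intro h <;> linarith
    by_cases hx : x ∈ Ioo a b
    · rw [indicator_of_mem hx]
      have : signedDist m ν ⁻¹' Ioo a b ∩ planeProj m ν ⁻¹' A ∩
        (AffineSubspace.mk' (x • ν +ᵥ m) (Submodule.span ℝ {ν})ᗮ : Set (Pt (n + 1))) =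
          (x • ν) +ᵥ (plane m ν ∩ A) := by
        ext y
        rw [mem_vadd_set_iff_neg_vadd_mem]
        simp only [mem_inter_iff, hmem, mem_preimage]
        simp only [vadd_eq_add]
        have e1 : -(x • ν) + y = y + -(x • ν) := by abel
        have e2 : signedDist m ν (y + -(x • ν)) = signedDist m ν y - x := by
          rw [signedDist_add, inner_neg_right, inner_smul_right, inner_self_unit hν]; ring
        rw [e1, mem_plane, e2]
        constructor
        · rintro ⟨⟨h1, h2⟩, h3⟩
          refine ⟨by linarith, ?_⟩
          rwa [planeProj, h3, sub_eq_add_neg] at h2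
        · rintro ⟨h1, h2⟩
          have h3 : signedDist m ν y = x := by linarith
          refine ⟨⟨by rwa [h3], ?_⟩, h3⟩
          rwa [planeProj, h3, sub_eq_add_neg]
      rw [this]
      exact measure_vadd _ _ _
    · rw [indicator_of_notMem hx]
      convert measure_empty (μ := surf (n + 1))
      rw [eq_empty_iff_forall_notMem]
      rintro y ⟨⟨h1, -⟩, h2⟩
      rw [hmem] at h2
      rw [mem_preimage, h2] at h1
      exact hx h1
  rw [hnorm, one_mul]
  simp_rw [hsec]
  rw [lintegral_indicator measurableSet_Ioo, lintegral_const, Measure.restrict_apply_univ,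
    Real.volume_Ioo, mul_comm]

/-- This form of Fubini turns integrals over the plane into integrals over a thin slab, where they
can be compared with volume integrals. -/
theorem map_planeProj (a b : ℝ) :
    (volume.restrict (signedDist m ν ⁻¹' Ioo a b)).map (planeProj m ν) =
      ENNReal.ofReal (b - a) • (surf (n + 1)).restrict (plane m ν) := by
  ext A hA
  rw [Measure.map_apply (continuous_planeProj m ν).measurable hA,
    Measure.restrict_apply ((continuous_planeProj m ν).measurable hA), inter_comm,
    volume_slab_inter hν a b hA, Measure.smul_apply, Measure.restrict_apply hA, inter_comm A,
    smul_eq_mul]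

theorem integral_comp_planeProj {a b : ℝ} (hab : a ≤ b) {u : Pt (n + 1) → ℝ} (hu : Continuous u) :
    ∫ x in signedDist m ν ⁻¹' Ioo a b, u (planeProj m ν x) =
      (b - a) * ∫ x in plane m ν, u x ∂surf (n + 1) := by
  have := integral_map (μ := volume.restrict (signedDist m ν ⁻¹' Ioo a b))
    (continuous_planeProj m ν).aemeasurable (f := u)
    hu.measurable.aestronglyMeasurable
  rw [← this, map_planeProj hν, integral_smul_measure, ENNReal.toReal_ofReal (by linarith),
    smul_eq_mul]

/-- The volume of the unit ball in dimension `n`. -/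
def unitBallVolume (n : ℕ) : ℝ :=
  (volume (Metric.closedBall (0 : EuclideanSpace ℝ (Fin n)) 1)).toReal

omit hν in
theorem unitBallVolume_pos (n : ℕ) : 0 < unitBallVolume n :=
  ENNReal.toReal_pos (Metric.measure_closedBall_pos _ _ one_pos).ne'
    (isCompact_closedBall _ _).measure_lt_top.ne

omit hν in
theorem volume_closedBall_eq {n : ℕ} (c : EuclideanSpace ℝ (Fin n)) {R : ℝ} (hR : 0 ≤ R) :
    volume (Metric.closedBall c R) = ENNReal.ofReal (R ^ n * unitBallVolume n) := by
  rw [Measure.addHaar_closedBall' volume c hR, ENNReal.ofReal_mul (by positivity), unitBallVolume,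
    ENNReal.ofReal_toReal (isCompact_closedBall _ _).measure_lt_top.ne]
  simp

/-- An orthonormal basis of the orthogonal complement of ν gives an isometry from an n-dimensional
Euclidean space that maps a ball onto the disc; Hausdorff measure is preserved and agrees with
Lebesgue measure there. -/
theorem surf_plane_inter_closedBall {c : Pt (n + 1)} (hc : c ∈ plane m ν) {R : ℝ} (hR : 0 ≤ R) :
    surf (n + 1) (plane m ν ∩ Metric.closedBall c R) =
      ENNReal.ofReal (R ^ n * unitBallVolume n) := by
  have hν0 : ν ≠ 0 := by rintro rfl; simp at hν
  have : Fact (Module.finrank ℝ (Pt (n + 1)) = n + 1) := ⟨by simp⟩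
  let b := OrthonormalBasis.fromOrthogonalSpanSingleton (𝕜 := ℝ) n hν0
  let j : EuclideanSpace ℝ (Fin n) → Pt (n + 1) := fun y => ((b.repr.symm y : _) : Pt (n + 1)) + c
  have hj : Isometry j := by
    refine Isometry.of_dist_eq fun x y => ?_
    simp only [j, dist_add_right]
    exact b.repr.symm.dist_map x y
  have himg : j '' Metric.closedBall 0 R = plane m ν ∩ Metric.closedBall c R := by
    have hpl : ∀ y, signedDist m ν y = inner ℝ ν (y - c) := by
      intro y
      have : signedDist m ν c = 0 := hc
      rw [← sub_zero (signedDist m ν y), ← this, signedDist, signedDist, ← inner_sub_right]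
      congr 1; abel
    ext y
    constructor
    · rintro ⟨z, hz, rfl⟩
      have hz' : ‖z‖ ≤ R := by simpa using hz
      refine ⟨?_, ?_⟩
      · rw [mem_plane, hpl]
        simp only [j, add_sub_cancel_right]
        exact Submodule.mem_orthogonal_singleton_iff_inner_right.1 (b.repr.symm z).2
      · simp only [j, Metric.mem_closedBall, dist_eq_norm, add_sub_cancel_right]
        exact (b.repr.symm.norm_map z).trans_le hz'
    · rintro ⟨h1, h2⟩
      rw [mem_plane, hpl] at h1
      refine ⟨b.repr ⟨y - c, Submodule.mem_orthogonal_singleton_iff_inner_right.2 h1⟩, ?_, ?_⟩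
      · rw [Metric.mem_closedBall, dist_zero_right, b.repr.norm_map, Submodule.coe_norm]
        simpa [dist_eq_norm] using h2
      · simp [j]
  rw [← himg]
  change Measure.euclideanHausdorffMeasure n _ = _
  rw [hj.euclideanHausdorffMeasure_image, EuclideanSpace.euclideanHausdorffMeasure_eq_volume,
    volume_closedBall_eq _ hR]

/-- Projection to the plane does not increase the distance to c, so the set lies in a cylinder over
the disc. The factor b − a is what later makes the squeezed bumps small. -/
theorem volume_slab_inter_closedBall_le (a b : ℝ) {c : Pt (n + 1)} (hc : c ∈ plane m ν) {R : ℝ}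
    (hR : 0 ≤ R) : volume (signedDist m ν ⁻¹' Ioo a b ∩ Metric.closedBall c R) ≤
      ENNReal.ofReal (b - a) * ENNReal.ofReal (R ^ n * unitBallVolume n) := by
  rw [← surf_plane_inter_closedBall hν hc hR,
    ← volume_slab_inter hν a b Metric.isClosed_closedBall.measurableSet]
  refine measure_mono (inter_subset_inter_right _ fun x hx => ?_)
  rw [mem_preimage, mem_closedBall_iff_norm]
  exact (norm_planeProj_sub_le hν hc x).trans (mem_closedBall_iff_norm.1 hx)

theorem volume_signedDist_eq (c : ℝ) : volume {x | signedDist m ν x = c} = 0 := by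
  have hν0 : ν ≠ 0 := by rintro rfl; simp at hν
  have hc : {x | signedDist m ν x = c} =
      (AffineSubspace.mk' (c • ν + m) (Submodule.span ℝ {ν})ᗮ : Set (Pt (n + 1))) := by
    ext y
    rw [SetLike.mem_coe, AffineSubspace.mem_mk', Submodule.mem_orthogonal_singleton_iff_inner_right]
    rw [vsub_eq_sub, show y - (c • ν + m) = (y - m) - c • ν by abel,
      inner_sub_right _ _ (c • ν), inner_smul_right,
      inner_self_unit hν, ← signedDist, mem_ofPred_eq]
    constructor <;> intro h <;> linarith
  rw [hc]
  refine Measure.addHaar_affineSubspace _ _ fun h => ?_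
  have h1 : ν ∈ (Submodule.span ℝ {ν})ᗮ := by
    have : (AffineSubspace.mk' (c • ν + m) (Submodule.span ℝ {ν})ᗮ).direction = ⊤ := by
      rw [h, AffineSubspace.direction_top]
    rw [AffineSubspace.direction_mk'] at this
    rw [this]; trivial
  rw [Submodule.mem_orthogonal_singleton_iff_inner_right, inner_self_unit hν] at h1
  norm_num at h1

end Fubini

/-! ### Gradients of compactly supported Lipschitz functions -/

section Lipschitz

variable {d : ℕ} {u : Pt d → ℝ} {L : ℝ≥0}

theorem inner_gradient_eq (u : Pt d → ℝ) (x w : Pt d) :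
    inner ℝ (gradient u x) w = fderiv ℝ u x w := by
  rw [gradient, InnerProductSpace.toDual_symm_apply]

theorem integrable_lineDeriv_of_lipschitz (hu : LipschitzWith L u) (hc : HasCompactSupport u)
    (w : Pt d) : Integrable (fun x => lineDeriv ℝ u x w) := by
  have h1 : IntegrableOn (fun x => lineDeriv ℝ u x w) (tsupport u) :=
    Measure.integrableOn_of_bounded (M := L * ‖w‖) hc.isCompact.measure_lt_top.ne
      (measurable_lineDeriv hu.continuous).aestronglyMeasurable
      (Eventually.of_forall fun x => norm_lineDeriv_le_of_lipschitz ℝ hu)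
  refine (integrableOn_iff_integrable_of_support_subset fun x hx => ?_).1 h1
  by_contra hx'
  refine hx ?_
  have h0 : u =ᶠ[𝓝 x] fun _ => 0 := notMem_tsupport_iff_eventuallyEq.1 hx'
  show lineDeriv ℝ u x w = 0
  rw [Filter.EventuallyEq.lineDeriv_eq h0]
  simp [lineDeriv]

/-- Integration by parts against the constant function 1; Rademacher's theorem identifies line
derivatives with the gradient almost everywhere. -/
theorem integral_inner_gradient_eq_zero (hu : LipschitzWith L u) (hc : HasCompactSupport u)
    (w : Pt d) : ∫ x, inner ℝ (gradient u x) w = 0 := by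
  have h := (LipschitzWith.const' (α := Pt d) (K := 0) (1 : ℝ)).integral_lineDeriv_mul_eq
    (μ := volume) hu hc (-w)
  have h0 : ∀ x : Pt d, lineDeriv ℝ (fun _ : Pt d => (1 : ℝ)) x (-w) = 0 := by simp [lineDeriv]
  simp only [h0, zero_mul, integral_zero, neg_neg, mul_one] at h
  rw [h]
  refine integral_congr_ae ?_
  filter_upwards [hu.ae_differentiableAt] with x hx
  rw [hx.lineDeriv_eq_fderiv, inner_gradient_eq]

end Lipschitz

/-! ### The divergence theorem on a half space -/

section HalfSpace

variable {n : ℕ} {m ν : Pt (n + 1)}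

/-- A Lipschitz cutoff function: `1` on the half space behind the hyperplane, `0` at distance
`1 / k` in front of it. -/
def planeCutoff (m ν : Pt (n + 1)) (k : ℝ) (x : Pt (n + 1)) : ℝ :=
  max 0 (min 1 (1 - k * signedDist m ν x))

theorem planeCutoff_nonneg (k : ℝ) (x : Pt (n + 1)) : 0 ≤ planeCutoff m ν k x := le_max_left _ _

theorem planeCutoff_le_one (k : ℝ) (x : Pt (n + 1)) : planeCutoff m ν k x ≤ 1 :=
  max_le zero_le_one (min_le_left _ _)

theorem lipschitz_planeCutoff (hν : ‖ν‖ = 1) {k : ℝ} (hk : 0 < k) :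
    LipschitzWith k.toNNReal (planeCutoff m ν k) := by
  refine LipschitzWith.const_max (LipschitzWith.const_min (LipschitzWith.of_dist_le_mul
    fun x y => ?_) 1) 0
  rw [Real.dist_eq, Real.coe_toNNReal _ hk.le, dist_eq_norm]
  have := abs_signedDist_sub_le (m := m) hν y x
  rw [show (1 - k * signedDist m ν x - (1 - k * signedDist m ν y)) =
    k * (signedDist m ν y - signedDist m ν x) by ring, abs_mul, abs_of_pos hk, norm_sub_rev]
  gcongr

theorem lineDeriv_planeCutoff {k : ℝ} (hk : 0 < k) {x : Pt (n + 1)} (w : Pt (n + 1))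
    (h0 : signedDist m ν x ≠ 0) (h1 : signedDist m ν x ≠ 1 / k) :
    lineDeriv ℝ (planeCutoff m ν k) x w =
      (signedDist m ν ⁻¹' Ioo 0 (1 / k)).indicator (fun _ => -(k * inner ℝ ν w)) x := by
  have hc : Continuous fun s : ℝ => signedDist m ν (x + s • w) :=
    (continuous_signedDist m ν).comp (by fun_prop)
  have hc0 : signedDist m ν (x + (0 : ℝ) • w) = signedDist m ν x := by simp
  have hT : Tendsto (fun s : ℝ => signedDist m ν (x + s • w)) (𝓝 0) (𝓝 (signedDist m ν x)) := by
    simpa [hc0] using hc.tendsto 0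
  have hlin : ∀ s : ℝ, signedDist m ν (x + s • w) = signedDist m ν x + s * inner ℝ ν w := by
    intro s; rw [signedDist_add, inner_smul_right]
  apply HasLineDerivAt.lineDeriv
  rw [HasLineDerivAt]
  -- Along the line the cutoff is locally constant 1 behind the plane, affine inside the slab and
  -- constant 0 beyond it.
  rcases lt_or_gt_of_ne h0 with h | h
  · rw [indicator_of_notMem (by simp [h.le])]
    refine (hasDerivAt_const (0 : ℝ) (1 : ℝ)).congr_of_eventuallyEq ?_
    filter_upwards [hT.eventually (gt_mem_nhds h)] with s hs
    rw [planeCutoff, min_eq_left (by nlinarith), max_eq_right zero_le_one]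
  rcases lt_or_gt_of_ne h1 with h' | h'
  · rw [indicator_of_mem (show x ∈ signedDist m ν ⁻¹' Ioo 0 (1 / k) from ⟨h, h'⟩)]
    have hd : HasDerivAt (fun s : ℝ => 1 - k * (signedDist m ν x + s * inner ℝ ν w))
        (-(k * inner ℝ ν w)) 0 := by
      have := ((((hasDerivAt_id (0 : ℝ)).mul_const (inner ℝ ν w)).const_add
        (signedDist m ν x)).const_mul k).const_sub 1
      simpa using this
    refine hd.congr_of_eventuallyEq ?_
    filter_upwards [hT.eventually (lt_mem_nhds h), hT.eventually (gt_mem_nhds h')] with s hs hs'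
    rw [lt_div_iff₀ hk] at hs'
    rw [planeCutoff, min_eq_right (by nlinarith), max_eq_right (by nlinarith), hlin]
  · rw [indicator_of_notMem (by simp only [mem_preimage, mem_Ioo, not_and, not_lt]; exact fun _ => h'.le)]
    refine (hasDerivAt_const (0 : ℝ) (0 : ℝ)).congr_of_eventuallyEq ?_
    filter_upwards [hT.eventually (lt_mem_nhds h')] with s hs
    rw [div_lt_iff₀ hk] at hs
    rw [planeCutoff, max_eq_left ((min_le_right _ _).trans (by nlinarith))]

variable (hν : ‖ν‖ = 1) {u : Pt (n + 1) → ℝ} {L : ℝ≥0} (hu : LipschitzWith L u)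
  (hc : HasCompactSupport u)
include hν hu hc

/-- The derivative moves onto the cutoff, whose directional derivative lives on the slab of width 1
/ k only. -/
theorem integral_lineDeriv_mul_planeCutoff {k : ℝ} (hk : 0 < k) (w : Pt (n + 1)) :
    ∫ x, lineDeriv ℝ u x w * planeCutoff m ν k x =
      inner ℝ ν w * (k * ∫ x in signedDist m ν ⁻¹' Ioo 0 (1 / k), u x) := by
  have h := (lipschitz_planeCutoff (m := m) hν hk).integral_lineDeriv_mul_eq (μ := volume) hu hc (-w)
  simp only [neg_neg] at h
  rw [← h]
  have hae : ∀ᵐ x, lineDeriv ℝ (planeCutoff m ν k) x (-w) * u x =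
      (signedDist m ν ⁻¹' Ioo 0 (1 / k)).indicator (fun x => (k * inner ℝ ν w) * u x) x := by
    have z0 := volume_signedDist_eq (m := m) hν 0
    have z1 := volume_signedDist_eq (m := m) hν (1 / k)
    rw [← compl_compl {x | signedDist m ν x = 0}, ← mem_ae_iff] at z0
    rw [← compl_compl {x | signedDist m ν x = 1 / k}, ← mem_ae_iff] at z1
    filter_upwards [z0, z1] with x h0 h1
    rw [lineDeriv_planeCutoff hk (-w) h0 h1]
    by_cases hx : x ∈ signedDist m ν ⁻¹' Ioo 0 (1 / k)
    · rw [indicator_of_mem hx, indicator_of_mem hx, inner_neg_right]; ring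
    · rw [indicator_of_notMem hx, indicator_of_notMem hx, zero_mul]
  rw [integral_congr_ae hae,
    integral_indicator ((continuous_signedDist m ν).measurable measurableSet_Ioo),
    integral_const_mul]
  ring

/-- With slab width a, the values at x and at its projection differ by at most La, and the part of
the slab that matters has volume aB. The error of the average is thus at most a⁻¹ · La · aB = LBa.
-/
theorem tendsto_integral_slab :
    Tendsto (fun k : ℕ => ((k : ℝ) + 1) * ∫ x in signedDist m ν ⁻¹' Ioo 0 (1 / ((k : ℝ) + 1)), u x)
      atTop (𝓝 (∫ x in plane m ν, u x ∂surf (n + 1))) := by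
  obtain ⟨R, hR0, hR⟩ : ∃ R : ℝ, 0 ≤ R ∧ ∀ x, R < ‖x - m‖ → u x = 0 := by
    obtain ⟨R, hR⟩ := hc.isCompact.isBounded.subset_closedBall m
    refine ⟨max R 0, le_max_right _ _, fun x hx => image_eq_zero_of_notMem_tsupport fun hx' => ?_⟩
    have := hR hx'
    rw [mem_closedBall_iff_norm] at this
    exact absurd (hx.trans_le this) (not_lt.2 (le_max_left _ _))
  set B := R ^ n * unitBallVolume n
  have hB : 0 ≤ B := by have := unitBallVolume_pos n; positivity
  have hm : m ∈ plane m ν := signedDist_self m ν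
  have hucont : Continuous u := hu.continuous
  have hint : Integrable u := hucont.integrable_of_hasCompactSupport hc
  have bound : ∀ k : ℕ, |((k : ℝ) + 1) * (∫ x in signedDist m ν ⁻¹' Ioo 0 (1 / ((k : ℝ) + 1)), u x) -
      (∫ x in plane m ν, u x ∂surf (n + 1))| ≤ (L * B) * (1 / ((k : ℝ) + 1)) := by
    intro k
    have hk : (0 : ℝ) < (k : ℝ) + 1 := by positivity
    set a : ℝ := 1 / ((k : ℝ) + 1) with ha
    have ha0 : 0 < a := by positivity
    have hka : ((k : ℝ) + 1) * a = 1 := by rw [ha]; field_simp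
    set S := signedDist m ν ⁻¹' Ioo 0 a with hS
    set S' := S ∩ planeProj m ν ⁻¹' Metric.closedBall m R with hS'
    have hSm : MeasurableSet S := (continuous_signedDist m ν).measurable measurableSet_Ioo
    have hS'm : MeasurableSet S' := hSm.inter
      ((continuous_planeProj m ν).measurable Metric.isClosed_closedBall.measurableSet)
    have hvol : volume S' = ENNReal.ofReal (a * B) := by
      rw [hS', hS, volume_slab_inter hν 0 a Metric.isClosed_closedBall.measurableSet,
        surf_plane_inter_closedBall hν hm hR0, sub_zero, ENNReal.ofReal_mul ha0.le]
    have hvol' : volume S' ≠ ∞ := by rw [hvol]; exact ENNReal.ofReal_ne_top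
    have hout : ∀ x ∈ S \ S', u x = 0 ∧ u (planeProj m ν x) = 0 := by
      rintro x ⟨hx, hx'⟩
      have h1 : R < ‖planeProj m ν x - m‖ := by
        by_contra hcon
        exact hx' ⟨hx, by rw [mem_preimage, mem_closedBall_iff_norm]; exact not_lt.1 hcon⟩
      exact ⟨hR _ (h1.trans_le (norm_planeProj_sub_le hν hm x)), hR _ h1⟩
    have e1 : ∫ x in S, u x = ∫ x in S', u x :=
      (setIntegral_eq_of_subset_of_forall_sdiff_eq_zero hSm inter_subset_left
        fun x hx => (hout x hx).1)
    have e2 : ∫ x in S, u (planeProj m ν x) = ∫ x in S', u (planeProj m ν x) :=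
      (setIntegral_eq_of_subset_of_forall_sdiff_eq_zero hSm inter_subset_left
        fun x hx => (hout x hx).2)
    have e3 := integral_comp_planeProj (m := m) hν ha0.le hucont
    obtain ⟨C, hC⟩ := hucont.bounded_above_of_compact_support hc
    have i1 : IntegrableOn u S' := Measure.integrableOn_of_bounded (M := C) hvol'
      hucont.aestronglyMeasurable (Eventually.of_forall hC)
    have i2 : IntegrableOn (fun x => u (planeProj m ν x)) S' :=
      Measure.integrableOn_of_bounded (M := C) hvol'
      (hucont.comp (continuous_planeProj m ν)).aestronglyMeasurable
      (Eventually.of_forall fun x => hC _)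
    have e4 : ∫ x in plane m ν, u x ∂surf (n + 1) =
        ((k : ℝ) + 1) * ∫ x in S', u (planeProj m ν x) := by
      rw [← e2, hS, e3, sub_zero, ← mul_assoc, hka, one_mul]
    rw [e4, e1, ← mul_sub, ← integral_sub i1 i2, abs_mul, abs_of_pos hk]
    have e5 := norm_setIntegral_le_of_norm_le_const (μ := volume) (s := S') (C := L * a)
      (f := fun x => u x - u (planeProj m ν x)) hvol'.lt_top (fun x hx => by
        rw [← dist_eq_norm]
        refine (hu.dist_le_mul _ _).trans ?_
        rw [dist_eq_norm, norm_planeProj_sub hν, abs_of_pos hx.1.1]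
        exact mul_le_mul_of_nonneg_left hx.1.2.le L.2)
    rw [Real.norm_eq_abs, Measure.real, hvol, ENNReal.toReal_ofReal (by positivity)] at e5
    calc ((k : ℝ) + 1) * |∫ x in S', u x - u (planeProj m ν x)|
        ≤ ((k : ℝ) + 1) * (L * a * (a * B)) := by gcongr
      _ = (((k : ℝ) + 1) * a) * (L * B * a) := by ring
      _ = L * B * a := by rw [hka, one_mul]
  rw [tendsto_iff_dist_tendsto_zero]
  refine squeeze_zero (fun _ => dist_nonneg) bound ?_
  have := tendsto_one_div_add_atTop_nhds_zero_nat (𝕜 := ℝ)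
  simpa using this.const_mul (L * B)

/-- Integration by parts on a half space. -/
theorem integral_inner_gradient_halfSpace (w : Pt (n + 1)) :
    ∫ x in {x | signedDist m ν x ≤ 0}, inner ℝ (gradient u x) w =
      inner ℝ ν w * ∫ x in plane m ν, u x ∂surf (n + 1) := by
  have hHm : MeasurableSet {x | signedDist m ν x ≤ 0} :=
    (continuous_signedDist m ν).measurable measurableSet_Iic
  have hlim := (tendsto_integral_slab (m := m) hν hu hc).const_mul (inner ℝ ν w)
  have hlim' : Tendsto (fun k : ℕ => ∫ x, lineDeriv ℝ u x w * planeCutoff m ν ((k : ℝ) + 1) x)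
      atTop (𝓝 (inner ℝ ν w * ∫ x in plane m ν, u x ∂surf (n + 1))) := by
    refine hlim.congr fun k => ?_
    rw [integral_lineDeriv_mul_planeCutoff hν hu hc (by positivity)]
  have hint := integrable_lineDeriv_of_lipschitz hu hc w
  -- The cutoffs converge pointwise to the indicator function of the closed half space, and the line
  -- derivative of u dominates.
  have hdom : Tendsto (fun k : ℕ => ∫ x, lineDeriv ℝ u x w * planeCutoff m ν ((k : ℝ) + 1) x)
      atTop (𝓝 (∫ x, {x | signedDist m ν x ≤ 0}.indicator (fun x => lineDeriv ℝ u x w) x)) := by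
    refine tendsto_integral_of_dominated_convergence (fun x => ‖lineDeriv ℝ u x w‖)
      (fun k => ?_) hint.norm (fun k => Eventually.of_forall fun x => ?_)
      (Eventually.of_forall fun x => ?_)
    · exact hint.aestronglyMeasurable.mul
        (lipschitz_planeCutoff hν (by positivity)).continuous.aestronglyMeasurable
    · rw [norm_mul, Real.norm_of_nonneg (planeCutoff_nonneg _ _)]
      exact mul_le_of_le_one_right (norm_nonneg _) (planeCutoff_le_one _ _)
    · by_cases hx : signedDist m ν x ≤ 0
      · rw [indicator_of_mem (show x ∈ {x | signedDist m ν x ≤ 0} from hx)]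
        refine tendsto_const_nhds.congr fun k => ?_
        have : ((k : ℝ) + 1) * signedDist m ν x ≤ 0 :=
          mul_nonpos_of_nonneg_of_nonpos (by positivity) hx
        rw [planeCutoff, min_eq_left (by linarith), max_eq_right zero_le_one, mul_one]
      · rw [indicator_of_notMem (show x ∉ {x | signedDist m ν x ≤ 0} from hx)]
        push Not at hx
        refine tendsto_const_nhds.congr' ?_
        obtain ⟨N, hN⟩ := exists_nat_gt (1 / signedDist m ν x)
        filter_upwards [eventually_ge_atTop N] with k hk
        rw [div_lt_iff₀ hx] at hN
        have : (N : ℝ) ≤ k := by exact_mod_cast hk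
        rw [planeCutoff, max_eq_left, mul_zero]
        refine (min_le_right _ _).trans ?_
        nlinarith
  have huniq := tendsto_nhds_unique hlim' hdom
  rw [huniq, integral_indicator hHm]
  refine integral_congr_ae (ae_restrict_of_ae ?_)
  filter_upwards [hu.ae_differentiableAt] with x hx
  rw [hx.lineDeriv_eq_fderiv, inner_gradient_eq]

end HalfSpace

variable {d : ℕ}

/-! ### Affine functions and their gradients -/

/-- The gradient of an affine function. -/
def affGrad (A : Pt d →ᵃ[ℝ] ℝ) : Pt d := gradient A 0

theorem hasFDerivAt_affine (A : Pt d →ᵃ[ℝ] ℝ) (x : Pt d) :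
    HasFDerivAt A (LinearMap.toContinuousLinearMap A.linear) x := by
  have h : (A : Pt d → ℝ) = fun y => LinearMap.toContinuousLinearMap A.linear y + A 0 := by
    ext y
    have := A.map_vadd 0 y
    simpa using this
  rw [h]
  exact ((LinearMap.toContinuousLinearMap A.linear).hasFDerivAt).add_const _

theorem inner_affGrad (A : Pt d →ᵃ[ℝ] ℝ) (w : Pt d) : inner ℝ (affGrad A) w = A.linear w := by
  rw [affGrad, inner_gradient_eq, (hasFDerivAt_affine A 0).fderiv]
  rfl

theorem gradient_affine (A : Pt d →ᵃ[ℝ] ℝ) (x : Pt d) : gradient A x = affGrad A := by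
  rw [affGrad, gradient, gradient, (hasFDerivAt_affine A 0).fderiv, (hasFDerivAt_affine A x).fderiv]

theorem affine_sub (A : Pt d →ᵃ[ℝ] ℝ) (x y : Pt d) : A x - A y = inner ℝ (affGrad A) (x - y) := by
  rw [inner_affGrad]
  simpa using (A.linearMap_vsub x y).symm

theorem continuous_affine (A : Pt d →ᵃ[ℝ] ℝ) : Continuous A :=
  A.continuous_of_finiteDimensional

theorem gradient_congr {u v : Pt d → ℝ} {x : Pt d} (h : u =ᶠ[𝓝 x] v) :
    gradient u x = gradient v x := by
  rw [gradient, gradient, h.fderiv_eq]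

theorem eventuallyEq_of_mem_interior {u v : Pt d → ℝ} {S : Set (Pt d)} (h : EqOn u v S) {x : Pt d}
    (hx : x ∈ interior S) : u =ᶠ[𝓝 x] v := by
  filter_upwards [mem_interior_iff_mem_nhds.1 hx] with y hy using h hy

theorem gradient_eq_affGrad {u : Pt d → ℝ} {A : Pt d →ᵃ[ℝ] ℝ} {S : Set (Pt d)} (h : EqOn u A S)
    {x : Pt d} (hx : x ∈ interior S) : gradient u x = affGrad A := by
  rw [gradient_congr (eventuallyEq_of_mem_interior h hx), gradient_affine]

theorem measurable_gradient (u : Pt d → ℝ) : Measurable (gradient u) := by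
  unfold gradient
  exact (InnerProductSpace.toDual ℝ (Pt d)).symm.continuous.measurable.comp (measurable_fderiv ℝ u)

namespace Mesh

variable (M : Mesh d)

/-! ### Conformity -/

variable {M} in
theorem isSimplex {e : Finset (Pt d)} (he : e ∈ M.elements) : IsSimplex e :=
  ⟨M.card_eq e he, M.affineIndependent e he⟩

variable {M} {e e' : Finset (Pt d)} {x p q : Pt d}

/-- Conformity puts x into the hull of the common vertices, and coordinates can be read off there.
This is what makes the nodal basis functions single-valued. -/
theorem coord_eq_coord (he : e ∈ M.elements) (he' : e' ∈ M.elements) (hx : x ∈ hull e)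
    (hx' : x ∈ hull e') (q : Pt d) : coord e q x = coord e' q x := by
  classical
  have h : x ∈ hull (e ∩ e') := by
    have := M.conforming e he e' he'
    rw [hull, Finset.coe_inter, ← this]
    exact ⟨hx, hx'⟩
  exact (isSimplex he).coord_eq_of_mem_face (isSimplex he') Finset.inter_subset_left
    Finset.inter_subset_right h q

/-- A vertex that carries x with positive weight belongs to every element containing x. Most of the
support arguments below reduce to this. -/
theorem mem_of_coord_pos (he : e ∈ M.elements) (he' : e' ∈ M.elements) (hx : x ∈ hull e)
    (hx' : x ∈ hull e') (hq : 0 < coord e q x) : q ∈ e' := by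
  by_contra h
  rw [coord_eq_coord he he' hx hx', coord_of_notMem h] at hq
  simp at hq

theorem hat_eq (he : e ∈ M.elements) (hx : x ∈ hull e) (q : Pt d) : M.hat q x = coord e q x := by
  rw [Mesh.hat]
  set T : Set ℝ := {t : ℝ | ∃ e ∈ M.elements, q ∈ e ∧ ∃ w : Pt d → ℝ, (∀ q ∈ e, 0 ≤ w q) ∧
      ∑ q ∈ e, w q = 1 ∧ ∑ q ∈ e, w q • q = x ∧ t = w q}
  have hmem : ∀ t ∈ T, t = coord e q x := by
    rintro t ⟨e', he', hq, w, hw0, hw1, hwx, rfl⟩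
    have hx' : x ∈ hull e' := Finset.mem_convexHull'.2 ⟨w, hw0, hw1, hwx⟩
    rw [coord_eq_coord he he' hx hx', ← hwx, (isSimplex he').coord_sum hw1 hq]
  by_cases hq : q ∈ e
  · have : coord e q x ∈ T :=
      ⟨e, he, hq, fun q => coord e q x, (isSimplex he).mem_hull_iff.1 hx,
        (isSimplex he).sum_coord x, (isSimplex he).sum_coord_smul x, rfl⟩
    rw [(eq_singleton_iff_unique_mem.2 ⟨this, hmem⟩ : T = {coord e q x}), csSup_singleton]
  -- Here the set can still be nonempty, when another element contains both q and x; its only member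
  -- is then zero, the same value as the supremum of the empty set.
  · have h0 : coord e q x = 0 := by rw [coord_of_notMem hq]; rfl
    rcases T.eq_empty_or_nonempty with h | ⟨t, ht⟩
    · rw [h, h0, Real.sSup_empty]
    · rw [(eq_singleton_iff_unique_mem.2 ⟨hmem t ht ▸ ht, hmem⟩ : T = {coord e q x}),
        csSup_singleton]

/-- A common interior point carries all vertices of e with positive weight, so they are all vertices
of e'; both sets have the same cardinality. -/
theorem disjoint_interior (he : e ∈ M.elements) (he' : e' ∈ M.elements) (hne : e ≠ e') :
    Disjoint (interior (hull e)) (interior (hull e')) := by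
  rw [Set.disjoint_left]
  intro x hx hx'
  have h1 := (isSimplex he).mem_interior_iff.1 hx
  have h2 : e ⊆ e' := fun q hq =>
    mem_of_coord_pos he he' (interior_subset hx) (interior_subset hx') (h1 q hq)
  exact hne (Finset.eq_of_subset_of_card_le h2 (by rw [M.card_eq e he, M.card_eq e' he']))

/-! ### Integrals over unions of elements -/

/-- Boundaries of convex sets are null sets and there are finitely many elements. Integrals over Ω
or a patch can therefore be computed in open simplices, where piecewise affine functions are
differentiable. -/
theorem ae_mem_interior_hull (S : Finset (Finset (Pt d))) :
    ∀ᵐ x ∂volume.restrict (interior (⋃ e ∈ S, hull e)), ∃ e ∈ S, x ∈ interior (hull e) := by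
  rw [ae_restrict_iff' isOpen_interior.measurableSet]
  have h : ∀ e ∈ S, ∀ᵐ x ∂(volume : Measure (Pt d)), x ∉ hull e \ interior (hull e) :=
    fun e _ => measure_eq_zero_iff_ae_notMem.1 (volume_hull_diff_interior e)
  rw [← Finset.eventually_all] at h
  filter_upwards [h] with x hx hxU
  obtain ⟨e, he, hxe⟩ := mem_iUnion₂.1 (interior_subset hxU)
  refine ⟨e, he, ?_⟩
  by_contra hcon
  exact hx e he ⟨hxe, hcon⟩

theorem interior_hull_subset {S : Finset (Finset (Pt d))} (he : e ∈ S) :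
    interior (hull e) ⊆ interior (⋃ e ∈ S, hull e) :=
  interior_mono (subset_biUnion_of_mem (u := fun e : Finset (Pt d) => hull e) he)

theorem restrict_hull (e : Finset (Pt d)) :
    (volume : Measure (Pt d)).restrict (hull e) = volume.restrict (interior (hull e)) := by
  refine Measure.restrict_congr_set ?_
  refine (ae_eq_set).2 ⟨volume_hull_diff_interior e, ?_⟩
  rw [sdiff_eq_empty.2 interior_subset, measure_empty]

theorem restrict_hull_le {S : Finset (Finset (Pt d))} (he : e ∈ S) :
    (volume : Measure (Pt d)).restrict (hull e) ≤ volume.restrict (interior (⋃ e ∈ S, hull e)) := by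
  rw [restrict_hull]
  exact Measure.restrict_mono (interior_hull_subset he) le_rfl

theorem setIntegral_union_hull {S : Finset (Finset (Pt d))} (hS : S ⊆ M.elements) {F : Pt d → ℝ}
    (hF : IntegrableOn F (interior (⋃ e ∈ S, hull e))) :
    ∫ x in interior (⋃ e ∈ S, hull e), F x = ∑ e ∈ S, ∫ x in hull e, F x := by
  have h1 : (interior (⋃ e ∈ S, hull e) : Set (Pt d)) =ᵐ[volume] ⋃ e ∈ S, interior (hull e) := by
    refine (ae_eq_set).2 ⟨?_, ?_⟩
    · have := ae_mem_interior_hull S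
      rw [ae_restrict_iff' isOpen_interior.measurableSet] at this
      refine measure_eq_zero_iff_ae_notMem.2 ?_
      filter_upwards [this] with x hx hx'
      obtain ⟨e, he, hxe⟩ := hx hx'.1
      exact hx'.2 (mem_iUnion₂.2 ⟨e, he, hxe⟩)
    · rw [sdiff_eq_empty.2 (iUnion₂_subset fun e he => interior_hull_subset he), measure_empty]
  rw [setIntegral_congr_set h1, integral_biUnion_finset S
    (fun e _ => isOpen_interior.measurableSet)
    (fun e he e' he' hne => disjoint_interior (hS he) (hS he') hne)
    (fun e he => hF.mono_set (interior_hull_subset he))]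
  refine Finset.sum_congr rfl fun e _ => ?_
  rw [restrict_hull]

theorem Ω_eq : M.Ω = interior (⋃ e ∈ M.elements, hull e) := rfl

theorem star_subset : M.star p ⊆ M.elements := Finset.filter_subset _ _

theorem mem_star : e ∈ M.star p ↔ e ∈ M.elements ∧ p ∈ e := by
  simp [Mesh.star]

theorem patch_subset_Ω : M.patch p ⊆ M.Ω :=
  interior_mono (biUnion_subset_biUnion_left fun _ he => star_subset he)

theorem hull_subset_closedDomain (he : e ∈ M.elements) : hull e ⊆ M.closedDomain :=
  subset_biUnion_of_mem (u := fun e : Finset (Pt d) => hull e) he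

theorem isCompact_closedDomain : IsCompact M.closedDomain :=
  M.elements.isCompact_biUnion fun e _ => isCompact_hull e

theorem Ω_subset : M.Ω ⊆ M.closedDomain := interior_subset

theorem isOpen_Ω : IsOpen M.Ω := isOpen_interior

theorem measurableSet_Ω : MeasurableSet M.Ω := isOpen_Ω.measurableSet

theorem volume_Ω_lt_top : volume M.Ω < ∞ :=
  (measure_mono Ω_subset).trans_lt isCompact_closedDomain.measure_lt_top

theorem ae_mem_interior_Ω :
    ∀ᵐ x ∂volume.restrict M.Ω, ∃ e ∈ M.elements, x ∈ interior (hull e) := ae_mem_interior_hull _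

/-! ### Piecewise affine functions -/

variable (M) in
/-- Functions that are affine on every element. -/
def IsPA (w : Pt d → ℝ) : Prop := ∀ e ∈ M.elements, ∃ A : Pt d →ᵃ[ℝ] ℝ, EqOn w A (hull e)

theorem continuousOn_biUnion_hull {w : Pt d → ℝ} {S : Finset (Finset (Pt d))}
    (h : ∀ e ∈ S, ContinuousOn w (hull e)) : ContinuousOn w (⋃ e ∈ S, hull e) := by
  classical
  induction S using Finset.induction_on with
  | empty => simp
  | insert e S _ ih =>
    rw [Finset.set_biUnion_insert]
    refine ContinuousOn.union_of_isClosed (h e (Finset.mem_insert_self _ _))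
      (ih fun e' he' => h e' (Finset.mem_insert_of_mem he')) (isClosed_hull e) ?_
    exact isClosed_biUnion_finset fun e _ => isClosed_hull e

theorem IsPA.continuousOn {w : Pt d → ℝ} (h : M.IsPA w) : ContinuousOn w M.closedDomain :=
  continuousOn_biUnion_hull fun e he => by
    obtain ⟨A, hA⟩ := h e he
    exact (continuous_affine A).continuousOn.congr hA

theorem isPA_hat (q : Pt d) : M.IsPA (M.hat q) := fun e he => ⟨coord e q, fun _ hx => hat_eq he hx q⟩

theorem isPA_const (c : ℝ) : M.IsPA fun _ => c := fun _ _ => ⟨AffineMap.const ℝ _ c, fun _ _ => rfl⟩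

theorem IsP1.isPA {v : Pt d → ℝ} (h : M.IsP1 v) : M.IsPA v := h.2

theorem elemGrad_eq {w : Pt d → ℝ} {A : Pt d →ᵃ[ℝ] ℝ} (he : e ∈ M.elements)
    (hA : EqOn w A (hull e)) : elemGrad w e = affGrad A :=
  gradient_eq_affGrad hA (isSimplex he).barycentre_mem_interior

theorem IsPA.gradient_eq {w : Pt d → ℝ} (h : M.IsPA w) (he : e ∈ M.elements)
    (hx : x ∈ interior (hull e)) : gradient w x = elemGrad w e := by
  obtain ⟨A, hA⟩ := h e he
  rw [elemGrad_eq he hA, gradient_eq_affGrad hA hx]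

theorem IsPA.exists_bound {w : Pt d → ℝ} (h : M.IsPA w) :
    ∃ C : ℝ, 0 ≤ C ∧ ∀ x ∈ M.closedDomain, |w x| ≤ C := by
  obtain ⟨C, hC⟩ := isCompact_closedDomain.exists_bound_of_continuousOn h.continuousOn
  exact ⟨max C 0, le_max_right _ _, fun x hx => (hC x hx).trans (le_max_left _ _)⟩

theorem IsPA.exists_bound_gradient {w : Pt d → ℝ} (h : M.IsPA w) :
    ∃ C : ℝ, 0 ≤ C ∧ ∀ᵐ x ∂volume.restrict M.Ω, ‖gradient w x‖ ≤ C := by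
  refine ⟨∑ e ∈ M.elements, ‖elemGrad w e‖, Finset.sum_nonneg fun _ _ => norm_nonneg _, ?_⟩
  filter_upwards [ae_mem_interior_Ω] with x ⟨e, he, hx⟩
  rw [h.gradient_eq he hx]
  exact Finset.single_le_sum (f := fun e => ‖elemGrad w e‖) (fun _ _ => norm_nonneg _) he

theorem IsPA.aestronglyMeasurable {w : Pt d → ℝ} (h : M.IsPA w) :
    AEStronglyMeasurable w (volume.restrict M.Ω) :=
  (h.continuousOn.mono Ω_subset).aestronglyMeasurable measurableSet_Ω

theorem IsPA.memLp {w : Pt d → ℝ} (h : M.IsPA w) : MemLp w 2 (volume.restrict M.Ω) := by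
  obtain ⟨C, -, hC⟩ := h.exists_bound
  have : IsFiniteMeasure (volume.restrict M.Ω) := ⟨by simpa using volume_Ω_lt_top⟩
  refine MemLp.of_bound h.aestronglyMeasurable C ?_
  filter_upwards [ae_restrict_mem measurableSet_Ω] with x hx using hC x (Ω_subset hx)

theorem IsPA.memLp_gradient {w : Pt d → ℝ} (h : M.IsPA w) :
    MemLp (fun x => gradient w x) 2 (volume.restrict M.Ω) := by
  obtain ⟨C, -, hC⟩ := h.exists_bound_gradient
  have : IsFiniteMeasure (volume.restrict M.Ω) := ⟨by simpa using volume_Ω_lt_top⟩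
  exact MemLp.of_bound (measurable_gradient w).aestronglyMeasurable C hC

end Mesh

/-! ### Sides and outer normals -/

section Sides

variable {n : ℕ} {e s : Finset (Pt (n + 1))}

theorem nonempty_of_card (hs : s.card = n + 1) : s.Nonempty :=
  Finset.card_pos.1 (by rw [hs]; omega)

theorem exists_opposite (he : IsSimplex e) (hse : s ⊆ e) (hs : s.card = n + 1) :
    ∃ o ∈ e, o ∉ s ∧ ∀ q ∈ e, q ≠ o → q ∈ s := by
  classical
  have h1 : (e \ s).card = 1 := by
    rw [Finset.card_sdiff_of_subset hse, he.card, hs]; omega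
  obtain ⟨o, ho⟩ := Finset.card_eq_one.1 h1
  have ho' : o ∈ e \ s := by rw [ho]; exact Finset.mem_singleton_self o
  refine ⟨o, (Finset.mem_sdiff.1 ho').1, (Finset.mem_sdiff.1 ho').2, fun q hq hqo => ?_⟩
  by_contra hqs
  have : q ∈ e \ s := Finset.mem_sdiff.2 ⟨hq, hqs⟩
  rw [ho, Finset.mem_singleton] at this
  exact hqo this

theorem sub_mem_vectorSpan_side {a b : Pt (n + 1)} (ha : a ∈ hull s) (hb : b ∈ hull s) :
    a - b ∈ vectorSpan ℝ (s : Set (Pt (n + 1))) := by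
  rw [← direction_affineSpan]
  exact AffineSubspace.vsub_mem_direction (convexHull_subset_affineSpan _ ha)
    (convexHull_subset_affineSpan _ hb)

theorem signedDist_eq_sum (he : IsSimplex e) (m ν x : Pt (n + 1)) :
    signedDist m ν x = ∑ q ∈ e, coord e q x * signedDist m ν q := by
  simp only [signedDist, inner_sub_right, mul_sub, Finset.sum_sub_distrib]
  rw [← Finset.sum_mul, he.sum_coord, one_mul]
  conv_lhs => rw [← he.sum_coord_smul x]
  rw [inner_sum]
  simp only [inner_smul_right]

/-- The gradient of the coordinate of the opposite vertex o is orthogonal to the side. If the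
projection vanished, that coordinate would agree at the two barycentres, but it is 0 on the side and
1 / (n + 2) at the barycentre of e. -/
theorem outerNormal_aux (he : IsSimplex e) (hse : s ⊆ e) (hs : s.card = n + 1) :
    ((vectorSpan ℝ (s : Set (Pt (n + 1))))ᗮ.starProjection (barycentre s - barycentre e)) ≠ 0 := by
  obtain ⟨o, hoe, hos, -⟩ := exists_opposite he hse hs
  intro h0
  rw [Submodule.starProjection_apply_eq_zero_iff, Submodule.orthogonal_orthogonal] at h0
  have hg : affGrad (coord e o) ∈ (vectorSpan ℝ (s : Set (Pt (n + 1))))ᗮ := by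
    rw [Submodule.mem_orthogonal']
    intro y hy
    rw [vectorSpan_def] at hy
    induction hy using Submodule.span_induction with
    | mem y hy =>
      obtain ⟨a, ha, b, hb, rfl⟩ := Set.mem_vsub.1 hy
      rw [vsub_eq_sub, ← affine_sub, he.coord_ne (hse ha) (fun h => hos (by rw [h]; exact ha)),
        he.coord_ne (hse hb) (fun h => hos (by rw [h]; exact hb)), sub_zero]
    | zero => simp
    | add y z _ _ hy hz => rw [inner_add_right, hy, hz, add_zero]
    | smul c y _ hy => rw [inner_smul_right, hy, mul_zero]
  have h1 := (Submodule.mem_orthogonal' _ _).1 hg _ h0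
  have hsne := nonempty_of_card hs
  rw [← affine_sub, he.coord_eq_zero_of_mem_face hse (barycentre_mem_hull hsne) hos,
    he.coord_barycentre subset_rfl he.nonempty hoe, he.card] at h1
  have : (0 : ℝ) < ((n + 1 + 1 : ℕ) : ℝ)⁻¹ := by positivity
  linarith

theorem norm_outerNormal (he : IsSimplex e) (hse : s ⊆ e) (hs : s.card = n + 1) :
    ‖outerNormal e s‖ = 1 := by
  have := outerNormal_aux he hse hs
  simp only [outerNormal]
  rw [norm_smul, norm_inv, norm_norm, inv_mul_cancel₀ (norm_ne_zero_iff.2 this)]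

theorem signedDist_side (hs : s.card = n + 1) {x : Pt (n + 1)} (hx : x ∈ hull s) :
    signedDist (barycentre s) (outerNormal e s) x = 0 := by
  have h1 := sub_mem_vectorSpan_side hx (barycentre_mem_hull (nonempty_of_card hs))
  have h2 : outerNormal e s ∈ (vectorSpan ℝ (s : Set (Pt (n + 1))))ᗮ := by
    simp only [outerNormal]
    exact Submodule.smul_mem _ _ (Submodule.starProjection_apply_mem _ _)
  exact (Submodule.mem_orthogonal' _ _).1 h2 _ h1

/-- An affine function vanishing at all vertices but o is a multiple of the barycentric coordinate
of o. Signed distance and coordinate thus carry the same information about the position relative to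
the side. -/
theorem signedDist_opposite (he : IsSimplex e) (hs : s.card = n + 1)
    {o : Pt (n + 1)} (ho : ∀ q ∈ e, q ≠ o → q ∈ s) (hoe : o ∈ e) (x : Pt (n + 1)) :
    signedDist (barycentre s) (outerNormal e s) x =
      coord e o x * signedDist (barycentre s) (outerNormal e s) o := by
  rw [signedDist_eq_sum he, Finset.sum_eq_single o]
  · intro q hq hqo
    rw [signedDist_side hs (subset_convexHull ℝ _ (ho q hq hqo)), mul_zero]
  · exact fun h => absurd hoe h

theorem signedDist_opposite_neg (he : IsSimplex e) (hse : s ⊆ e) (hs : s.card = n + 1)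
    {o : Pt (n + 1)} (ho : ∀ q ∈ e, q ≠ o → q ∈ s) (hoe : o ∈ e) :
    signedDist (barycentre s) (outerNormal e s) o < 0 := by
  have h1 := signedDist_opposite he hs ho hoe (barycentre e)
  rw [he.coord_barycentre subset_rfl he.nonempty hoe, he.card] at h1
  -- The sign is fixed at the barycentre of e: the inner product of the projection with the
  -- projected vector is its squared norm.
  have h2 : signedDist (barycentre s) (outerNormal e s) (barycentre e) < 0 := by
    have hv := outerNormal_aux he hse hs
    simp only [outerNormal, signedDist]
    set v := (vectorSpan ℝ (s : Set (Pt (n + 1))))ᗮ.starProjection (barycentre s - barycentre e)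
      with hvdef
    have h3 : inner ℝ v (barycentre s - barycentre e) = ‖v‖ ^ 2 := by
      rw [← real_inner_self_eq_norm_sq]
      have h5 : v ∈ (vectorSpan ℝ (s : Set (Pt (n + 1))))ᗮ := Submodule.starProjection_apply_mem _ _
      have h4 := Submodule.sub_starProjection_mem_orthogonal
        (K := (vectorSpan ℝ (s : Set (Pt (n + 1))))ᗮ) (barycentre s - barycentre e)
      have h6 := (Submodule.mem_orthogonal _ _).1 h4 v h5
      rw [← hvdef, inner_sub_right] at h6
      linarith
    rw [inner_smul_left, ← neg_sub (barycentre s), inner_neg_right, h3]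
    have : 0 < ‖v‖ := norm_pos_iff.2 hv
    simp only [RCLike.conj_to_real]
    have : 0 < ‖v‖⁻¹ * ‖v‖ ^ 2 := by positivity
    linarith
  have : (0 : ℝ) < ((n + 1 + 1 : ℕ) : ℝ)⁻¹ := by positivity
  by_contra hcon
  push Not at hcon
  have := mul_nonneg this.le hcon
  linarith

/-- Where the coordinates of the vertices of s are nonnegative, only the one of the opposite vertex
is left to decide membership. Near the barycentre of s the element is therefore a half space. -/
theorem mem_hull_iff_signedDist (he : IsSimplex e) (hse : s ⊆ e) (hs : s.card = n + 1)
    {x : Pt (n + 1)} (hx : ∀ q ∈ s, 0 ≤ coord e q x) :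
    x ∈ hull e ↔ signedDist (barycentre s) (outerNormal e s) x ≤ 0 := by
  obtain ⟨o, hoe, hos, ho⟩ := exists_opposite he hse hs
  rw [signedDist_opposite he hs ho hoe, he.mem_hull_iff]
  have hneg := signedDist_opposite_neg he hse hs ho hoe
  constructor
  · intro h
    exact mul_nonpos_of_nonneg_of_nonpos (h o hoe) hneg.le
  · intro h q hq
    by_cases hqo : q = o
    · subst hqo
      by_contra hcon
      push Not at hcon
      nlinarith
    · exact hx q (ho q hq hqo)

theorem mem_hull_side_iff (he : IsSimplex e) (hse : s ⊆ e) (hs : s.card = n + 1)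
    {x : Pt (n + 1)} (hx : ∀ q ∈ s, 0 ≤ coord e q x) :
    x ∈ hull s ↔ signedDist (barycentre s) (outerNormal e s) x = 0 := by
  refine ⟨signedDist_side hs, fun h => ?_⟩
  obtain ⟨o, hoe, hos, ho⟩ := exists_opposite he hse hs
  rw [signedDist_opposite he hs ho hoe] at h
  have hneg := signedDist_opposite_neg he hse hs ho hoe
  refine he.mem_face hse hx fun q hq hqs => ?_
  have : q = o := by
    by_contra hqo
    exact hqs (ho q hq hqo)
  subst this
  exact (mul_eq_zero.1 h).resolve_right hneg.ne

theorem hull_side_subset_plane (hs : s.card = n + 1) :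
    hull s ⊆ plane (barycentre s) (outerNormal e s) := fun _ hx => signedDist_side hs hx

theorem barycentre_mem_plane (e s : Finset (Pt (n + 1))) :
    barycentre s ∈ plane (barycentre s) (outerNormal e s) := signedDist_self _ _

/-- The side lies in a disc of radius H about its barycentre. -/
theorem surf_hull_le (he : IsSimplex e) (hse : s ⊆ e) (hs : s.card = n + 1) {H : ℝ}
    (hH : Metric.diam (hull s) ≤ H) :
    surf (n + 1) (hull s) ≤ ENNReal.ofReal (H ^ n * unitBallVolume n) := by
  have hH0 : 0 ≤ H := Metric.diam_nonneg.trans hH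
  rw [← surf_plane_inter_closedBall (norm_outerNormal he hse hs) (barycentre_mem_plane e s) hH0]
  refine measure_mono (subset_inter (hull_side_subset_plane hs) fun x hx => ?_)
  exact (Metric.dist_le_diam_of_mem (isCompact_hull s).isBounded hx
    (barycentre_mem_hull (nonempty_of_card hs))).trans hH

theorem surf_hull_lt_top (he : IsSimplex e) (hse : s ⊆ e) (hs : s.card = n + 1) :
    surf (n + 1) (hull s) < ∞ :=
  (surf_hull_le he hse hs le_rfl).trans_lt ENNReal.ofReal_lt_top

/-- Two simplices on the same side of a common side have the same outer normal there; on different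
sides, opposite ones. -/
theorem outerNormal_eq_or_neg {e' : Finset (Pt (n + 1))} (he : IsSimplex e) (he' : IsSimplex e')
    (hse : s ⊆ e) (hse' : s ⊆ e') (hs : s.card = n + 1) :
    outerNormal e' s = outerNormal e s ∨ outerNormal e' s = -outerNormal e s := by
  set ν := outerNormal e s with hνdef
  set ν' := outerNormal e' s with hν'def
  have hν : ‖ν‖ = 1 := norm_outerNormal he hse hs
  have hν' : ‖ν'‖ = 1 := norm_outerNormal he' hse' hs
  -- A shift orthogonal to the first normal keeps the barycentre in the affine hull of s, hence is
  -- orthogonal to the second normal too; so the two unit normals are parallel.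
  have key : ∀ w : Pt (n + 1), inner ℝ ν w = 0 → inner ℝ ν' w = 0 := by
    intro w hw
    obtain ⟨o, hoe, hos, ho⟩ := exists_opposite he hse hs
    have h1 : signedDist (barycentre s) ν (barycentre s + w) = 0 := by
      rw [signedDist_add, signedDist_self, hw, add_zero]
    rw [signedDist_opposite he hs ho hoe] at h1
    have h2 := (mul_eq_zero.1 h1).resolve_right (signedDist_opposite_neg he hse hs ho hoe).ne
    have h3 : signedDist (barycentre s) ν' (barycentre s + w) = 0 := by
      rw [signedDist_eq_sum he]
      refine Finset.sum_eq_zero fun q hq => ?_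
      by_cases hqo : q = o
      · rw [hqo, h2, zero_mul]
      · rw [signedDist_side hs (subset_convexHull ℝ _ (ho q hq hqo)), mul_zero]
    rwa [signedDist_add, signedDist_self, zero_add] at h3
  set c : ℝ := inner ℝ ν ν'
  have h1 : inner ℝ ν (ν' - c • ν) = 0 := by
    rw [inner_sub_right, inner_smul_right, inner_self_unit hν]; simp [c]
  have h2 := key _ h1
  have h3 : inner ℝ (ν' - c • ν) (ν' - c • ν) = 0 := by
    rw [inner_sub_left, h2, inner_smul_left, h1]; simp
  have h4 : ν' = c • ν := sub_eq_zero.1 (inner_self_eq_zero.1 h3)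
  have h5 : |c| = 1 := by
    have := congrArg norm h4
    rwa [norm_smul, hν, hν', mul_one, Real.norm_eq_abs, eq_comm] at this
  rcases (abs_eq zero_le_one).1 h5 with h | h
  · left; rw [h4, h, one_smul]
  · right; rw [h4, h, neg_one_smul]

end Sides

/-! ### Cauchy-Schwarz inequalities -/

theorem integrable_inner_of_memLp {α E : Type*} [MeasurableSpace α] {μ : Measure α}
    [NormedAddCommGroup E] [InnerProductSpace ℝ E] {f g : α → E} (hf : MemLp f 2 μ)
    (hg : MemLp g 2 μ) : Integrable (fun x => inner ℝ (f x) (g x)) μ := by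
  refine (hf.norm.integrable_mul hg.norm).mono' (hf.1.inner hg.1) (Eventually.of_forall fun x => ?_)
  exact abs_real_inner_le_norm _ _

/-- The integrated quadratic polynomial in s is nonnegative, so its discriminant is not positive.
Stating it for integrands covers both the scalar and the energy inner product. -/
theorem integral_sq_le_of_quadratic {α : Type*} [MeasurableSpace α] {μ : Measure α} {P X Q : α → ℝ}
    (hP : Integrable P μ) (hX : Integrable X μ) (hQ : Integrable Q μ)
    (h : ∀ x, ∀ s : ℝ, 0 ≤ P x * (s * s) + 2 * X x * s + Q x) :
    (∫ x, X x ∂μ) ^ 2 ≤ (∫ x, P x ∂μ) * ∫ x, Q x ∂μ := by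
  have hd := discrim_le_zero (a := ∫ x, P x ∂μ) (b := 2 * ∫ x, X x ∂μ) (c := ∫ x, Q x ∂μ) fun s => by
    have h1 : ∫ x, (P x * (s * s) + 2 * X x * s + Q x) ∂μ =
        (∫ x, P x ∂μ) * (s * s) + (2 * ∫ x, X x ∂μ) * s + ∫ x, Q x ∂μ := by
      have j1 : Integrable (fun x => P x * (s * s)) μ := hP.mul_const _
      have j2 : Integrable (fun x => 2 * X x * s) μ := (hX.const_mul 2).mul_const s
      have j3 : Integrable (fun x => P x * (s * s) + 2 * X x * s) μ := j1.add j2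
      rw [integral_add j3 hQ, integral_add j1 j2, integral_mul_const, integral_mul_const,
        integral_const_mul]
    rw [← h1]
    exact integral_nonneg fun x => h x s
  rw [discrim] at hd
  nlinarith

theorem integral_mul_le_sqrt {α : Type*} [MeasurableSpace α] {μ : Measure α} {u v : α → ℝ}
    (hu : MemLp u 2 μ) (hv : MemLp v 2 μ) :
    |∫ x, u x * v x ∂μ| ≤ Real.sqrt (∫ x, u x ^ 2 ∂μ) * Real.sqrt (∫ x, v x ^ 2 ∂μ) := by
  rw [← Real.sqrt_mul (integral_nonneg fun x => sq_nonneg _)]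
  refine Real.abs_le_sqrt ?_
  refine integral_sq_le_of_quadratic hu.integrable_sq (hu.integrable_mul hv) hv.integrable_sq
    fun x s => ?_
  nlinarith [sq_nonneg (u x * s + v x)]

theorem integral_energy_le {d : ℕ} {ω : Set (Pt d)} (ε : ℝ) {u v : Jet d}
    (hu : MemLp u.val 2 (volume.restrict ω)) (hu' : MemLp u.grad 2 (volume.restrict ω))
    (hv : MemLp v.val 2 (volume.restrict ω)) (hv' : MemLp v.grad 2 (volume.restrict ω)) :
    |(∫ x in ω, ε ^ 2 * inner ℝ (u.grad x) (v.grad x)) + ∫ x in ω, u.val x * v.val x| ≤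
      energyNorm ε ω u * energyNorm ε ω v := by
  have e0 : ∀ w : Jet d, 0 ≤ ε ^ 2 * (∫ x in ω, ‖w.grad x‖ ^ 2) + ∫ x in ω, w.val x ^ 2 :=
    fun w => add_nonneg (mul_nonneg (sq_nonneg _) (integral_nonneg fun x => sq_nonneg _))
      (integral_nonneg fun x => sq_nonneg _)
  rw [energyNorm, energyNorm, ← Real.sqrt_mul (e0 u)]
  refine Real.abs_le_sqrt ?_
  have iu := hu'.norm.integrable_sq.const_mul (ε ^ 2)
  have iv := hv'.norm.integrable_sq.const_mul (ε ^ 2)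
  have iX := (integrable_inner_of_memLp hu' hv').const_mul (ε ^ 2)
  have iY : Integrable (fun x => u.val x * v.val x) (volume.restrict ω) := hu.integrable_mul hv
  rw [← integral_add iX iY, ← integral_const_mul, ← integral_const_mul,
    ← integral_add iu hu.integrable_sq, ← integral_add iv hv.integrable_sq]
  refine integral_sq_le_of_quadratic (iu.add hu.integrable_sq) (iX.add iY)
    (iv.add hv.integrable_sq) fun x s => ?_
  have h1 : 0 ≤ ‖s • u.grad x + v.grad x‖ ^ 2 := sq_nonneg _
  rw [norm_add_sq_real, norm_smul, inner_smul_left, Real.norm_eq_abs, mul_pow, sq_abs] at h1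
  simp only [RCLike.conj_to_real] at h1
  nlinarith [sq_nonneg (u.val x * s + v.val x), mul_nonneg (sq_nonneg ε) h1]

/-! ### Lipschitz test functions -/

section LipschitzTest

variable {d : ℕ} {ψ : Pt d → ℝ} {L : ℝ≥0}

theorem norm_gradient_le (hψ : LipschitzWith L ψ) (x : Pt d) : ‖gradient ψ x‖ ≤ L := by
  rw [gradient, LinearIsometryEquiv.norm_map]
  exact norm_fderiv_le_of_lipschitz ℝ hψ

theorem gradient_mul_eq {u v : Pt d → ℝ} {x : Pt d} (hu : DifferentiableAt ℝ u x)
    (hv : DifferentiableAt ℝ v x) :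
    gradient (fun y => u y * v y) x = v x • gradient u x + u x • gradient v x := by
  have h : fderiv ℝ (fun y => u y * v y) x = u x • fderiv ℝ v x + v x • fderiv ℝ u x :=
    fderiv_fun_mul hu hv
  simp only [gradient]
  rw [h, map_add, map_smul, map_smul, add_comm]

/-- The product of a compactly supported Lipschitz function and an affine function is Lipschitz. -/
theorem exists_lipschitz_mul_affine (hψ : LipschitzWith L ψ) (hc : HasCompactSupport ψ)
    (A : Pt d →ᵃ[ℝ] ℝ) : ∃ K, LipschitzWith K fun x => ψ x * A x := by
  obtain ⟨C, hC⟩ := hψ.continuous.bounded_above_of_compact_support hc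
  obtain ⟨N, hN⟩ := hc.isCompact.exists_bound_of_continuousOn (continuous_affine A).continuousOn
  have hC0 : 0 ≤ C := (norm_nonneg _).trans (hC 0)
  have hN' : ∀ x, ψ x ≠ 0 → |A x| ≤ max N 0 := fun x hx =>
    (hN x (subset_tsupport _ hx)).trans (le_max_left _ _)
  have hK : 0 ≤ C * ‖affGrad A‖ + max N 0 * L := by positivity
  refine ⟨(C * ‖affGrad A‖ + max N 0 * L).toNNReal, LipschitzWith.of_dist_le_mul fun x y => ?_⟩
  rw [Real.coe_toNNReal _ hK, Real.dist_eq]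
  have hA : |A x - A y| ≤ ‖affGrad A‖ * dist x y := by
    rw [affine_sub, dist_eq_norm]; exact abs_real_inner_le_norm _ _
  have hL : |ψ x - ψ y| ≤ L * dist x y := by
    have := hψ.dist_le_mul x y; rwa [Real.dist_eq] at this
  have hCx : |ψ x| ≤ C := hC x
  have hd : 0 ≤ dist x y := dist_nonneg
  -- A is bounded only on the support of ψ, so the product rule must be split so that A is evaluated
  -- at a point where ψ is not zero.
  by_cases hy : ψ y = 0
  · by_cases hx : ψ x = 0
    · rw [hx, hy]; simp; positivity
    · rw [hy] at hL ⊢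
      rw [zero_mul, sub_zero, abs_mul]
      rw [sub_zero] at hL
      calc |ψ x| * |A x| ≤ (L * dist x y) * max N 0 := by
            gcongr
            exact hN' x hx
        _ ≤ (C * ‖affGrad A‖ + max N 0 * L) * dist x y := by
            have : 0 ≤ C * ‖affGrad A‖ * dist x y := by positivity
            linarith
  · have h1 : ψ x * A x - ψ y * A y = ψ x * (A x - A y) + (ψ x - ψ y) * A y := by ring
    rw [h1]
    refine (abs_add_le _ _).trans ?_
    rw [abs_mul, abs_mul]
    calc |ψ x| * |A x - A y| + |ψ x - ψ y| * |A y|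
        ≤ C * (‖affGrad A‖ * dist x y) + (L * dist x y) * max N 0 := by
          gcongr
          exact hN' y hy
      _ = _ := by ring

/-- Integration by parts holds on the whole space for a Lipschitz factor and a compactly supported
one; η and its derivative vanish outside Ω. -/
theorem isWeakGradient_of_lipschitz (hψ : LipschitzWith L ψ) (Ω : Set (Pt d)) :
    IsWeakGradient Ω ψ fun x => gradient ψ x := by
  intro η hη hηc hηΩ v
  obtain ⟨D, hD⟩ := ContDiff.lipschitzWith_of_hasCompactSupport hηc hη (by simp)
  have h := hψ.integral_lineDeriv_mul_eq (μ := volume) hD hηc v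
  have z : ∀ x ∉ Ω, η x = 0 := fun x hx =>
    image_eq_zero_of_notMem_tsupport fun h => hx (hηΩ h)
  have z' : ∀ x ∉ Ω, fderiv ℝ η x = 0 := fun x hx =>
    image_eq_zero_of_notMem_tsupport fun h => hx (hηΩ (tsupport_fderiv_subset ℝ h))
  rw [setIntegral_eq_integral_of_forall_compl_eq_zero fun x hx => by simp [z' x hx],
    setIntegral_eq_integral_of_forall_compl_eq_zero fun x hx => by simp [z x hx]]
  have e1 : ∫ x, inner ℝ (gradient ψ x) v * η x = ∫ x, lineDeriv ℝ ψ x v * η x := by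
    refine integral_congr_ae ?_
    filter_upwards [hψ.ae_differentiableAt] with x hx
    rw [hx.lineDeriv_eq_fderiv, inner_gradient_eq]
  have e2 : ∀ x, lineDeriv ℝ η x (-v) * ψ x = -(ψ x * fderiv ℝ η x v) := by
    intro x
    rw [((hη.differentiable (by simp)) x).lineDeriv_eq_fderiv, map_neg]
    ring
  rw [e1, h]
  simp only [e2]
  rw [integral_neg, neg_neg]

end LipschitzTest

namespace Mesh

variable {n : ℕ} {M : Mesh (n + 1)} {ψ : Pt (n + 1) → ℝ} {L : ℝ≥0}

theorem mem_sides {s : Finset (Pt (n + 1))} :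
    s ∈ M.sides ↔ ∃ e ∈ M.elements, s ⊆ e ∧ s.card = n + 1 := by
  simp [Mesh.sides, Finset.mem_powersetCard]

theorem mem_elementsAt {s e : Finset (Pt (n + 1))} :
    e ∈ M.elementsAt s ↔ e ∈ M.elements ∧ s ⊆ e := by
  simp [Mesh.elementsAt]

theorem surf_Γ_lt_top : surf (n + 1) M.Γ < ∞ := by
  refine (measure_biUnion_lt_top (Finset.finite_toSet _) fun s hs => ?_)
  obtain ⟨e, he, hse, hcard⟩ := mem_sides.1 (Finset.mem_filter.1 hs).1
  exact surf_hull_lt_top (isSimplex he) hse hcard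

/-- A Lipschitz function is its own approximating sequence in the definition of the trace. -/
theorem isTest_ofFun (hψ : LipschitzWith L ψ) (hc : HasCompactSupport ψ)
    (hD : ∀ x ∈ M.ΓD, ψ x = 0) : M.IsTest (.ofFun ψ) := by
  have hfin : IsFiniteMeasure (volume.restrict M.Ω) := ⟨by simpa using volume_Ω_lt_top⟩
  have hfin' : IsFiniteMeasure ((surf (n + 1)).restrict M.Γ) := ⟨by simpa using surf_Γ_lt_top⟩
  obtain ⟨C, hC⟩ := hψ.continuous.bounded_above_of_compact_support hc
  refine ⟨⟨?_, ?_, ?_, ?_, fun _ => ψ, fun _ => ⟨L, hψ⟩, ?_, ?_, ?_⟩, ?_⟩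
  · exact MemLp.of_bound hψ.continuous.aestronglyMeasurable C (Eventually.of_forall hC)
  · exact MemLp.of_bound (measurable_gradient ψ).aestronglyMeasurable L
      (Eventually.of_forall (norm_gradient_le hψ))
  · exact isWeakGradient_of_lipschitz hψ _
  · exact MemLp.of_bound hψ.continuous.aestronglyMeasurable C (Eventually.of_forall hC)
  · simp [Jet.ofFun]
  · simp [Jet.ofFun]
  · simp [Jet.ofFun]
  · have hm : MeasurableSet M.ΓD := by
      refine Finset.measurableSet_biUnion _ fun s _ => measurableSet_hull s
    filter_upwards [ae_restrict_mem hm] with x hx using hD x hx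

/-! ### The residual of a product -/

/-- On each element the gradient of φ_m is constant and w may be replaced by its affine extension A
e. Then ψ · A e is Lipschitz on the whole space, so that the integrals over elements become
accessible to integration by parts without any regularity of w across sides. -/
theorem residual_mulFun {ε : ℝ} {f π φm w : Pt (n + 1) → ℝ}
    {A : Finset (Pt (n + 1)) → (Pt (n + 1) →ᵃ[ℝ] ℝ)}
    (hf : MemLp f 2 (volume.restrict M.Ω)) (hφm : M.IsPA φm)
    (hψ : LipschitzWith L ψ) (hc : HasCompactSupport ψ) (hw : M.IsPA w)
    (hA : ∀ e ∈ M.elements, EqOn w (A e) (hull e)) :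
    M.residual ε f π (.ofFun φm) ((Jet.ofFun ψ).mulFun w) =
      (∫ x in M.Ω, ((f x - φm x) * ψ x) * w x) + (∫ x in M.ΓN, π x * (ψ x * w x) ∂surf (n + 1)) -
        ε ^ 2 * ∑ e ∈ M.elements, ∫ x in hull e,
          inner ℝ (gradient (fun y => ψ y * A e y) x) (elemGrad φm e) := by
  have hfin : IsFiniteMeasure (volume.restrict M.Ω) := ⟨by simpa using volume_Ω_lt_top⟩
  obtain ⟨C, hC⟩ := hψ.continuous.bounded_above_of_compact_support hc
  obtain ⟨B, hB0, hB⟩ := hw.exists_bound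
  obtain ⟨G, hG0, hG⟩ := hw.exists_bound_gradient
  have hC0 : 0 ≤ C := (norm_nonneg _).trans (hC 0)
  have hψw : AEStronglyMeasurable (fun x => ψ x * w x) (volume.restrict M.Ω) :=
    hψ.continuous.aestronglyMeasurable.mul hw.aestronglyMeasurable
  have hψwb : ∀ᵐ x ∂volume.restrict M.Ω, ‖ψ x * w x‖ ≤ C * B := by
    filter_upwards [ae_restrict_mem measurableSet_Ω] with x hx
    rw [norm_mul]
    exact mul_le_mul (hC x) (hB x (Ω_subset hx)) (norm_nonneg _) hC0
  have i1 : Integrable (fun x => f x * (ψ x * w x)) (volume.restrict M.Ω) :=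
    (hf.integrable one_le_two).mul_bdd hψw hψwb
  have i2 : Integrable (fun x => φm x * (ψ x * w x)) (volume.restrict M.Ω) :=
    (hφm.memLp.integrable one_le_two).mul_bdd hψw hψwb
  have i3 : Integrable (fun x => inner ℝ (gradient φm x)
      (w x • gradient ψ x + ψ x • gradient w x)) (volume.restrict M.Ω) := by
    refine integrable_inner_of_memLp hφm.memLp_gradient (MemLp.of_bound ?_ (B * L + C * G) ?_)
    · exact (hw.aestronglyMeasurable.smul (measurable_gradient ψ).aestronglyMeasurable).add
        (hψ.continuous.aestronglyMeasurable.smul (measurable_gradient w).aestronglyMeasurable)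
    · filter_upwards [ae_restrict_mem measurableSet_Ω, hG] with x hx hGx
      refine (norm_add_le _ _).trans ?_
      rw [norm_smul, norm_smul]
      exact add_le_add (mul_le_mul (hB x (Ω_subset hx)) (norm_gradient_le hψ x) (norm_nonneg _) hB0)
        (mul_le_mul (hC x) hGx (norm_nonneg _) hC0)
  have hgrad : ∫ x in M.Ω, inner ℝ (gradient φm x) (w x • gradient ψ x + ψ x • gradient w x) =
      ∑ e ∈ M.elements, ∫ x in hull e,
          inner ℝ (gradient (fun y => ψ y * A e y) x) (elemGrad φm e) := by
    rw [Ω_eq, setIntegral_union_hull subset_rfl i3]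
    refine Finset.sum_congr rfl fun e he => ?_
    rw [restrict_hull]
    refine integral_congr_ae ?_
    filter_upwards [ae_restrict_mem isOpen_interior.measurableSet,
      ae_restrict_of_ae hψ.ae_differentiableAt] with x hx hdx
    rw [gradient_mul_eq hdx (hasFDerivAt_affine (A e) x).differentiableAt, hφm.gradient_eq he hx,
      gradient_affine, gradient_eq_affGrad (hA e he) hx, hA e he (interior_subset hx),
      real_inner_comm]
  simp only [Mesh.residual, Mesh.load, Mesh.bilin, Jet.mulFun, Jet.ofFun]
  rw [integral_const_mul, hgrad]
  have e1 : ∫ x in M.Ω, ((f x - φm x) * ψ x) * w x =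
      (∫ x in M.Ω, f x * (ψ x * w x)) - ∫ x in M.Ω, φm x * (ψ x * w x) := by
    rw [← integral_sub i1 i2]
    congr 1; ext x; ring
  rw [e1]
  ring

end Mesh

/-! ### The residual of functions localised at an element or a side -/

theorem gradient_mul_eq_zero {d : ℕ} {ψ v : Pt d → ℝ} {U : Set (Pt d)} (hU : IsOpen U)
    (h : ∀ y ∈ U, ψ y = 0) {x : Pt d} (hx : x ∈ U) : gradient (fun y => ψ y * v y) x = 0 := by
  have h0 : (fun y => ψ y * v y) =ᶠ[𝓝 x] fun _ => 0 := by
    filter_upwards [hU.mem_nhds hx] with y hy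
    rw [h y hy, zero_mul]
  rw [gradient_congr h0]
  simp [gradient]

theorem gradient_eq_zero_of_open {d : ℕ} {ψ : Pt d → ℝ} {U : Set (Pt d)} (hU : IsOpen U)
    (h : ∀ y ∈ U, ψ y = 0) {x : Pt d} (hx : x ∈ U) : gradient ψ x = 0 := by
  have := gradient_mul_eq_zero (v := fun _ => 1) hU h hx
  simpa using this

namespace Mesh

variable {n : ℕ} {M : Mesh (n + 1)} {ψ : Pt (n + 1) → ℝ} {L : ℝ≥0}
  {E : Finset (Finset (Pt (n + 1)))} {e : Finset (Pt (n + 1))}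

/-- An interior point of e that also lies in e' forces e = e', by positivity of all its coordinates.
The support condition on the closed domain thus switches off all other elements. -/
theorem eq_zero_of_inactive (hE : E ⊆ M.elements)
    (hsupp : ∀ x ∈ M.closedDomain, ψ x ≠ 0 → ∃ e ∈ E, x ∈ hull e) (he : e ∈ M.elements)
    (heE : e ∉ E) {x : Pt (n + 1)} (hx : x ∈ interior (hull e)) : ψ x = 0 := by
  by_contra h
  obtain ⟨e', he', hx'⟩ := hsupp x (hull_subset_closedDomain he (interior_subset hx)) h
  have h1 := (isSimplex he).mem_interior_iff.1 hx
  have h2 : e ⊆ e' := fun q hq =>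
    mem_of_coord_pos he (hE he') (interior_subset hx) hx' (h1 q hq)
  have := Finset.eq_of_subset_of_card_le h2 (by rw [M.card_eq e he, M.card_eq e' (hE he')])
  exact heE (this ▸ he')

theorem integral_inactive (hE : E ⊆ M.elements)
    (hsupp : ∀ x ∈ M.closedDomain, ψ x ≠ 0 → ∃ e ∈ E, x ∈ hull e) (he : e ∈ M.elements)
    (heE : e ∉ E) (v : Pt (n + 1) → ℝ) (G : Pt (n + 1)) :
    ∫ x in hull e, inner ℝ (gradient (fun y => ψ y * v y) x) G = 0 := by
  rw [restrict_hull]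
  refine setIntegral_eq_zero_of_forall_eq_zero fun x hx => ?_
  rw [gradient_mul_eq_zero isOpen_interior (fun y hy => eq_zero_of_inactive hE hsupp he heE hy) hx,
    inner_zero_left]

/-- The residual of the product of a function supported in one element and a piecewise affine
function. -/
theorem residual_mulFun_element {ε : ℝ} {f π φm w : Pt (n + 1) → ℝ}
    (hf : MemLp f 2 (volume.restrict M.Ω)) (hφm : M.IsPA φm)
    (hψ : LipschitzWith L ψ) (hc : HasCompactSupport ψ) (he : e ∈ M.elements)
    (hsupp : ∀ x, ψ x ≠ 0 → x ∈ hull e) (hN : ∀ x ∈ M.ΓN, ψ x = 0) (hw : M.IsPA w) :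
    M.residual ε f π (.ofFun φm) ((Jet.ofFun ψ).mulFun w) =
      ∫ x in M.Ω, ((f x - φm x) * ψ x) * w x := by
  have hw' := hw
  choose! A hA using hw'
  rw [residual_mulFun hf hφm hψ hc hw hA]
  have h1 : ∫ x in M.ΓN, π x * (ψ x * w x) ∂surf (n + 1) = 0 :=
    setIntegral_eq_zero_of_forall_eq_zero fun x hx => by rw [hN x hx]; ring
  have h2 : ∑ e ∈ M.elements, ∫ x in hull e,
      inner ℝ (gradient (fun y => ψ y * A e y) x) (elemGrad φm e) = 0 := by
    -- On the element itself the integral extends to the whole space, where the gradient of a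
    -- compactly supported function integrates to zero; the other elements do not meet the support
    -- in their interiors.
    refine Finset.sum_eq_zero fun e' he' => ?_
    by_cases hee : e' = e
    · subst hee
      obtain ⟨K, hK⟩ := exists_lipschitz_mul_affine hψ hc (A e')
      rw [setIntegral_eq_integral_of_forall_compl_eq_zero fun x hx => ?_]
      · exact integral_inner_gradient_eq_zero hK hc.mul_right _
      · rw [gradient_mul_eq_zero (isClosed_hull e').isOpen_compl
          (fun y hy => by_contra fun h => hy (hsupp y h)) hx, inner_zero_left]
    · exact integral_inactive (E := {e}) (by simpa using he)
        (fun x _ hx => ⟨e, Finset.mem_singleton_self e, hsupp x hx⟩) he' (by simpa using hee) _ _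
  rw [h1, h2]; ring

/-- The residual of the product of a function supported around one side and a piecewise affine
function. -/
theorem residual_mulFun_side {ε : ℝ} {f π φm w : Pt (n + 1) → ℝ} {s : Finset (Pt (n + 1))}
    (hf : MemLp f 2 (volume.restrict M.Ω)) (hφm : M.IsPA φm)
    (hψ : LipschitzWith L ψ) (hc : HasCompactSupport ψ) (hs : s.card = n + 1)
    (hsupp : ∀ x ∈ M.closedDomain, ψ x ≠ 0 → ∃ e ∈ M.elementsAt s, x ∈ hull e)
    (hhalf : ∀ e ∈ M.elementsAt s, ∀ x, ψ x ≠ 0 →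
      signedDist (barycentre s) (outerNormal e s) x ≤ 0 → x ∈ hull e)
    (hplane : ∀ e ∈ M.elementsAt s, ∀ x ∈ plane (barycentre s) (outerNormal e s),
      ψ x ≠ 0 → x ∈ hull s) (hw : M.IsPA w) :
    M.residual ε f π (.ofFun φm) ((Jet.ofFun ψ).mulFun w) =
      (∫ x in M.Ω, ((f x - φm x) * ψ x) * w x) + (∫ x in M.ΓN, π x * (ψ x * w x) ∂surf (n + 1)) -
        ε ^ 2 * normalJump M φm s * ∫ x in hull s, ψ x * w x ∂surf (n + 1) := by
  have hw' := hw
  choose! A hA using hw'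
  rw [residual_mulFun hf hφm hψ hc hw hA, mul_assoc]
  congr 2
  have hsub : M.elementsAt s ⊆ M.elements := Finset.filter_subset _ _
  rw [← Finset.sum_subset hsub fun e he heE => integral_inactive hsub hsupp he heE _ _, normalJump,
    Finset.sum_mul]
  refine Finset.sum_congr rfl fun e heE => ?_
  obtain ⟨he, hse⟩ := mem_elementsAt.1 heE
  have hsx := isSimplex he
  have hν := norm_outerNormal hsx hse hs
  obtain ⟨K, hK⟩ := exists_lipschitz_mul_affine hψ hc (A e)
  have hhs := integral_inner_gradient_halfSpace (m := barycentre s) hν hK hc.mul_right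
    (elemGrad φm e)
  have hsub' : hull e ⊆ {x | signedDist (barycentre s) (outerNormal e s) x ≤ 0} := fun x hx =>
    (mem_hull_iff_signedDist hsx hse hs fun q _ => hsx.coord_nonneg hx q).1 hx
  have hm : MeasurableSet {x | signedDist (barycentre s) (outerNormal e s) x ≤ 0} :=
    (continuous_signedDist _ _).measurable measurableSet_Iic
  -- Within the support of ψ the element and the half space behind the side coincide, up to the null
  -- set of the plane itself.
  have e1 : ∫ x in {x | signedDist (barycentre s) (outerNormal e s) x ≤ 0},
      inner ℝ (gradient (fun y => ψ y * A e y) x) (elemGrad φm e) =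
      ∫ x in hull e, inner ℝ (gradient (fun y => ψ y * A e y) x) (elemGrad φm e) := by
    refine setIntegral_eq_of_subset_of_ae_sdiff_eq_zero hm.nullMeasurableSet hsub' ?_
    filter_upwards [measure_eq_zero_iff_ae_notMem.1
      (volume_signedDist_eq (m := barycentre s) hν 0)] with x hx0 hx
    have hU : IsOpen ({y | signedDist (barycentre s) (outerNormal e s) y < 0} ∩ (hull e)ᶜ) :=
      (isOpen_lt (continuous_signedDist _ _) continuous_const).inter (isClosed_hull e).isOpen_compl
    rw [gradient_mul_eq_zero hU (fun y hy => by_contra fun h => hy.2 (hhalf e heE y h (le_of_lt hy.1)))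
      ⟨lt_of_le_of_ne hx.1 hx0, hx.2⟩, inner_zero_left]
  have e2 : ∫ x in plane (barycentre s) (outerNormal e s), ψ x * A e x ∂surf (n + 1) =
      ∫ x in hull s, ψ x * A e x ∂surf (n + 1) := by
    refine setIntegral_eq_of_subset_of_forall_sdiff_eq_zero (measurableSet_plane _ _)
      (hull_side_subset_plane hs) fun x hx => ?_
    have : ψ x = 0 := by_contra fun h => hx.2 (hplane e heE x hx.1 h)
    rw [this, zero_mul]
  rw [← e1, hhs, e2, real_inner_comm]
  congr 1
  refine setIntegral_congr_fun (measurableSet_hull s) fun x hx => ?_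
  rw [hA e he (convexHull_mono (by exact_mod_cast hse) hx)]

/-! ### The test inequality -/

open Classical in
/-- One minus the sum of the nodal basis functions of the full-contact nodes. -/
def contactWeight (M : Mesh (n + 1)) (ε : ℝ) (f π gm φm : Pt (n + 1) → ℝ) (x : Pt (n + 1)) : ℝ :=
  1 - ∑ q ∈ M.nodes.filter (M.IsFullContact ε f π gm φm), M.hat q x

section Weight

variable {ε : ℝ} {f π gm φm : Pt (n + 1) → ℝ} {x p : Pt (n + 1)}

theorem mem_nodes {q : Pt (n + 1)} : q ∈ M.nodes ↔ ∃ e ∈ M.elements, q ∈ e := by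
  simp [Mesh.nodes]

-- The nodal basis functions form a partition of unity, so on e the weight is the sum of the
-- coordinates of those vertices that are not in full contact.
open Classical in
theorem contactWeight_eq (he : e ∈ M.elements) (hx : x ∈ hull e) :
    M.contactWeight ε f π gm φm x =
      ∑ q ∈ e.filter (fun q => ¬ M.IsFullContact ε f π gm φm q), coord e q x := by
  have h1 : ∑ q ∈ M.nodes.filter (M.IsFullContact ε f π gm φm), M.hat q x =
      ∑ q ∈ e.filter (M.IsFullContact ε f π gm φm), coord e q x := by
    rw [Finset.sum_congr rfl fun q _ => hat_eq he hx q]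
    symm
    refine Finset.sum_subset ?_ ?_
    · intro q hq
      rw [Finset.mem_filter] at hq ⊢
      exact ⟨mem_nodes.2 ⟨e, he, hq.1⟩, hq.2⟩
    · intro q hq hqe
      rw [Finset.mem_filter] at hq hqe
      rw [coord_of_notMem fun h => hqe ⟨h, hq.2⟩]; rfl
  rw [contactWeight, h1, ← (isSimplex he).sum_coord x,
    ← Finset.sum_filter_add_sum_filter_not e (M.IsFullContact ε f π gm φm)]
  ring

/-- This is where it matters that p is not a full-contact node: its own basis function survives in
the weight and gives the lower bound for the test integrals. -/
theorem coord_le_contactWeight (he : e ∈ M.elements) (hx : x ∈ hull e) (hp : p ∈ e)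
    (hfc : ¬ M.IsFullContact ε f π gm φm p) :
    coord e p x ≤ M.contactWeight ε f π gm φm x := by
  classical
  rw [contactWeight_eq he hx]
  exact Finset.single_le_sum (f := fun q => coord e q x)
    (fun q _ => (isSimplex he).coord_nonneg hx q) (Finset.mem_filter.2 ⟨hp, hfc⟩)

theorem contactWeight_le_one (he : e ∈ M.elements) (hx : x ∈ hull e) :
    M.contactWeight ε f π gm φm x ≤ 1 := by
  classical
  rw [contactWeight_eq he hx, ← (isSimplex he).sum_coord x]
  exact Finset.sum_le_sum_of_subset_of_nonneg (Finset.filter_subset _ _)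
    fun q _ _ => (isSimplex he).coord_nonneg hx q

theorem contactWeight_nonneg (he : e ∈ M.elements) (hx : x ∈ hull e) :
    0 ≤ M.contactWeight ε f π gm φm x := by
  classical
  rw [contactWeight_eq he hx]
  exact Finset.sum_nonneg fun q _ => (isSimplex he).coord_nonneg hx q

theorem continuousOn_contactWeight :
    ContinuousOn (M.contactWeight ε f π gm φm) M.closedDomain := by
  unfold contactWeight
  exact continuousOn_const.sub (continuousOn_finsetSum _ fun q _ => (isPA_hat q).continuousOn)

end Weight

/-- Test functions that are supported in some elements sharing the node `p` and are orthogonal to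
the semi-contact part of the quasi-discrete constraining force. -/
structure LocalTest (M : Mesh (n + 1)) (p : Pt (n + 1)) (E : Finset (Finset (Pt (n + 1))))
    (ψ : Pt (n + 1) → ℝ) : Prop where
  lipschitz : ∃ L, LipschitzWith L ψ
  hasCompactSupport : HasCompactSupport ψ
  dirichlet : ∀ x ∈ M.ΓD, ψ x = 0
  subset : E ⊆ M.star p
  support : ∀ x ∈ M.closedDomain, ψ x ≠ 0 → ∃ e ∈ E, x ∈ hull e
  refined : ∀ q, ∀ x ∈ M.refinedPatch q, ψ x = 0
  ne_zero : ∃ e ∈ E, ∃ x ∈ hull e, ψ x ≠ 0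

namespace LocalTest

variable {p : Pt (n + 1)} (h : LocalTest M p E ψ)
include h

/-- Gradient values are included because the energy inner product has to be cut down to the patch as
well. -/
theorem ae_zero_off_patch :
    ∀ᵐ x ∂volume.restrict M.Ω, x ∉ M.patch p → ψ x = 0 ∧ gradient ψ x = 0 := by
  filter_upwards [ae_mem_interior_Ω] with x ⟨e, he, hx⟩ hxp
  have heE : e ∉ E := fun heE => hxp (interior_hull_subset (h.subset heE) hx)
  have h0 : ∀ y ∈ interior (hull e), ψ y = 0 := fun y hy =>
    eq_zero_of_inactive (h.subset.trans star_subset) h.support he heE hy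
  exact ⟨h0 x hx, gradient_eq_zero_of_open isOpen_interior h0 hx⟩

theorem vanishesOff : M.VanishesOff (M.patch p) (.ofFun ψ) := by
  filter_upwards [h.ae_zero_off_patch] with x hx hxp using (hx hxp).1

theorem isTest : M.IsTest (.ofFun ψ) := by
  obtain ⟨L, hL⟩ := h.lipschitz
  exact isTest_ofFun hL h.hasCompactSupport h.dirichlet

theorem energyNorm_pos (ε : ℝ) : 0 < energyNorm ε M.Ω (.ofFun ψ) := by
  obtain ⟨L, hL⟩ := h.lipschitz
  have hsq := h.isTest.1.1.integrable_sq
  have h1 : 0 ≤ ε ^ 2 * ∫ x in M.Ω, ‖(Jet.ofFun ψ).grad x‖ ^ 2 :=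
    mul_nonneg (sq_nonneg _) (integral_nonneg fun x => sq_nonneg _)
  have h2 : 0 < ∫ x in M.Ω, (Jet.ofFun ψ).val x ^ 2 := by
    refine lt_of_le_of_ne (integral_nonneg fun x => sq_nonneg _) fun h0 => ?_
    have h3 := (integral_eq_zero_iff_of_nonneg (fun x => sq_nonneg _) hsq).1 h0.symm
    have h4 : ψ =ᵐ[volume.restrict M.Ω] fun _ => 0 := by
      filter_upwards [h3] with x hx
      exact pow_eq_zero_iff two_ne_zero |>.1 hx
    have h5 := Measure.eqOn_open_of_ae_eq h4 isOpen_Ω hL.continuous.continuousOn continuousOn_const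
    obtain ⟨e, he, x, hx, hne⟩ := h.ne_zero
    refine hne ?_
    have heM := star_subset (h.subset he)
    -- The point where ψ is nonzero may lie on the boundary of the domain, for example on a Neumann
    -- side; continuity extends the vanishing on Ω to its closure.
    rw [← (isSimplex heM).closure_interior] at hx
    have h6 : closure (interior (hull e)) ⊆ closure M.Ω := closure_mono (interior_hull_subset heM)
    exact (h5.closure hL.continuous continuous_const) (h6 hx)
  exact Real.sqrt_pos.2 (by linarith)

/-- The numerator integrates ψ over a refined patch, where it vanishes. Thus no semi-contact node
contributes to the quasi-discrete force of such a test function. -/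
theorem weightedMean_eq_zero (q : Pt (n + 1)) : M.weightedMean q (.ofFun ψ) = 0 := by
  rw [Mesh.weightedMean]
  split_ifs
  · rfl
  · have : ∀ x, x ∈ M.refinedPatch q → (Jet.ofFun ψ).val x * M.hat q x = 0 := fun x hx => by
      simp [Jet.ofFun, h.refined q x hx]
    rw [setIntegral_eq_zero_of_forall_eq_zero this, zero_div]

/-- The left-hand side is the residual of ψ times the contact weight. It equals the residual minus
the quasi-discrete force at ψ, and adding and subtracting λ splits this into an energy product of φ
− φ_m with ψ and the functional measured by the dual norm. The formula `hres`, linear in w, is an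
assumption so that elements (Γ' empty) and sides (Γ' the side) are treated together. -/
theorem test_bound {ε : ℝ} {f π gm φm : Pt (n + 1) → ℝ} {φ : Jet (n + 1)}
    {Γ' : Set (Pt (n + 1))} {k : Pt (n + 1) → ℝ}
    (hf : MemLp f 2 (volume.restrict M.Ω)) (hφm : M.IsPA φm) (hφ : M.IsH1 φ)
    (hΓ' : MeasurableSet Γ') (hΓ'M : Γ' ⊆ M.closedDomain)
    (hk : IntegrableOn k Γ' (surf (n + 1)))
    (hres : ∀ w, M.IsPA w → M.residual ε f π (.ofFun φm) ((Jet.ofFun ψ).mulFun w) =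
      (∫ x in M.Ω, ((f x - φm x) * ψ x) * w x) + ∫ x in Γ', k x * w x ∂surf (n + 1))
    (hD : M.dualNorm ε (M.patch p)
      (fun ψ => M.residual ε f π φ ψ - M.quasiForce ε f π gm φm ψ) ≠ ∞) :
    (∫ x in M.Ω, ((f x - φm x) * ψ x) * M.contactWeight ε f π gm φm x) +
        (∫ x in Γ', k x * M.contactWeight ε f π gm φm x ∂surf (n + 1)) ≤
      (M.localError ε f π gm φm φ p).toReal * energyNorm ε M.Ω (.ofFun ψ) := by
  classical
  obtain ⟨L, hL⟩ := h.lipschitz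
  obtain ⟨C, hC⟩ := hL.continuous.bounded_above_of_compact_support h.hasCompactSupport
  have hfin : IsFiniteMeasure (volume.restrict M.Ω) := ⟨by simpa using volume_Ω_lt_top⟩
  have hN := h.energyNorm_pos ε
  have htest := h.isTest
  have hφm2 : MemLp (fun x => gradient φm x) 2 (volume.restrict M.Ω) := hφm.memLp_gradient
  set ℓ : Jet (n + 1) → ℝ := fun ψ => M.residual ε f π φ ψ - M.quasiForce ε f π gm φm ψ with hℓ
  -- the dual norm bounds the functional
  have hdual : ℓ (.ofFun ψ) ≤ (M.dualNorm ε (M.patch p) ℓ).toReal * energyNorm ε M.Ω (.ofFun ψ) := by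
    have h1 : ENNReal.ofReal (ℓ (.ofFun ψ) / energyNorm ε M.Ω (.ofFun ψ)) ≤
        M.dualNorm ε (M.patch p) ℓ :=
      le_iSup₂_of_le (Jet.ofFun ψ) ⟨htest, h.vanishesOff⟩ le_rfl
    rw [← div_le_iff₀ hN]
    exact (ENNReal.ofReal_le_iff_le_toReal hD).1 h1
  -- the difference of the residuals
  have hdiff : M.residual ε f π (.ofFun φm) (.ofFun ψ) - M.residual ε f π φ (.ofFun ψ) ≤
      energyNorm ε (M.patch p) (φ - .ofFun φm) * energyNorm ε M.Ω (.ofFun ψ) := by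
    have j1 := (integrable_inner_of_memLp hφ.2.1 htest.1.2.1).const_mul (ε ^ 2)
    have j2 := (integrable_inner_of_memLp hφm2 htest.1.2.1).const_mul (ε ^ 2)
    have j3 : Integrable (fun x => φ.val x * (Jet.ofFun ψ).val x) (volume.restrict M.Ω) :=
      hφ.1.integrable_mul htest.1.1
    have j4 : Integrable (fun x => φm x * (Jet.ofFun ψ).val x) (volume.restrict M.Ω) :=
      hφm.memLp.integrable_mul htest.1.1
    have hsubs : ∀ F : Pt (n + 1) → ℝ,
        (∀ᵐ x ∂volume.restrict M.Ω, x ∉ M.patch p → F x = 0) →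
        ∫ x in M.Ω, F x = ∫ x in M.patch p, F x := by
      intro F hF
      refine setIntegral_eq_of_subset_of_ae_sdiff_eq_zero measurableSet_Ω.nullMeasurableSet
        patch_subset_Ω ?_
      rw [ae_restrict_iff' measurableSet_Ω] at hF
      filter_upwards [hF] with x hx hx' using hx hx'.1 hx'.2
    have e1 : M.residual ε f π (.ofFun φm) (.ofFun ψ) - M.residual ε f π φ (.ofFun ψ) =
        (∫ x in M.patch p, ε ^ 2 * inner ℝ ((φ - .ofFun φm).grad x) ((Jet.ofFun ψ).grad x)) +
          ∫ x in M.patch p, (φ - .ofFun φm).val x * (Jet.ofFun ψ).val x := by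
      rw [← hsubs, ← hsubs]
      · have e2 : ∀ x, ε ^ 2 * inner ℝ ((φ - .ofFun φm).grad x) ((Jet.ofFun ψ).grad x) =
            ε ^ 2 * inner ℝ (φ.grad x) ((Jet.ofFun ψ).grad x) -
              ε ^ 2 * inner ℝ (gradient φm x) ((Jet.ofFun ψ).grad x) := by
          intro x
          rw [← mul_sub, ← inner_sub_left]; rfl
        have e3 : ∀ x, (φ - .ofFun φm).val x * (Jet.ofFun ψ).val x =
            φ.val x * (Jet.ofFun ψ).val x - φm x * (Jet.ofFun ψ).val x := by
          intro x
          rw [← sub_mul]; rfl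
        simp only [e2, e3]
        rw [integral_sub j1 j2, integral_sub j3 j4]
        simp only [Mesh.residual, Mesh.bilin]
        simp only [Jet.ofFun]
        ring
      · filter_upwards [h.ae_zero_off_patch] with x hx hxp
        simp [Jet.ofFun, (hx hxp).1]
      · filter_upwards [h.ae_zero_off_patch] with x hx hxp
        simp [Jet.ofFun, (hx hxp).2]
    rw [e1]
    have hle : (volume : Measure (Pt (n + 1))).restrict (M.patch p) ≤ volume.restrict M.Ω :=
      Measure.restrict_mono patch_subset_Ω le_rfl
    refine (le_abs_self _).trans ((integral_energy_le ε
      ((hφ.1.sub hφm.memLp).mono_measure hle) ((hφ.2.1.sub hφm2).mono_measure hle)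
      (htest.1.1.mono_measure hle) (htest.1.2.1.mono_measure hle)).trans ?_)
    refine mul_le_mul_of_nonneg_left ?_ (Real.sqrt_nonneg _)
    refine Real.sqrt_le_sqrt (add_le_add (mul_le_mul_of_nonneg_left ?_ (sq_nonneg _)) ?_)
    · exact setIntegral_mono_set htest.1.2.1.norm.integrable_sq
        (Eventually.of_forall fun x => sq_nonneg _) patch_subset_Ω.eventuallyLE
    · exact setIntegral_mono_set htest.1.1.integrable_sq
        (Eventually.of_forall fun x => sq_nonneg _) patch_subset_Ω.eventuallyLE
  -- the quasi-discrete force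
  have hone : (Jet.ofFun ψ).mulFun (fun _ => 1) = .ofFun ψ := by
    have : ∀ x : Pt (n + 1), gradient (fun _ : Pt (n + 1) => (1 : ℝ)) x = 0 := fun x => by
      simp [gradient]
    simp [Jet.mulFun, Jet.ofFun, this]
  have i1 : Integrable (fun x => (f x - φm x) * ψ x) (volume.restrict M.Ω) :=
    ((hf.integrable one_le_two).sub (hφm.memLp.integrable one_le_two)).mul_bdd
      hL.continuous.aestronglyMeasurable (Eventually.of_forall hC)
  have i2 : ∀ w, M.IsPA w → Integrable (fun x => ((f x - φm x) * ψ x) * w x)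
      (volume.restrict M.Ω) := by
    intro w hw
    obtain ⟨B, -, hB⟩ := hw.exists_bound
    refine i1.mul_bdd hw.aestronglyMeasurable (c := B) ?_
    filter_upwards [ae_restrict_mem measurableSet_Ω] with x hx using hB x (Ω_subset hx)
  have i3 : ∀ w, M.IsPA w → Integrable (fun x => k x * w x) ((surf (n + 1)).restrict Γ') := by
    intro w hw
    obtain ⟨B, -, hB⟩ := hw.exists_bound
    refine Integrable.mul_bdd (c := B) hk
      ((hw.continuousOn.mono hΓ'M).aestronglyMeasurable hΓ') ?_
    filter_upwards [ae_restrict_mem hΓ'] with x hx using hB x (hΓ'M hx)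
  have hquasi : M.residual ε f π (.ofFun φm) (.ofFun ψ) - M.quasiForce ε f π gm φm (.ofFun ψ) =
      (∫ x in M.Ω, ((f x - φm x) * ψ x) * M.contactWeight ε f π gm φm x) +
        (∫ x in Γ', k x * M.contactWeight ε f π gm φm x ∂surf (n + 1)) := by
    -- The formula with w = 1 gives the residual of ψ itself, and with w = φ_q each full-contact
    -- term; their difference assembles the contact weight under the integrals.
    have e1 := hres _ (isPA_const 1)
    rw [hone] at e1
    simp only [mul_one] at e1
    rw [e1, Mesh.quasiForce]
    simp only [h.weightedMean_eq_zero, mul_zero, Finset.sum_const_zero, zero_add]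
    rw [Finset.sum_congr rfl fun q _ => hres _ (isPA_hat q)]
    simp only [contactWeight, mul_sub, mul_one, Finset.mul_sum]
    rw [integral_sub i1 (integrable_finsetSum _ fun q _ => i2 _ (isPA_hat q)),
      integral_sub hk (integrable_finsetSum _ fun q _ => i3 _ (isPA_hat q)),
      integral_finsetSum _ fun q _ => i2 _ (isPA_hat q),
      integral_finsetSum _ fun q _ => i3 _ (isPA_hat q), Finset.sum_add_distrib]
    ring
  have hloc : (M.localError ε f π gm φm φ p).toReal =
      energyNorm ε (M.patch p) (φ - .ofFun φm) + (M.dualNorm ε (M.patch p) ℓ).toReal := by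
    rw [Mesh.localError, ENNReal.toReal_add ENNReal.ofReal_ne_top hD,
      ENNReal.toReal_ofReal (by exact Real.sqrt_nonneg _)]
  rw [← hquasi, hloc, add_mul]
  have : ℓ (.ofFun ψ) = M.residual ε f π φ (.ofFun ψ) - M.quasiForce ε f π gm φm (.ofFun ψ) := rfl
  linarith

end LocalTest

end Mesh

/-! ### Shape regularity -/

namespace Mesh

variable {n : ℕ} {M : Mesh (n + 1)} {e e' : Finset (Pt (n + 1))} {p : Pt (n + 1)} {κ : ℝ}

theorem abs_coord_sub_le (he : e ∈ M.elements) {c : Pt (n + 1)} {r : ℝ} (hr : 0 < r)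
    (hb : Metric.closedBall c r ⊆ hull e) (q x y : Pt (n + 1)) :
    |coord e q x - coord e q y| ≤ (2 * r)⁻¹ * ‖x - y‖ :=
  affine_lipschitz_of_ball hr (fun _ hx => ⟨(isSimplex he).coord_nonneg (hb hx) q,
    (isSimplex he).coord_le_one (hb hx) q⟩) x y

/-- A barycentric coordinate falls from 1 to 0 along the edge, but its Lipschitz constant is at most
1 / (2r). -/
theorem le_norm_edge (he : e ∈ M.elements) {c : Pt (n + 1)} {r : ℝ} (hr : 0 < r)
    (hb : Metric.closedBall c r ⊆ hull e) {q q' : Pt (n + 1)} (hq : q ∈ e) (hq' : q' ∈ e)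
    (hne : q ≠ q') : 2 * r ≤ ‖q - q'‖ := by
  have h := abs_coord_sub_le he hr hb q q q'
  rw [(isSimplex he).coord_self hq, (isSimplex he).coord_ne hq' hne, sub_zero, abs_one,
    inv_mul_eq_div, le_div_iff₀ (by positivity), one_mul] at h
  exact h

theorem dist_le_diam_hull {x y : Pt (n + 1)} (hx : x ∈ hull e) (hy : y ∈ hull e) :
    ‖x - y‖ ≤ Metric.diam (hull e) := by
  rw [← dist_eq_norm]
  exact Metric.dist_le_diam_of_mem (isCompact_hull e).isBounded hx hy

theorem mem_hull_of_mem {q : Pt (n + 1)} (hq : q ∈ e) : q ∈ hull e := subset_convexHull ℝ _ hq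

theorem exists_ne_of_card {s : Finset (Pt (n + 1))} (hn : 1 ≤ n) (hs : s.card = n + 1) :
    ∃ q ∈ s, ∃ q' ∈ s, q ≠ q' := by
  obtain ⟨a, ha, b, hb, hab⟩ := Finset.one_lt_card.1 (by omega : 1 < s.card)
  exact ⟨a, ha, b, hb, hab⟩

theorem diam_hull_pos (hn : 1 ≤ n) (he : e ∈ M.elements) : 0 < Metric.diam (hull e) := by
  obtain ⟨a, ha, b, hb, hab⟩ := Finset.one_lt_card.1 (by rw [M.card_eq e he]; omega : 1 < e.card)
  exact (norm_pos_iff.2 (sub_ne_zero.2 hab)).trans_le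
    (dist_le_diam_hull (mem_hull_of_mem ha) (mem_hull_of_mem hb))

/-- For n ≥ 1 the common side has an edge, which is at least as long as the inscribed diameter of e
and at most as long as the diameter of e'. -/
theorem diam_le_of_neighbour (hn : 1 ≤ n) (hM : M.ShapeRegular κ) (he : e ∈ M.elements)
    {s : Finset (Pt (n + 1))} (hs : s.card = n + 1) (hse : s ⊆ e) (hse' : s ⊆ e') :
    Metric.diam (hull e) ≤ max κ 1 * Metric.diam (hull e') := by
  obtain ⟨c, r, hr, hb, hd⟩ := hM e he
  obtain ⟨q, hq, q', hq', hne⟩ := exists_ne_of_card hn hs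
  have h1 := le_norm_edge he hr hb (hse hq) (hse hq') hne
  have h2 := dist_le_diam_hull (mem_hull_of_mem (hse' hq)) (mem_hull_of_mem (hse' hq'))
  calc Metric.diam (hull e) ≤ κ * (2 * r) := hd
    _ ≤ max κ 1 * (2 * r) := by gcongr; exact le_max_left _ _
    _ ≤ max κ 1 * Metric.diam (hull e') := by gcongr; exact h1.trans h2

/-- Volume count: shrink every element towards p so that its diameter becomes the smallest diameter
t in the star. The shrunk inscribed balls have radius at least t / (2κ'), are disjoint, and lie in
the ball of radius t about p. -/
theorem card_star_le (hn : 1 ≤ n) (hM : M.ShapeRegular κ) (p : Pt (n + 1)) :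
    ((M.star p).card : ℝ) ≤ (2 * max κ 1) ^ (n + 1) := by
  rcases (M.star p).eq_empty_or_nonempty with h0 | hne
  · rw [h0, Finset.card_empty, Nat.cast_zero]; positivity
  set κ' := max κ 1
  have hκ' : 0 < κ' := lt_of_lt_of_le one_pos (le_max_right _ _)
  obtain ⟨e₀, he₀, hmin⟩ := Finset.exists_min_image (M.star p) (fun e => Metric.diam (hull e)) hne
  set t := Metric.diam (hull e₀)
  have ht : 0 < t := diam_hull_pos hn (star_subset he₀)
  have hball : ∀ e ∈ M.star p, ∃ c : Pt (n + 1), Metric.ball c (t / (2 * κ')) ⊆ interior (hull e) ∧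
      Metric.ball c (t / (2 * κ')) ⊆ Metric.closedBall p t := by
    intro e he
    obtain ⟨heM, hpe⟩ := mem_star.1 he
    obtain ⟨c, r, hr, hb, hd⟩ := hM e heM
    have hde : 0 < Metric.diam (hull e) := diam_hull_pos hn heM
    have hte : t ≤ Metric.diam (hull e) := hmin e he
    set τ := t / Metric.diam (hull e) with hτ
    have hτ0 : 0 < τ := by positivity
    have hτ1 : τ ≤ 1 := (div_le_one hde).2 hte
    have hrad : t / (2 * κ') ≤ τ * r := by
      rw [hτ, div_mul_eq_mul_div, div_le_div_iff₀ (by positivity) hde]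
      have : Metric.diam (hull e) ≤ κ' * (2 * r) :=
        hd.trans (by gcongr; exact le_max_left _ _)
      nlinarith
    have key : ∀ y ∈ Metric.ball (p + τ • (c - p)) (t / (2 * κ')), ∃ z ∈ hull e,
        y = p + τ • (z - p) := by
      intro y hy
      refine ⟨p + τ⁻¹ • (y - p), hb ?_, ?_⟩
      · rw [mem_closedBall_iff_norm]
        have e1 : p + τ⁻¹ • (y - p) - c = τ⁻¹ • (y - (p + τ • (c - p))) := by
          rw [smul_sub, smul_sub, smul_add, smul_smul, inv_mul_cancel₀ hτ0.ne', one_smul]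
          abel
        rw [e1, norm_smul, norm_inv, Real.norm_of_nonneg hτ0.le, inv_mul_le_iff₀ hτ0]
        rw [mem_ball_iff_norm] at hy
        exact hy.le.trans hrad
      · rw [add_sub_cancel_left, smul_smul, mul_inv_cancel₀ hτ0.ne', one_smul]; abel
    refine ⟨p + τ • (c - p), interior_maximal ?_ Metric.isOpen_ball, ?_⟩
    · intro y hy
      obtain ⟨z, hz, rfl⟩ := key y hy
      -- The shrunk copy stays in e by convexity, as p is a vertex of e.
      exact (convex_hull' e).add_smul_sub_mem (mem_hull_of_mem hpe) hz ⟨hτ0.le, hτ1⟩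
    · intro y hy
      obtain ⟨z, hz, rfl⟩ := key y hy
      rw [mem_closedBall_iff_norm, add_sub_cancel_left, norm_smul, Real.norm_of_nonneg hτ0.le]
      calc τ * ‖z - p‖ ≤ τ * Metric.diam (hull e) := by
            gcongr
            exact dist_le_diam_hull hz (mem_hull_of_mem hpe)
        _ = t := by rw [hτ]; field_simp
  choose! c hc1 hc2 using hball
  have hvol : ∑ e ∈ M.star p, volume (Metric.ball (c e) (t / (2 * κ'))) ≤
      volume (Metric.closedBall p t) := by
    rw [← measure_biUnion_finset]
    · exact measure_mono (iUnion₂_subset fun e he => hc2 e he)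
    · intro a ha b hb hab
      exact (disjoint_interior (star_subset ha) (star_subset hb) hab).mono (hc1 a ha) (hc1 b hb)
    · exact fun e _ => Metric.isOpen_ball.measurableSet
  have hω := unitBallVolume_pos (n + 1)
  have hvol' : ∀ e, volume (Metric.ball (c e) (t / (2 * κ'))) =
      ENNReal.ofReal ((t / (2 * κ')) ^ (n + 1) * unitBallVolume (n + 1)) := by
    intro e
    rw [← volume_closedBall_eq (c e) (by positivity),
      Measure.addHaar_closedBall_eq_addHaar_ball]
  simp only [hvol', Finset.sum_const, nsmul_eq_mul] at hvol
  rw [volume_closedBall_eq p ht.le, ← ENNReal.ofReal_natCast, ← ENNReal.ofReal_mul (by positivity),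
    ENNReal.ofReal_le_ofReal_iff (by positivity), ← mul_assoc, div_pow] at hvol
  have h2 := le_of_mul_le_mul_right hvol hω
  rw [mul_div_assoc', div_le_iff₀ (by positivity), mul_comm] at h2
  exact le_of_mul_le_mul_left h2 (by positivity)

variable (M p) in
/-- Adjacency of the elements around a node: they share a side. -/
def starGraph : SimpleGraph (M.star p) :=
  SimpleGraph.fromRel fun a b => ∃ s : Finset (Pt (n + 1)), s.card = n + 1 ∧ s ⊆ a.1 ∧ s ⊆ b.1

/-- A chain may repeat elements. Passing to a graph allows it to be replaced by a path, whose length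
is bounded by the number of elements in the star. -/
theorem reachable_starGraph (he : e ∈ M.star p) (he' : e' ∈ M.star p) :
    (M.starGraph p).Reachable ⟨e, he⟩ ⟨e', he'⟩ := by
  obtain ⟨h1, h2⟩ := mem_star.1 he
  obtain ⟨h1', h2'⟩ := mem_star.1 he'
  have hch := M.chain p e h1 e' h1' h2 h2'
  have : ∀ b, Relation.ReflTransGen
      (fun a b => b ∈ M.elements ∧ p ∈ b ∧ ∃ s : Finset (Pt (n + 1)), s.card = n + 1 ∧ s ⊆ a ∧ s ⊆ b)
      e b → ∃ hb : b ∈ M.star p, (M.starGraph p).Reachable ⟨e, he⟩ ⟨b, hb⟩ := by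
    intro b hb
    induction hb with
    | refl => exact ⟨he, SimpleGraph.Reachable.refl _⟩
    | tail _ hbc ih =>
      rename_i b c _
      obtain ⟨hb, hr⟩ := ih
      obtain ⟨hc1, hc2, hs⟩ := hbc
      have hc : c ∈ M.star p := mem_star.2 ⟨hc1, hc2⟩
      refine ⟨hc, hr.trans ?_⟩
      by_cases hbc : b = c
      · subst hbc; exact SimpleGraph.Reachable.refl _
      · refine SimpleGraph.Adj.reachable ?_
        rw [starGraph, SimpleGraph.fromRel_adj]
        exact ⟨fun h => hbc (congrArg Subtype.val h), Or.inl hs⟩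
  exact (this e' hch).2

theorem diam_le_of_walk (hn : 1 ≤ n) (hM : M.ShapeRegular κ) {a b : M.star p}
    (w : (M.starGraph p).Walk a b) :
    Metric.diam (hull a.1) ≤ max κ 1 ^ w.length * Metric.diam (hull b.1) := by
  induction w with
  | nil => simp
  | cons h w ih =>
    rename_i u v _
    rw [starGraph, SimpleGraph.fromRel_adj] at h
    have hs : ∃ s : Finset (Pt (n + 1)), s.card = n + 1 ∧ s ⊆ u.1 ∧ s ⊆ v.1 := by
      rcases h.2 with h | ⟨s, h1, h2, h3⟩
      · exact h
      · exact ⟨s, h1, h3, h2⟩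
    obtain ⟨s, h1, h2, h3⟩ := hs
    have := diam_le_of_neighbour hn hM (star_subset u.2) h1 h2 h3
    rw [SimpleGraph.Walk.length_cons, pow_succ', mul_assoc]
    exact this.trans (mul_le_mul_of_nonneg_left ih (le_max_of_le_right zero_le_one))

/-- Along a path each step costs a factor κ', and the path has at most as many steps as the star has
elements. -/
theorem diam_le_of_mem_star (hn : 1 ≤ n) (hM : M.ShapeRegular κ) (he : e ∈ M.star p)
    (he' : e' ∈ M.star p) :
    Metric.diam (hull e) ≤
      max κ 1 ^ ⌊(2 * max κ 1) ^ (n + 1)⌋₊ * Metric.diam (hull e') := by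
  classical
  obtain ⟨w, hw⟩ := (reachable_starGraph he he').exists_isPath
  have h1 := diam_le_of_walk hn hM w
  have h2 : w.length ≤ ⌊(2 * max κ 1) ^ (n + 1)⌋₊ := by
    refine Nat.le_floor (le_trans ?_ (card_star_le hn hM p))
    have := hw.length_lt
    rw [Fintype.card_coe] at this
    exact_mod_cast this.le
  exact h1.trans (mul_le_mul_of_nonneg_right (pow_le_pow_right₀ (le_max_right _ _) h2)
    Metric.diam_nonneg)

variable (M p) in
/-- The patch of `p` has at most `N` elements; they have diameter at most `h_p` and inradius at
least `h_p / K`. -/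
structure PatchRegular (K : ℝ) (N : ℕ) : Prop where
  hp_pos : 0 < M.hp p
  diam_le : ∀ e ∈ M.star p, Metric.diam (hull e) ≤ M.hp p
  ball : ∀ e ∈ M.star p, ∃ c, Metric.closedBall c (M.hp p / K) ⊆ hull e
  card_le : (M.star p).card ≤ N

theorem isBounded_patch : Bornology.IsBounded (M.patch p) :=
  isCompact_closedDomain.isBounded.subset (patch_subset_Ω.trans Ω_subset)

theorem diam_hull_le_hp (he : e ∈ M.star p) : Metric.diam (hull e) ≤ M.hp p := by
  rw [Mesh.hp, ← (isSimplex (star_subset he)).closure_interior, Metric.diam_closure]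
  exact Metric.diam_mono (interior_hull_subset he) isBounded_patch

/-- Any two points of the patch are joined via p, so h_p ≤ 2 κ'^N diam e ≤ 4 κ'^(N+1) r for every
element e of the star with inscribed radius r. This explains K, and neither constant depends on the
mesh or the node. -/
theorem exists_patchRegular (hn : 1 ≤ n) (κ : ℝ) : ∃ K : ℝ, 1 ≤ K ∧ ∃ N : ℕ,
    ∀ M : Mesh (n + 1), M.ShapeRegular κ → ∀ p ∈ M.nodes, M.PatchRegular p K N := by
  set κ' := max κ 1
  have hκ' : 1 ≤ κ' := le_max_right _ _
  set N := ⌊(2 * κ') ^ (n + 1)⌋₊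
  refine ⟨4 * κ' ^ (N + 1), ?_, N, fun M hM p hp => ?_⟩
  · have := one_le_pow₀ hκ' (n := N + 1); linarith
  obtain ⟨e₀, he₀, hpe₀⟩ := mem_nodes.1 hp
  have he₀' : e₀ ∈ M.star p := mem_star.2 ⟨he₀, hpe₀⟩
  have hhp : 0 < M.hp p := (diam_hull_pos hn he₀).trans_le (diam_hull_le_hp he₀')
  refine ⟨hhp, fun e he => diam_hull_le_hp he, fun e he => ?_, Nat.le_floor (card_star_le hn hM p)⟩
  obtain ⟨c, r, hr, hb, hd⟩ := hM e (star_subset he)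
  refine ⟨c, (Metric.closedBall_subset_closedBall ?_).trans hb⟩
  have h1 : M.hp p ≤ 2 * (κ' ^ N * Metric.diam (hull e)) := by
    refine Metric.diam_le_of_forall_dist_le (by positivity) fun x hx y hy => ?_
    obtain ⟨a, ha, hxa⟩ := mem_iUnion₂.1 (interior_subset hx)
    obtain ⟨b, hb, hyb⟩ := mem_iUnion₂.1 (interior_subset hy)
    have hxp := dist_le_diam_hull hxa (mem_hull_of_mem (mem_star.1 ha).2)
    have hpy := dist_le_diam_hull (mem_hull_of_mem (mem_star.1 hb).2) hyb
    have h3 := diam_le_of_mem_star hn hM ha he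
    have h4 := diam_le_of_mem_star hn hM hb he
    rw [← dist_eq_norm] at hxp hpy
    have := dist_triangle x p y
    linarith
  have h2 : Metric.diam (hull e) ≤ κ' * (2 * r) := hd.trans (by gcongr; exact le_max_left _ _)
  rw [div_le_iff₀ (by positivity)]
  calc M.hp p ≤ 2 * (κ' ^ N * Metric.diam (hull e)) := h1
    _ ≤ 2 * (κ' ^ N * (κ' * (2 * r))) := by gcongr
    _ = r * (4 * κ' ^ (N + 1)) := by ring

end Mesh

/-! ### Bump functions -/

section Bump

variable {d : ℕ} {m ν : Pt d} {ρ a b : ℝ}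

/-- A cone-shaped bump function around `m`, squeezed in the direction `ν` with slopes `a` and `b`. -/
def bump (m ν : Pt d) (ρ a b : ℝ) (x : Pt d) : ℝ :=
  max 0 (1 - ρ⁻¹ * ‖x - m‖ - a * max (signedDist m ν x) 0 - b * max (-signedDist m ν x) 0)

theorem bump_nonneg (x : Pt d) : 0 ≤ bump m ν ρ a b x := le_max_left _ _

theorem bump_le_one (hρ : 0 ≤ ρ) (ha : 0 ≤ a) (hb : 0 ≤ b) (x : Pt d) : bump m ν ρ a b x ≤ 1 := by
  refine max_le zero_le_one ?_
  have h1 : 0 ≤ ρ⁻¹ * ‖x - m‖ := by positivity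
  have h2 : 0 ≤ a * max (signedDist m ν x) 0 := by positivity
  have h3 : 0 ≤ b * max (-signedDist m ν x) 0 := by positivity
  linarith

theorem bump_ne_zero (hρ : 0 < ρ) (ha : 0 ≤ a) (hb : 0 ≤ b) {x : Pt d}
    (hx : bump m ν ρ a b x ≠ 0) :
    ‖x - m‖ < ρ ∧ a * signedDist m ν x < 1 ∧ b * -signedDist m ν x < 1 := by
  have h0 : 0 < 1 - ρ⁻¹ * ‖x - m‖ - a * max (signedDist m ν x) 0 -
      b * max (-signedDist m ν x) 0 := by
    by_contra hcon
    exact hx (max_eq_left (not_lt.1 hcon))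
  have h1 : 0 ≤ ρ⁻¹ * ‖x - m‖ := by positivity
  have h2 : 0 ≤ a * max (signedDist m ν x) 0 := by positivity
  have h3 : 0 ≤ b * max (-signedDist m ν x) 0 := by positivity
  have h4 : a * signedDist m ν x ≤ a * max (signedDist m ν x) 0 :=
    mul_le_mul_of_nonneg_left (le_max_left _ _) ha
  have h5 : b * -signedDist m ν x ≤ b * max (-signedDist m ν x) 0 :=
    mul_le_mul_of_nonneg_left (le_max_left _ _) hb
  refine ⟨?_, by linarith, by linarith⟩
  have : ρ⁻¹ * ‖x - m‖ < 1 := by linarith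
  rwa [inv_mul_lt_iff₀ hρ, mul_one] at this

theorem half_le_bump (hρ : 0 < ρ) {x : Pt d} (hx : ‖x - m‖ ≤ ρ / 2) (h0 : signedDist m ν x = 0) :
    1 / 2 ≤ bump m ν ρ a b x := by
  have : ρ⁻¹ * ‖x - m‖ ≤ 1 / 2 := by
    rw [inv_mul_le_iff₀ hρ]; linarith
  rw [bump, h0]
  simp only [neg_zero, max_self, mul_zero, sub_zero]
  exact le_max_of_le_right (by linarith)

theorem bump_center : bump m ν ρ a b m = 1 := by
  simp [bump, signedDist_self]

theorem lipschitz_bump (hν : ‖ν‖ ≤ 1) (hρ : 0 ≤ ρ) (ha : 0 ≤ a) (hb : 0 ≤ b) :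
    LipschitzWith (ρ⁻¹ + a + b).toNNReal (bump m ν ρ a b) := by
  refine LipschitzWith.const_max (LipschitzWith.of_dist_le_mul fun x y => ?_) 0
  have hK : 0 ≤ ρ⁻¹ + a + b := by positivity
  rw [Real.coe_toNNReal _ hK, Real.dist_eq, dist_eq_norm]
  have hs : |signedDist m ν x - signedDist m ν y| ≤ ‖x - y‖ := by
    have : signedDist m ν x - signedDist m ν y = inner ℝ ν (x - y) := by
      rw [signedDist, signedDist, ← inner_sub_right]; congr 1; abel
    rw [this]
    exact (abs_real_inner_le_norm _ _).trans (mul_le_of_le_one_left (norm_nonneg _) hν)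
  have h1 : |‖x - m‖ - ‖y - m‖| ≤ ‖x - y‖ := by
    have := abs_norm_sub_norm_le (x - m) (y - m)
    rwa [sub_sub_sub_cancel_right] at this
  have h2 := (abs_max_sub_max_le_abs (signedDist m ν x) (signedDist m ν y) 0).trans hs
  have h3 : |max (-signedDist m ν x) 0 - max (-signedDist m ν y) 0| ≤ ‖x - y‖ := by
    refine (abs_max_sub_max_le_abs _ _ 0).trans ?_
    rwa [neg_sub_neg, abs_sub_comm]
  rw [abs_le] at h1 h2 h3 ⊢
  have hρ' : 0 ≤ ρ⁻¹ := inv_nonneg.2 hρ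
  constructor
  · nlinarith [mul_le_mul_of_nonneg_left h1.2 hρ', mul_le_mul_of_nonneg_left h2.2 ha,
      mul_le_mul_of_nonneg_left h3.2 hb]
  · nlinarith [mul_le_mul_of_nonneg_left h1.1 hρ', mul_le_mul_of_nonneg_left h2.1 ha,
      mul_le_mul_of_nonneg_left h3.1 hb]

theorem hasCompactSupport_bump (hρ : 0 < ρ) (ha : 0 ≤ a) (hb : 0 ≤ b) :
    HasCompactSupport (bump m ν ρ a b) :=
  HasCompactSupport.intro (isCompact_closedBall m ρ) fun x hx => by
    by_contra h
    exact hx (mem_closedBall_iff_norm.2 (bump_ne_zero hρ ha hb h).1.le)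

end Bump

/-! ### Energy norms of localised functions and the refined patches -/

namespace Mesh

variable {n : ℕ} {M : Mesh (n + 1)} {e : Finset (Pt (n + 1))} {p : Pt (n + 1)}
  {ψ : Pt (n + 1) → ℝ} {L : ℝ≥0} {ε : ℝ}

/-- A bound for the energy norm of a bounded Lipschitz function supported in a small set. -/
theorem energyNorm_le (hψ : LipschitzWith L ψ) (hψ1 : ∀ x, |ψ x| ≤ 1)
    {S : Set (Pt (n + 1))} (hS : MeasurableSet S) {V Λ : ℝ} (hV0 : 0 ≤ V)
    (hV : volume S ≤ ENNReal.ofReal V)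
    (hoff : ∀ᵐ x ∂volume.restrict M.Ω, x ∉ S → ψ x = 0 ∧ gradient ψ x = 0)
    (hΛ : ∀ᵐ x ∂volume.restrict M.Ω, ‖gradient ψ x‖ ≤ Λ) :
    (∫ x in M.Ω, ψ x ^ 2) ≤ V ∧
      energyNorm ε M.Ω (.ofFun ψ) ≤ Real.sqrt ((ε ^ 2 * Λ ^ 2 + 1) * V) := by
  have hVS : (volume S).toReal ≤ V := ENNReal.toReal_le_of_le_ofReal hV0 hV
  have hSfin : volume S < ∞ := hV.trans_lt ENNReal.ofReal_lt_top
  -- Used twice, for ψ² with bound 1 and for the squared gradient with bound Λ².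
  have key : ∀ (F : Pt (n + 1) → ℝ) (c : ℝ), 0 ≤ c → AEStronglyMeasurable F (volume.restrict M.Ω) →
      (∀ᵐ x ∂volume.restrict M.Ω, 0 ≤ F x) →
      (∀ᵐ x ∂volume.restrict M.Ω, F x ≤ c) → (∀ᵐ x ∂volume.restrict M.Ω, x ∉ S → F x = 0) →
      ∫ x in M.Ω, F x ≤ c * V := by
    intro F c hc hF hF0 hFc hFS
    have hle : F ≤ᵐ[volume.restrict M.Ω] S.indicator fun _ => c := by
      filter_upwards [hFc, hFS] with x h1 h2
      by_cases hx : x ∈ S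
      · rwa [indicator_of_mem hx]
      · rw [indicator_of_notMem hx, h2 hx]
    have hint : Integrable (S.indicator fun _ => c) (volume.restrict M.Ω) := by
      rw [integrable_indicator_iff hS]
      exact integrableOn_const ((Measure.restrict_apply_le _ _).trans_lt hSfin).ne
    refine (integral_mono_of_nonneg hF0 hint hle).trans ?_
    rw [integral_indicator hS, setIntegral_const, smul_eq_mul, mul_comm]
    refine mul_le_mul_of_nonneg_left (le_trans ?_ hVS) hc
    exact ENNReal.toReal_mono hSfin.ne (Measure.restrict_apply_le _ _)
  have h1 : ∫ x in M.Ω, ψ x ^ 2 ≤ 1 * V := by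
    refine key _ 1 zero_le_one (hψ.continuous.pow 2).aestronglyMeasurable
      (Eventually.of_forall fun x => sq_nonneg _) (Eventually.of_forall fun x => ?_) ?_
    · rw [← sq_abs]; exact pow_le_one₀ (abs_nonneg _) (hψ1 x)
    · filter_upwards [hoff] with x hx hxS
      rw [(hx hxS).1]; ring
  have h2 : ∫ x in M.Ω, ‖gradient ψ x‖ ^ 2 ≤ Λ ^ 2 * V := by
    refine key _ _ (sq_nonneg _) ((measurable_gradient ψ).norm.pow_const 2).aestronglyMeasurable
      (Eventually.of_forall fun x => sq_nonneg _) ?_ ?_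
    · filter_upwards [hΛ] with x hx
      exact pow_le_pow_left₀ (norm_nonneg _) hx 2
    · filter_upwards [hoff] with x hx hxS
      rw [(hx hxS).2]; simp
  rw [one_mul] at h1
  refine ⟨h1, Real.sqrt_le_sqrt ?_⟩
  have := mul_le_mul_of_nonneg_left h2 (sq_nonneg ε)
  simp only [Jet.ofFun]
  linarith

/-- The homothety sends a coordinate value t at q to 3/4 + t/4. -/
theorem refinedPatch_coord {q x : Pt (n + 1)} (hx : x ∈ M.refinedPatch q) :
    ∃ e ∈ M.elements, x ∈ hull e ∧ 3 / 4 ≤ coord e q x := by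
  obtain ⟨y, hy, rfl⟩ := hx
  obtain ⟨e, he, hye⟩ := mem_iUnion₂.1 (interior_subset hy)
  obtain ⟨heM, hqe⟩ := mem_star.1 he
  have hy' : AffineMap.homothety q (1 / 4 : ℝ) y = q + (1 / 4 : ℝ) • (y - q) := by
    rw [AffineMap.homothety_apply]; simp [add_comm]
  have hx : q + (1 / 4 : ℝ) • (y - q) ∈ hull e :=
    (convex_hull' e).add_smul_sub_mem (mem_hull_of_mem hqe) hye (by norm_num)
  refine ⟨e, heM, by rwa [hy'], ?_⟩
  rw [hy']
  have h1 := affine_sub (coord e q) (q + (1 / 4 : ℝ) • (y - q)) q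
  have h2 := affine_sub (coord e q) y q
  rw [add_sub_cancel_left, inner_smul_right, ← h2, (isSimplex heM).coord_self hqe] at h1
  have h3 := (isSimplex heM).coord_nonneg hye q
  linarith

/-- The threshold 3/4 leaves room around the barycentres of sides: for n = 1 these already have two
coordinates equal to 1/2, which a patch of ratio 1/2 would touch. -/
theorem eq_zero_of_refinedPatch {E : Finset (Finset (Pt (n + 1)))} (hE : E ⊆ M.elements)
    (hsupp : ∀ x ∈ M.closedDomain, ψ x ≠ 0 → ∃ e ∈ E, x ∈ hull e)
    (hcoord : ∀ e ∈ E, ∀ x ∈ hull e, ψ x ≠ 0 → ∀ q, coord e q x < 3 / 4)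
    (q x : Pt (n + 1)) (hx : x ∈ M.refinedPatch q) : ψ x = 0 := by
  by_contra h
  obtain ⟨e', he', hx', h34⟩ := refinedPatch_coord hx
  obtain ⟨e, he, hxe⟩ := hsupp x (hull_subset_closedDomain he' hx') h
  have := hcoord e he x hxe h q
  rw [coord_eq_coord (hE he) he' hxe hx'] at this
  linarith

end Mesh

/-! ### The element residual -/

/-- From β, move by ρ/2 in the direction in which |A| grows. On the ball of radius ρ/4 around the
new point, σA is at least |A β| + (ρ/2 − ρ/4)‖∇A‖, which is comparable to the upper bound for |A| at
distance H. This takes the place of an equivalence of norms on affine functions. -/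
theorem exists_ball_affine {d : ℕ} (A : Pt d →ᵃ[ℝ] ℝ) (β : Pt d) {ρ H : ℝ} (hρ : 0 < ρ)
    (hρH : ρ ≤ H) : ∃ σ : ℝ, |σ| = 1 ∧ ∃ m : Pt d,
      Metric.closedBall m (ρ / 4) ⊆ Metric.closedBall β ρ ∧
      (∀ x ∈ Metric.closedBall m (ρ / 4), ρ / (4 * H) * (|A β| + ‖affGrad A‖ * H) ≤ σ * A x) ∧
      ∀ x, ‖x - β‖ ≤ H → |A x| ≤ |A β| + ‖affGrad A‖ * H := by
  have hH : 0 < H := hρ.trans_le hρH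
  set g := affGrad A
  obtain ⟨σ, hσ, hσA⟩ : ∃ σ : ℝ, |σ| = 1 ∧ σ * A β = |A β| := by
    rcases le_total 0 (A β) with h | h
    · exact ⟨1, abs_one, by rw [one_mul, abs_of_nonneg h]⟩
    · exact ⟨-1, by simp, by rw [abs_of_nonpos h]; ring⟩
  set u : Pt d := σ • (‖g‖⁻¹ • g)
  have hu : ‖u‖ ≤ 1 := by
    rw [norm_smul, norm_smul, norm_inv, norm_norm, Real.norm_eq_abs, hσ, one_mul]
    exact inv_mul_le_one
  have hσ2 : σ * σ = 1 := by rw [← abs_mul_abs_self, hσ, one_mul]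
  have hgu : σ * inner ℝ g u = ‖g‖ := by
    rw [inner_smul_right, inner_smul_right, real_inner_self_eq_norm_sq, ← mul_assoc, hσ2, one_mul]
    by_cases h0 : ‖g‖ = 0
    · rw [h0]; simp
    · field_simp
  refine ⟨σ, hσ, β + (ρ / 2) • u, ?_, ?_, ?_⟩
  · intro x hx
    rw [mem_closedBall_iff_norm] at hx ⊢
    have e1 : x - β = (x - (β + (ρ / 2) • u)) + (ρ / 2) • u := by abel
    rw [e1]
    refine (norm_add_le _ _).trans ?_
    rw [norm_smul, Real.norm_of_nonneg (by positivity)]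
    nlinarith
  · intro x hx
    rw [mem_closedBall_iff_norm] at hx
    have e1 : A x = A β + (inner ℝ g (x - (β + (ρ / 2) • u)) + (ρ / 2) * inner ℝ g u) := by
      have := affine_sub A x β
      rw [← inner_smul_right, ← inner_add_right]
      have e2 : (x - (β + (ρ / 2) • u)) + (ρ / 2) • u = x - β := by abel
      rw [e2]; linarith
    have h2 : -(‖g‖ * (ρ / 4)) ≤ σ * inner ℝ g (x - (β + (ρ / 2) • u)) := by
      refine neg_le_of_abs_le ?_
      rw [abs_mul, hσ, one_mul]
      exact (abs_real_inner_le_norm _ _).trans (mul_le_mul_of_nonneg_left hx (norm_nonneg _))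
    have h3 : σ * A x = |A β| + σ * inner ℝ g (x - (β + (ρ / 2) • u)) + (ρ / 2) * ‖g‖ := by
      rw [e1, mul_add, mul_add, hσA, ← hgu]; ring
    have h4 : ρ / (4 * H) * |A β| ≤ |A β| := by
      refine mul_le_of_le_one_left (abs_nonneg _) ?_
      rw [div_le_one (by positivity)]; linarith
    have h5 : ρ / (4 * H) * (‖g‖ * H) = ρ / 4 * ‖g‖ := by field_simp
    rw [h3, mul_add, h5]
    linarith
  · intro x hx
    have := affine_sub A x β
    have e1 : A x = A β + inner ℝ g (x - β) := by linarith
    rw [e1]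
    refine (abs_add_le _ _).trans ?_
    have := (abs_real_inner_le_norm g (x - β)).trans
      (mul_le_mul_of_nonneg_left hx (norm_nonneg _))
    linarith

/-! ### Testing with a bump inside an element -/

namespace Mesh

variable {n : ℕ} {M : Mesh (n + 1)} {e e' s t : Finset (Pt (n + 1))} {p x : Pt (n + 1)}
  {ψ : Pt (n + 1) → ℝ} {L : ℝ≥0} {ε K : ℝ} {N : ℕ}

/-- Every face that contains x has all vertices carrying x; comparing numbers of vertices then
decides which sides a bump can meet. -/
theorem subset_of_coord_pos (he : e ∈ M.elements) (he' : e' ∈ M.elements) (hx : x ∈ hull e)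
    (ht : ∀ q ∈ t, 0 < coord e q x) (hse : s ⊆ e') (hxs : x ∈ hull s) : t ⊆ s := by
  intro q hq
  by_contra hqs
  have hx' : x ∈ hull e' := convexHull_mono (by exact_mod_cast hse) hxs
  have h1 := ht q hq
  rw [coord_eq_coord he he' hx hx', (isSimplex he').coord_eq_zero_of_mem_face hse hxs hqs] at h1
  exact lt_irrefl _ h1

namespace PatchRegular

variable (hreg : M.PatchRegular p K N)
include hreg

theorem abs_coord_sub_le (hK : 1 ≤ K) (he : e ∈ M.star p) (q x y : Pt (n + 1)) :
    |coord e q x - coord e q y| ≤ K / (2 * M.hp p) * ‖x - y‖ := by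
  obtain ⟨c, hc⟩ := hreg.ball e he
  have hH := hreg.hp_pos
  have := Mesh.abs_coord_sub_le (star_subset he) (by positivity) hc q x y
  have e1 : (2 * (M.hp p / K))⁻¹ = K / (2 * M.hp p) := by field_simp
  rwa [e1] at this

/-- At the barycentre the coordinates are 1 / (n + 2), and with Lipschitz constant K / (2 h_p) they
change by at most half of that within the given radius. The upper bound 3 / (2 (n + 2)) is at most
1/2 because n ≥ 1. -/
theorem coord_near_barycentre (hn : 1 ≤ n) (hK : 1 ≤ K) (he : e ∈ M.star p) {x : Pt (n + 1)}
    (hx : ‖x - barycentre e‖ ≤ M.hp p / (K * (n + 2))) :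
    (∀ q ∈ e, 1 / (2 * ((n : ℝ) + 2)) ≤ coord e q x) ∧ ∀ q, coord e q x < 3 / 4 := by
  have hH := hreg.hp_pos
  have hsx := isSimplex (star_subset he)
  have h1 : ∀ q ∈ e, |coord e q x - 1 / ((n : ℝ) + 2)| ≤ 1 / (2 * ((n : ℝ) + 2)) := by
    intro q hq
    have h := hreg.abs_coord_sub_le hK he q x (barycentre e)
    rw [hsx.coord_barycentre subset_rfl hsx.nonempty hq, hsx.card] at h
    have e1 : ((n + 1 + 1 : ℕ) : ℝ)⁻¹ = 1 / ((n : ℝ) + 2) := by push_cast; rw [one_div]; ring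
    rw [e1] at h
    refine h.trans ?_
    calc K / (2 * M.hp p) * ‖x - barycentre e‖
        ≤ K / (2 * M.hp p) * (M.hp p / (K * (n + 2))) := by gcongr
      _ = 1 / (2 * ((n : ℝ) + 2)) := by field_simp
  have e2 : 1 / ((n : ℝ) + 2) = 2 * (1 / (2 * ((n : ℝ) + 2))) := by field_simp
  have hn' : (1 : ℝ) ≤ n := by exact_mod_cast hn
  have h6 : 1 / (2 * ((n : ℝ) + 2)) ≤ 1 / 6 := by
    apply one_div_le_one_div_of_le <;> linarith
  refine ⟨fun q hq => ?_, fun q => ?_⟩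
  · have := abs_le.1 (h1 q hq)
    linarith [this.1]
  · by_cases hq : q ∈ e
    · have := abs_le.1 (h1 q hq)
      linarith [this.2]
    · rw [coord_of_notMem hq]; norm_num

end PatchRegular

theorem weight_nonneg (hε : 0 < ε) (p : Pt (n + 1)) : 0 ≤ M.weight ε p :=
  le_min (div_nonneg Metric.diam_nonneg hε.le) zero_le_one

theorem weight_le_one (p : Pt (n + 1)) : M.weight ε p ≤ 1 := min_le_right _ _

theorem weight_mul_le (hε : 0 < ε) (p : Pt (n + 1)) : M.weight ε p * ε ≤ M.hp p := by
  have := min_le_left (M.hp p / ε) 1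
  rwa [le_div_iff₀ hε] at this

/-- Test functions supported well inside an element. -/
theorem localTest_of_element (he : e ∈ M.star p) (hψ : LipschitzWith L ψ)
    (hc : HasCompactSupport ψ)
    (hpos : ∀ x, ψ x ≠ 0 → (∀ q ∈ e, 0 < coord e q x) ∧ ∀ q, coord e q x < 3 / 4)
    (hne : ∃ x, ψ x ≠ 0) :
    LocalTest M p {e} ψ ∧ (∀ x, ψ x ≠ 0 → x ∈ interior (hull e)) ∧ ∀ x ∈ M.ΓN, ψ x = 0 := by
  have heM := star_subset he
  have hsx := isSimplex heM
  have hint : ∀ x, ψ x ≠ 0 → x ∈ interior (hull e) := fun x hx =>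
    hsx.mem_interior_iff.2 (hpos x hx).1
  -- All n + 2 vertices carry a point of the support, so it cannot lie on a side, which has only n +
  -- 1 vertices.
  have hside : ∀ s : Finset (Pt (n + 1)), s.card = n + 1 → (∃ e' ∈ M.elements, s ⊆ e') →
      ∀ x ∈ hull s, ψ x = 0 := by
    rintro s hs ⟨e', he', hse'⟩ x hx
    by_contra h
    have := subset_of_coord_pos heM he' (interior_subset (hint x h)) (hpos x h).1 hse' hx
    have := Finset.card_le_card this
    rw [hs, hsx.card] at this
    omega
  have hsupp : ∀ x ∈ M.closedDomain, ψ x ≠ 0 → ∃ e' ∈ ({e} : Finset (Finset (Pt (n + 1)))),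
      x ∈ hull e' := fun x _ hx =>
    ⟨e, Finset.mem_singleton_self e, interior_subset (hint x hx)⟩
  refine ⟨⟨⟨L, hψ⟩, hc, ?_, by simpa using he, hsupp, ?_, ?_⟩, hint, ?_⟩
  · intro x hx
    obtain ⟨s, hs, hxs⟩ := mem_iUnion₂.1 hx
    obtain ⟨e', he', -⟩ := M.dirichletSides_boundary s hs
    exact hside s (M.dirichletSides_card s hs) ⟨e', he'⟩ x hxs
  · refine eq_zero_of_refinedPatch (E := {e}) (by simpa using heM) hsupp ?_
    intro e' he' x _ hx q
    rw [Finset.mem_singleton.1 he']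
    exact (hpos x hx).2 q
  · obtain ⟨x, hx⟩ := hne
    exact ⟨e, Finset.mem_singleton_self e, x, interior_subset (hint x hx), hx⟩
  · intro x hx
    obtain ⟨s, hs, hxs⟩ := mem_iUnion₂.1 hx
    obtain ⟨e', he', hse', hcard⟩ := mem_sides.1
      (Finset.mem_filter.1 (Finset.mem_filter.1 hs).1).1
    exact hside s hcard ⟨e', he', hse'⟩ x hxs

section ElementBound

variable {f π gm φm : Pt (n + 1) → ℝ} {φ : Jet (n + 1)}

/-- The test function is a cone on the ball, with the sign of c − A there. The weighted residual is
bounded below through Q and above by the test inequality, the difference of f and c going to the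
oscillation; dividing by √V gives the claim. -/
theorem element_test (hn : 1 ≤ n) (hreg : M.PatchRegular p K N) (hK : 1 ≤ K)
    (hf : MemLp f 2 (volume.restrict M.Ω)) (hφm : M.IsPA φm) (hφ : M.IsH1 φ)
    (hD : M.dualNorm ε (M.patch p)
      (fun ψ => M.residual ε f π φ ψ - M.quasiForce ε f π gm φm ψ) ≠ ∞)
    (hfc : ¬ M.IsFullContact ε f π gm φm p) (he : e ∈ M.star p)
    {A : Pt (n + 1) →ᵃ[ℝ] ℝ} (hA : EqOn φm A (hull e)) (c : ℝ) {σ : ℝ} (hσ : |σ| = 1)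
    {m : Pt (n + 1)} {r Q : ℝ} (hr : 0 < r) (hQ : 0 ≤ Q)
    (hball : Metric.closedBall m r ⊆ Metric.closedBall (barycentre e) (M.hp p / (K * (n + 2))))
    (hσA : ∀ x ∈ Metric.closedBall m r, Q ≤ σ * (c - A x)) :
    1 / (4 * ((n : ℝ) + 2)) * (1 / 2) ^ (n + 1) * Q *
        Real.sqrt (r ^ (n + 1) * unitBallVolume (n + 1)) ≤
      (M.localError ε f π gm φm φ p).toReal * Real.sqrt (ε ^ 2 * r⁻¹ ^ 2 + 1) +
        Real.sqrt (∫ x in hull e, (c - f x) ^ 2) := by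
  have heM := star_subset he
  have hpe := (mem_star.1 he).2
  have hsx := isSimplex heM
  have hω := unitBallVolume_pos (n + 1)
  set V := r ^ (n + 1) * unitBallVolume (n + 1) with hVdef
  have hV : 0 < V := by positivity
  set B : Pt (n + 1) → ℝ := bump m 0 r 0 0
  set ψ : Pt (n + 1) → ℝ := fun x => σ * B x with hψdef
  have hσ0 : σ ≠ 0 := fun h => by rw [h] at hσ; simp at hσ
  have hBL : LipschitzWith (r⁻¹ + 0 + 0).toNNReal B := lipschitz_bump (by simp) hr.le le_rfl le_rfl
  have hψL : LipschitzWith r⁻¹.toNNReal ψ := by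
    refine LipschitzWith.of_dist_le_mul fun x y => ?_
    have := hBL.dist_le_mul x y
    rw [add_zero, add_zero] at this
    rw [Real.dist_eq, hψdef]
    simp only
    rw [← mul_sub, abs_mul, hσ, one_mul, ← Real.dist_eq]
    exact this
  have hψc : HasCompactSupport ψ := (hasCompactSupport_bump hr le_rfl le_rfl).mul_left
  have hψB : ∀ x, ψ x ≠ 0 → x ∈ Metric.closedBall m r := fun x hx =>
    mem_closedBall_iff_norm.2 (bump_ne_zero hr le_rfl le_rfl (right_ne_zero_of_mul hx)).1.le
  have hψ1 : ∀ x, |ψ x| ≤ 1 := fun x => by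
    rw [hψdef]; simp only
    rw [abs_mul, hσ, one_mul, abs_of_nonneg (bump_nonneg x)]
    exact bump_le_one hr.le le_rfl le_rfl x
  have hcoord : ∀ x ∈ Metric.closedBall m r,
      (∀ q ∈ e, 1 / (2 * ((n : ℝ) + 2)) ≤ coord e q x) ∧ ∀ q, coord e q x < 3 / 4 := fun x hx =>
    hreg.coord_near_barycentre hn hK he (mem_closedBall_iff_norm.1 (hball hx))
  have hn2 : (0 : ℝ) < 1 / (2 * ((n : ℝ) + 2)) := by positivity
  have hBe : Metric.closedBall m r ⊆ hull e := fun x hx =>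
    hsx.mem_hull_iff.2 fun q hq => hn2.le.trans ((hcoord x hx).1 q hq)
  have hm : ψ m ≠ 0 := mul_ne_zero hσ0 (by rw [show B m = 1 from bump_center]; exact one_ne_zero)
  obtain ⟨hloc, hint, hN⟩ := localTest_of_element he hψL hψc
    (fun x hx => ⟨fun q hq => hn2.trans_le ((hcoord x (hψB x hx)).1 q hq), (hcoord x (hψB x hx)).2⟩)
    ⟨m, hm⟩
  set θ := M.contactWeight ε f π gm φm with hθ
  have htest := hloc.test_bound (gm := gm) (π := π) (Γ' := ∅) (k := fun _ => 0) hf hφm hφ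
    MeasurableSet.empty (empty_subset _) (by simp) (fun w hw => by
      rw [residual_mulFun_element hf hφm hψL hψc heM (fun x hx => interior_subset (hint x hx)) hN hw]
      simp) hD
  simp only [Measure.restrict_empty, integral_zero_measure, add_zero] at htest
  -- the energy norm of the test function
  have hEN := energyNorm_le (M := M) (ε := ε) hψL hψ1 (S := Metric.closedBall m r)
    Metric.isClosed_closedBall.measurableSet (V := V) (Λ := r⁻¹) hV.le
    (volume_closedBall_eq m hr.le).le
    (Eventually.of_forall fun x hx => by
      have h0 : ∀ y ∈ (Metric.closedBall m r)ᶜ, ψ y = 0 := fun y hy =>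
        by_contra fun h => hy (hψB y h)
      exact ⟨h0 x hx, gradient_eq_zero_of_open Metric.isClosed_closedBall.isOpen_compl h0 hx⟩)
    (Eventually.of_forall fun x => by
      have := norm_gradient_le hψL x
      rwa [Real.coe_toNNReal _ (by positivity)] at this)
  -- restriction to the element
  have hI : ∫ x in M.Ω, ((f x - φm x) * ψ x) * θ x = ∫ x in hull e, ((f x - φm x) * ψ x) * θ x := by
    rw [restrict_hull]
    refine setIntegral_eq_of_subset_of_ae_sdiff_eq_zero measurableSet_Ω.nullMeasurableSet
      (interior_hull_subset heM) (Eventually.of_forall fun x hx => ?_)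
    have : ψ x = 0 := by_contra fun h => hx.2 (hint x h)
    rw [this]; ring
  have hfe : MemLp f 2 (volume.restrict (hull e)) := hf.mono_measure (restrict_hull_le heM)
  have hfin : IsFiniteMeasure (volume.restrict (hull e)) :=
    ⟨by simpa using (isCompact_hull e).measure_lt_top⟩
  have hθm : AEStronglyMeasurable θ (volume.restrict (hull e)) :=
    (continuousOn_contactWeight.mono (hull_subset_closedDomain heM)).aestronglyMeasurable
      (measurableSet_hull e)
  have hψθm : AEStronglyMeasurable (fun x => ψ x * θ x) (volume.restrict (hull e)) :=
    hψL.continuous.aestronglyMeasurable.mul hθm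
  have hψθb : ∀ x ∈ hull e, |ψ x * θ x| ≤ |ψ x| := fun x hx => by
    rw [abs_mul, abs_of_nonneg (contactWeight_nonneg heM hx)]
    exact mul_le_of_le_one_right (abs_nonneg _) (contactWeight_le_one heM hx)
  have hψθL : MemLp (fun x => ψ x * θ x) 2 (volume.restrict (hull e)) := by
    refine MemLp.of_bound hψθm 1 ?_
    filter_upwards [ae_restrict_mem (measurableSet_hull e)] with x hx
    exact (hψθb x hx).trans (hψ1 x)
  have hcf : MemLp (fun x => c - f x) 2 (volume.restrict (hull e)) := (memLp_const c).sub hfe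
  have hcA : MemLp (fun x => c - A x) 2 (volume.restrict (hull e)) := by
    refine (memLp_const c).sub ?_
    obtain ⟨B', hB'⟩ := (isCompact_hull e).exists_bound_of_continuousOn
      (continuous_affine A).continuousOn
    refine MemLp.of_bound (continuous_affine A).aestronglyMeasurable B' ?_
    filter_upwards [ae_restrict_mem (measurableSet_hull e)] with x hx using hB' x hx
  have i1 : Integrable (fun x => (c - A x) * (ψ x * θ x)) (volume.restrict (hull e)) :=
    hcA.integrable_mul hψθL
  have i2 : Integrable (fun x => (c - f x) * (ψ x * θ x)) (volume.restrict (hull e)) :=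
    hcf.integrable_mul hψθL
  have hsplit : ∫ x in hull e, ((f x - φm x) * ψ x) * θ x =
      (∫ x in hull e, (c - A x) * (ψ x * θ x)) - ∫ x in hull e, (c - f x) * (ψ x * θ x) := by
    rw [← integral_sub i1 i2]
    refine setIntegral_congr_fun (measurableSet_hull e) fun x hx => ?_
    rw [hA hx]; ring
  -- the oscillation term
  have hosc : ∫ x in hull e, (c - f x) * (ψ x * θ x) ≤
      Real.sqrt (∫ x in hull e, (c - f x) ^ 2) * Real.sqrt V := by
    refine (le_abs_self _).trans ((integral_mul_le_sqrt hcf hψθL).trans ?_)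
    refine mul_le_mul_of_nonneg_left (Real.sqrt_le_sqrt ?_) (Real.sqrt_nonneg _)
    refine le_trans ?_ hEN.1
    calc ∫ x in hull e, (ψ x * θ x) ^ 2 ≤ ∫ x in hull e, ψ x ^ 2 := by
          refine setIntegral_mono_on hψθL.integrable_sq
            ((hloc.isTest.1.1.mono_measure (restrict_hull_le heM)).integrable_sq)
            (measurableSet_hull e) fun x hx => ?_
          exact sq_le_sq.2 (hψθb x hx)
      _ ≤ ∫ x in M.Ω, ψ x ^ 2 := by
          rw [restrict_hull]
          exact setIntegral_mono_set hloc.isTest.1.1.integrable_sq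
            (Eventually.of_forall fun x => sq_nonneg _) (interior_hull_subset heM).eventuallyLE
  -- the lower bound
  have hsub2 : Metric.closedBall m (r / 2) ⊆ Metric.closedBall m r :=
    Metric.closedBall_subset_closedBall (by linarith)
  have hnonneg : ∀ x ∈ hull e, 0 ≤ (c - A x) * (ψ x * θ x) := by
    intro x hx
    have hθ0 : 0 ≤ θ x := contactWeight_nonneg heM hx
    have hB0 : 0 ≤ B x := bump_nonneg x
    by_cases h : ψ x = 0
    · rw [h]; simp
    · have h1 := hQ.trans (hσA x (hψB x h))
      have : (c - A x) * (ψ x * θ x) = (σ * (c - A x)) * (B x * θ x) := by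
        rw [hψdef]; ring
      rw [this]; positivity
  have hlow : 1 / (4 * ((n : ℝ) + 2)) * (1 / 2) ^ (n + 1) * Q * V ≤
      ∫ x in hull e, (c - A x) * (ψ x * θ x) := by
    have hvol : (volume (Metric.closedBall m (r / 2))).toReal = (1 / 2) ^ (n + 1) * V := by
      rw [volume_closedBall_eq m (by positivity), ENNReal.toReal_ofReal (by positivity), hVdef]
      rw [← mul_assoc, ← mul_pow]; congr 2; ring
    calc 1 / (4 * ((n : ℝ) + 2)) * (1 / 2) ^ (n + 1) * Q * V
        -- On the ball of half the radius the cone is at least 1/2 and the contact weight at least 1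
        -- / (2 (n + 2)); the power of 1/2 is the ratio of the volumes.
        = ∫ x in Metric.closedBall m (r / 2), (Q * (1 / 2 * (1 / (2 * ((n : ℝ) + 2))))) := by
          rw [setIntegral_const, Measure.real, hvol, smul_eq_mul]
          field_simp
          ring
      _ ≤ ∫ x in Metric.closedBall m (r / 2), (c - A x) * (ψ x * θ x) := by
          refine setIntegral_mono_on (integrableOn_const (isCompact_closedBall _ _).measure_lt_top.ne)
            (i1.mono_measure (Measure.restrict_mono (hsub2.trans hBe) le_rfl))
            Metric.isClosed_closedBall.measurableSet fun x hx => ?_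
          have : (c - A x) * (ψ x * θ x) = (σ * (c - A x)) * (B x * θ x) := by
            rw [hψdef]; ring
          rw [this]
          have hxe := hBe (hsub2 hx)
          have h1 := hσA x (hsub2 hx)
          have h2 : 1 / 2 ≤ B x := half_le_bump hr (mem_closedBall_iff_norm.1 hx) (by simp [signedDist])
          have h3 : 1 / (2 * ((n : ℝ) + 2)) ≤ θ x :=
            ((hcoord x (hsub2 hx)).1 p hpe).trans (coord_le_contactWeight heM hxe hpe hfc)
          exact mul_le_mul h1 (mul_le_mul h2 h3 hn2.le (by linarith)) (by positivity) (hQ.trans h1)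
      _ ≤ _ := setIntegral_mono_set i1
          ((ae_restrict_iff' (measurableSet_hull e)).2 (Eventually.of_forall hnonneg))
          (hsub2.trans hBe).eventuallyLE
  have hErr : 0 ≤ (M.localError ε f π gm φm φ p).toReal := ENNReal.toReal_nonneg
  have hfinal : 1 / (4 * ((n : ℝ) + 2)) * (1 / 2) ^ (n + 1) * Q * V ≤
      ((M.localError ε f π gm φm φ p).toReal * Real.sqrt (ε ^ 2 * r⁻¹ ^ 2 + 1) +
        Real.sqrt (∫ x in hull e, (c - f x) ^ 2)) * Real.sqrt V := by
    have h1 := mul_le_mul_of_nonneg_left hEN.2 hErr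
    rw [Real.sqrt_mul (by positivity)] at h1
    rw [hI, hsplit] at htest
    linarith
  have hsV : 0 < Real.sqrt V := Real.sqrt_pos.2 hV
  refine le_of_mul_le_mul_right ?_ hsV
  rw [mul_assoc, Real.mul_self_sqrt hV.le]
  exact hfinal

/-- A triangle inequality with the factor 2, directly for square roots of integrals as they occur in
the estimator. -/
theorem sqrt_integral_add_sq_le {α : Type*} [MeasurableSpace α] {μ : Measure α} {u v : α → ℝ}
    (hu : MemLp u 2 μ) (hv : MemLp v 2 μ) :
    Real.sqrt (∫ x, (u x + v x) ^ 2 ∂μ) ≤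
      2 * (Real.sqrt (∫ x, u x ^ 2 ∂μ) + Real.sqrt (∫ x, v x ^ 2 ∂μ)) := by
  have hX : 0 ≤ ∫ x, u x ^ 2 ∂μ := integral_nonneg fun x => sq_nonneg _
  have hY : 0 ≤ ∫ x, v x ^ 2 ∂μ := integral_nonneg fun x => sq_nonneg _
  have h1 : ∫ x, (u x + v x) ^ 2 ∂μ ≤ 2 * (∫ x, u x ^ 2 ∂μ) + 2 * ∫ x, v x ^ 2 ∂μ := by
    rw [← integral_const_mul, ← integral_const_mul,
      ← integral_add (hu.integrable_sq.const_mul 2) (hv.integrable_sq.const_mul 2)]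
    refine integral_mono (hu.add hv).integrable_sq
      ((hu.integrable_sq.const_mul 2).add (hv.integrable_sq.const_mul 2)) fun x => ?_
    simp only
    nlinarith [sq_nonneg (u x - v x)]
  rw [Real.sqrt_le_left (by positivity)]
  nlinarith [Real.sq_sqrt hX, Real.sq_sqrt hY, Real.sqrt_nonneg (∫ x, u x ^ 2 ∂μ),
    Real.sqrt_nonneg (∫ x, v x ^ 2 ∂μ),
    mul_nonneg (Real.sqrt_nonneg (∫ x, u x ^ 2 ∂μ)) (Real.sqrt_nonneg (∫ x, v x ^ 2 ∂μ))]

/-- Robustness for elements: the weight is at most h_p / ε, which absorbs the gradient part ε / r of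
the test function, and at most 1, which absorbs the remaining part. -/
theorem mul_sqrt_weight_le {T r : ℝ} (hε : 0 < ε) (hr : 0 < r)
    (hrT : M.hp p = T * r) :
    M.weight ε p * Real.sqrt (ε ^ 2 * r⁻¹ ^ 2 + 1) ≤ T + 1 := by
  have hα := weight_nonneg (M := M) hε p
  have h1 : Real.sqrt (ε ^ 2 * r⁻¹ ^ 2 + 1) ≤ ε * r⁻¹ + 1 := by
    rw [Real.sqrt_le_left (by positivity)]
    have : 0 ≤ ε * r⁻¹ := by positivity
    nlinarith
  have h2 : M.weight ε p * (ε * r⁻¹) ≤ T := by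
    rw [← mul_assoc, mul_inv_le_iff₀ hr, ← hrT]
    exact weight_mul_le hε p
  calc M.weight ε p * Real.sqrt (ε ^ 2 * r⁻¹ ^ 2 + 1)
      ≤ M.weight ε p * (ε * r⁻¹ + 1) := mul_le_mul_of_nonneg_left h1 hα
    _ ≤ T + 1 := by
      rw [mul_add, mul_one]
      exact add_le_add h2 (weight_le_one p)

theorem weight_mul_sqrt_le_oscForce (hε : 0 < ε) (he : e ∈ M.star p) (f : Pt (n + 1) → ℝ) :
    M.weight ε p * Real.sqrt (∫ x in hull e, ((⨍ y in hull e, f y) - f x) ^ 2) ≤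
      M.oscForce ε f p := by
  rw [Mesh.oscForce]
  refine mul_le_mul_of_nonneg_left (Real.sqrt_le_sqrt ?_) (weight_nonneg hε p)
  exact Finset.single_le_sum
    (f := fun e => ∫ x in hull e, ((⨍ y in hull e, f y) - f x) ^ 2)
    (fun e _ => integral_nonneg fun x => sq_nonneg _) he

/-- The element residual is bounded by the local error and the oscillation. -/
theorem exists_element_bound (hn : 1 ≤ n) {K : ℝ} (hK : 1 ≤ K) (N : ℕ) : ∃ C : ℝ, 0 ≤ C ∧
    ∀ (M : Mesh (n + 1)) (p : Pt (n + 1)), M.PatchRegular p K N → ∀ ε : ℝ, 0 < ε →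
    ∀ (f π gm φm : Pt (n + 1) → ℝ) (φ : Jet (n + 1)), MemLp f 2 (volume.restrict M.Ω) →
      M.IsPA φm → M.IsH1 φ → M.dualNorm ε (M.patch p)
        (fun ψ => M.residual ε f π φ ψ - M.quasiForce ε f π gm φm ψ) ≠ ∞ →
      ¬ M.IsFullContact ε f π gm φm p → ∀ e ∈ M.star p,
      M.weight ε p * Real.sqrt (∫ x in hull e, (f x - φm x) ^ 2) ≤
        C * ((M.localError ε f π gm φm φ p).toReal + M.oscForce ε f p) := by
  -- T is the ratio of h_p to the radius ρ/4 of the test ball; T^(n+1) then compares the volume of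
  -- the element with V.
  set T : ℝ := 4 * (K * (n + 2)) with hT
  have hT0 : 0 < T := by positivity
  set c2 : ℝ := 1 / (4 * ((n : ℝ) + 2)) * (1 / 2) ^ (n + 1) with hc2
  have hc20 : 0 < c2 := by positivity
  set c3 : ℝ := Real.sqrt (T ^ (n + 1)) * (T / c2) with hc3
  have hc30 : 0 ≤ c3 := by positivity
  refine ⟨2 + 2 * c3 * (T + 1) + 2 * c3, by positivity, ?_⟩
  intro M p hreg ε hε f π gm φm φ hf hφm hφ hD hfc e he
  have heM := star_subset he
  have hsx := isSimplex heM
  obtain ⟨A, hA⟩ := hφm e heM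
  have hH := hreg.hp_pos
  set H := M.hp p
  set c := ⨍ y in hull e, f y with hc
  set ρ := H / (K * (n + 2)) with hρ
  have hρ0 : 0 < ρ := by positivity
  have hρH : ρ ≤ H := by
    refine div_le_self hH.le ?_
    have : (0 : ℝ) ≤ n := by positivity
    nlinarith
  set Aq : Pt (n + 1) →ᵃ[ℝ] ℝ := AffineMap.const ℝ _ c - A with hAq
  have hAqx : ∀ x, Aq x = c - A x := fun x => by simp [hAq]
  obtain ⟨σ, hσ, m, hball, hlow, hup⟩ := exists_ball_affine Aq (barycentre e) hρ0 hρH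
  set Q₀ := |Aq (barycentre e)| + ‖affGrad Aq‖ * H with hQ₀
  have hQ₀0 : 0 ≤ Q₀ := by positivity
  have hr : 0 < ρ / 4 := by positivity
  have hHr : H = T * (ρ / 4) := by rw [hρ, hT]; field_simp
  have hρT : ρ / (4 * H) = 1 / T := by rw [hρ, hT]; field_simp
  have htest := element_test hn hreg hK hf hφm hφ hD hfc he hA c hσ hr
    (Q := ρ / (4 * H) * Q₀) (by positivity) hball (fun x hx => by rw [← hAqx]; exact hlow x hx)
  set Err := (M.localError ε f π gm φm φ p).toReal
  have hErr : 0 ≤ Err := ENNReal.toReal_nonneg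
  set osc := Real.sqrt (∫ x in hull e, (c - f x) ^ 2) with hosc
  have hω := unitBallVolume_pos (n + 1)
  set V := (ρ / 4) ^ (n + 1) * unitBallVolume (n + 1) with hV
  set S := Real.sqrt (ε ^ 2 * (ρ / 4)⁻¹ ^ 2 + 1) with hS
  rw [← hc2, hρT] at htest
  have hQV : Q₀ * Real.sqrt V ≤ T / c2 * (Err * S + osc) := by
    have e1 : c2 * (1 / T * Q₀) * Real.sqrt V = (Q₀ * Real.sqrt V) * (c2 / T) := by ring
    rw [e1, ← le_div_iff₀ (by positivity)] at htest
    refine htest.trans (le_of_eq ?_)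
    field_simp
  -- the norm of the affine part
  have hfin : IsFiniteMeasure (volume.restrict (hull e)) :=
    ⟨by simpa using (isCompact_hull e).measure_lt_top⟩
  have hdist : ∀ x ∈ hull e, ‖x - barycentre e‖ ≤ H := fun x hx =>
    (dist_le_diam_hull hx (barycentre_mem_hull hsx.nonempty)).trans (hreg.diam_le e he)
  have hvolH : (volume (hull e)).toReal ≤ H ^ (n + 1) * unitBallVolume (n + 1) := by
    refine ENNReal.toReal_le_of_le_ofReal (by positivity) ?_
    rw [← volume_closedBall_eq (barycentre e) hH.le]
    exact measure_mono fun x hx => mem_closedBall_iff_norm.2 (hdist x hx)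
  have hAqm : MemLp (fun x => Aq x) 2 (volume.restrict (hull e)) := by
    refine MemLp.of_bound (continuous_affine Aq).aestronglyMeasurable Q₀ ?_
    filter_upwards [ae_restrict_mem (measurableSet_hull e)] with x hx using hup x (hdist x hx)
  have hAqL : Real.sqrt (∫ x in hull e, Aq x ^ 2) ≤
      Q₀ * (Real.sqrt (T ^ (n + 1)) * Real.sqrt V) := by
    have h1 : ∫ x in hull e, Aq x ^ 2 ≤ Q₀ ^ 2 * (T ^ (n + 1) * V) := by
      calc ∫ x in hull e, Aq x ^ 2 ≤ ∫ x in hull e, Q₀ ^ 2 := by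
            refine setIntegral_mono_on hAqm.integrable_sq (integrable_const _)
              (measurableSet_hull e) fun x hx => ?_
            rw [← sq_abs]
            exact pow_le_pow_left₀ (abs_nonneg _) (hup x (hdist x hx)) 2
        _ = Q₀ ^ 2 * (volume (hull e)).toReal := by
            rw [setIntegral_const, smul_eq_mul, mul_comm]; rfl
        _ ≤ Q₀ ^ 2 * (T ^ (n + 1) * V) := by
            refine mul_le_mul_of_nonneg_left (hvolH.trans (le_of_eq ?_)) (sq_nonneg _)
            rw [hV, ← mul_assoc, ← mul_pow, ← hHr]
    refine (Real.sqrt_le_sqrt h1).trans (le_of_eq ?_)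
    rw [Real.sqrt_mul (sq_nonneg _), Real.sqrt_sq hQ₀0, Real.sqrt_mul (by positivity)]
  have hcf : MemLp (fun x => f x - c) 2 (volume.restrict (hull e)) :=
    (hf.mono_measure (restrict_hull_le heM)).sub (memLp_const c)
  have htri := sqrt_integral_add_sq_le hcf hAqm
  have e1 : ∫ x in hull e, (f x - c + Aq x) ^ 2 = ∫ x in hull e, (f x - φm x) ^ 2 := by
    refine setIntegral_congr_fun (measurableSet_hull e) fun x hx => ?_
    rw [hAqx, hA hx]; ring
  have e2 : ∫ x in hull e, (f x - c) ^ 2 = ∫ x in hull e, (c - f x) ^ 2 := by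
    congr 1; ext x; ring
  rw [e1, e2, ← hosc] at htri
  have hα := weight_nonneg (M := M) hε p
  set α := M.weight ε p
  have hαS : α * S ≤ T + 1 := mul_sqrt_weight_le hε hr hHr
  have hαosc : α * osc ≤ M.oscForce ε f p := weight_mul_sqrt_le_oscForce hε he f
  have h5 : Real.sqrt (∫ x in hull e, Aq x ^ 2) ≤ c3 * (Err * S + osc) := by
    calc _ ≤ Q₀ * (Real.sqrt (T ^ (n + 1)) * Real.sqrt V) := hAqL
      _ = Real.sqrt (T ^ (n + 1)) * (Q₀ * Real.sqrt V) := by ring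
      _ ≤ Real.sqrt (T ^ (n + 1)) * (T / c2 * (Err * S + osc)) := by gcongr
      _ = _ := by rw [hc3]; ring
  set O := M.oscForce ε f p
  have hosc0 : 0 ≤ osc := Real.sqrt_nonneg _
  have hO : 0 ≤ O := le_trans (mul_nonneg hα hosc0) hαosc
  calc α * Real.sqrt (∫ x in hull e, (f x - φm x) ^ 2)
      ≤ α * (2 * (osc + c3 * (Err * S + osc))) := by
        refine mul_le_mul_of_nonneg_left (htri.trans ?_) hα
        linarith
    _ = 2 * (α * osc) + 2 * c3 * (Err * (α * S)) + 2 * c3 * (α * osc) := by ring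
    _ ≤ 2 * O + 2 * c3 * (Err * (T + 1)) + 2 * c3 * O := by gcongr
    _ ≤ (2 + 2 * c3 * (T + 1) + 2 * c3) * (Err + O) := by
        have h6 : 0 ≤ 2 * c3 * (T + 1) * O := by positivity
        have h7 : 0 ≤ (2 + 2 * c3) * Err := by positivity
        linarith

end ElementBound

end Mesh

/-! ### Gradients of squeezed bump functions -/

section BumpGradient

variable {d : ℕ} {m ν : Pt d} {ρ a b : ℝ}

theorem norm_gradient_const_mul {σ : ℝ} (hσ : |σ| = 1) (B : Pt d → ℝ) (x : Pt d) :
    ‖gradient (fun y => σ * B y) x‖ = ‖gradient B x‖ := by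
  have h : fderiv ℝ (fun y => σ * B y) x = σ • fderiv ℝ B x := by
    have := congrFun (fderiv_const_smul_field (𝕜 := ℝ) (f := B) σ) x
    simpa [Pi.smul_def, smul_eq_mul] using this
  rw [gradient, gradient, LinearIsometryEquiv.norm_map, LinearIsometryEquiv.norm_map, h, norm_smul,
    Real.norm_eq_abs, hσ, one_mul]

/-- A zero of a nonnegative function is a minimum, so its derivative vanishes there, with the usual
default if it does not exist. -/
theorem gradient_bump_eq_zero {x : Pt d} (hx : bump m ν ρ a b x = 0) :
    gradient (bump m ν ρ a b) x = 0 := by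
  have : IsLocalMin (bump m ν ρ a b) x :=
    Eventually.of_forall fun y => by rw [hx]; exact bump_nonneg y
  rw [gradient, this.fderiv_eq_zero, map_zero]

/-- Behind the plane the bump does not depend on the slope a. This allows a to be chosen as steep as
the geometry of the mesh requires. -/
theorem norm_gradient_bump_le_of_nonpos (hν : ‖ν‖ ≤ 1) (hρ : 0 ≤ ρ) (hb : 0 ≤ b) {x : Pt d}
    (hx : ∀ᶠ y in 𝓝 x, signedDist m ν y ≤ 0) : ‖gradient (bump m ν ρ a b) x‖ ≤ ρ⁻¹ + b := by
  have h : bump m ν ρ a b =ᶠ[𝓝 x] bump m ν ρ 0 b := by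
    filter_upwards [hx] with y hy
    rw [bump, bump, max_eq_right hy]; simp
  rw [gradient_congr h]
  have := norm_gradient_le (lipschitz_bump (m := m) hν hρ le_rfl hb) x
  rwa [Real.coe_toNNReal _ (by positivity), add_zero] at this

theorem norm_gradient_bump_le_of_nonneg (hν : ‖ν‖ ≤ 1) (hρ : 0 ≤ ρ) (ha : 0 ≤ a) {x : Pt d}
    (hx : ∀ᶠ y in 𝓝 x, 0 ≤ signedDist m ν y) : ‖gradient (bump m ν ρ a b) x‖ ≤ ρ⁻¹ + a := by
  have h : bump m ν ρ a b =ᶠ[𝓝 x] bump m ν ρ a 0 := by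
    filter_upwards [hx] with y hy
    rw [bump, bump, max_eq_right (neg_nonpos.2 hy)]; simp
  rw [gradient_congr h]
  have := norm_gradient_le (lipschitz_bump (m := m) hν hρ ha le_rfl) x
  rwa [Real.coe_toNNReal _ (by positivity), add_zero] at this

theorem signedDist_neg (m ν x : Pt d) : signedDist m (-ν) x = -signedDist m ν x := by
  rw [signedDist, signedDist, inner_neg_left]

end BumpGradient

namespace Mesh

variable {n : ℕ} {M : Mesh (n + 1)} {e e' s : Finset (Pt (n + 1))} {p x : Pt (n + 1)}
  {ψ : Pt (n + 1) → ℝ} {L : ℝ≥0} {ε K a b : ℝ} {N : ℕ}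

/-! ### Bump functions around the barycentre of a side -/

theorem elementsAt_subset_star (hp : p ∈ s) : M.elementsAt s ⊆ M.star p := fun _ he =>
  mem_star.2 ⟨(mem_elementsAt.1 he).1, (mem_elementsAt.1 he).2 hp⟩

/-- At the barycentre of s its vertices have coordinate 1 / (n + 1) and the opposite vertex has 0;
within the given radius they change by at most a quarter of 1 / (n + 1). The largest possible value
is 5/8, since n ≥ 1. -/
theorem PatchRegular.coord_near_side (hreg : M.PatchRegular p K N) (hn : 1 ≤ n) (hK : 1 ≤ K)
    (hs : s.card = n + 1) (hp : p ∈ s) (he : e ∈ M.elementsAt s) {x : Pt (n + 1)}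
    (hx : ‖x - barycentre s‖ ≤ M.hp p / (2 * K * (n + 1))) :
    (∀ q ∈ s, 3 / (4 * ((n : ℝ) + 1)) ≤ coord e q x) ∧ ∀ q, coord e q x < 3 / 4 := by
  have hH := hreg.hp_pos
  obtain ⟨heM, hse⟩ := mem_elementsAt.1 he
  have hsx := isSimplex heM
  have h1 : ∀ q, |coord e q x - coord e q (barycentre s)| ≤ 1 / (4 * ((n : ℝ) + 1)) := by
    intro q
    refine (hreg.abs_coord_sub_le hK (elementsAt_subset_star hp he) q x (barycentre s)).trans ?_
    calc K / (2 * M.hp p) * ‖x - barycentre s‖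
        ≤ K / (2 * M.hp p) * (M.hp p / (2 * K * (n + 1))) := by gcongr
      _ = 1 / (4 * ((n : ℝ) + 1)) := by field_simp; norm_num
  have h2 : ∀ q ∈ s, coord e q (barycentre s) = 4 * (1 / (4 * ((n : ℝ) + 1))) := fun q hq => by
    rw [hsx.coord_barycentre hse (nonempty_of_card hs) hq, hs]
    push_cast
    field_simp
  have h3 : 3 / (4 * ((n : ℝ) + 1)) = 3 * (1 / (4 * ((n : ℝ) + 1))) := by ring
  have hn' : (1 : ℝ) ≤ n := by exact_mod_cast hn
  have h4 : 1 / (4 * ((n : ℝ) + 1)) ≤ 1 / 8 := by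
    apply one_div_le_one_div_of_le <;> linarith
  refine ⟨fun q hq => ?_, fun q => ?_⟩
  · have := (abs_le.1 (h1 q)).1
    rw [h2 q hq] at this
    rw [h3]; linarith
  · have := (abs_le.1 (h1 q)).2
    by_cases hq : q ∈ s
    · rw [h2 q hq] at this; linarith
    · rw [hsx.coord_eq_zero_of_mem_face hse (barycentre_mem_hull (nonempty_of_card hs)) hq] at this
      linarith

section SideBump

variable (hreg : M.PatchRegular p K N) (hn : 1 ≤ n) (hK : 1 ≤ K) (hs : s.card = n + 1) (hp : p ∈ s)
include hreg hn hK hs hp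

theorem coord_pos_near_side (he : e ∈ M.elementsAt s)
    (hx : ‖x - barycentre s‖ ≤ M.hp p / (2 * K * (n + 1))) {q : Pt (n + 1)} (hq : q ∈ s) :
    0 < coord e q x :=
  lt_of_lt_of_le (by positivity) ((hreg.coord_near_side hn hK hs hp he hx).1 q hq)

theorem mem_hull_near_side (he : e ∈ M.elementsAt s)
    (hx : ‖x - barycentre s‖ ≤ M.hp p / (2 * K * (n + 1)))
    (h : signedDist (barycentre s) (outerNormal e s) x ≤ 0) : x ∈ hull e :=
  (mem_hull_iff_signedDist (isSimplex (mem_elementsAt.1 he).1) (mem_elementsAt.1 he).2 hs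
    fun _ hq => (coord_pos_near_side hreg hn hK hs hp he hx hq).le).2 h

theorem mem_side_near_side (he : e ∈ M.elementsAt s)
    (hx : ‖x - barycentre s‖ ≤ M.hp p / (2 * K * (n + 1)))
    (h : signedDist (barycentre s) (outerNormal e s) x = 0) : x ∈ hull s :=
  (mem_hull_side_iff (isSimplex (mem_elementsAt.1 he).1) (mem_elementsAt.1 he).2 hs
    fun _ hq => (coord_pos_near_side hreg hn hK hs hp he hx hq).le).2 h

omit hreg hn hK hp in
theorem signedDist_nonpos_of_mem_hull (he : e ∈ M.elementsAt s) (hx : x ∈ hull e) :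
    signedDist (barycentre s) (outerNormal e s) x ≤ 0 :=
  (mem_hull_iff_signedDist (isSimplex (mem_elementsAt.1 he).1) (mem_elementsAt.1 he).2 hs
    fun q _ => (isSimplex (mem_elementsAt.1 he).1).coord_nonneg hx q).1 hx

-- With equal normals, both elements would contain the same half ball at the barycentre of s,
-- contradicting the disjointness of their interiors.
omit hp in
theorem outerNormal_eq_neg (hp : p ∈ s) (he : e ∈ M.elementsAt s) (he' : e' ∈ M.elementsAt s)
    (hne : e ≠ e') : outerNormal e' s = -outerNormal e s := by
  obtain ⟨heM, hse⟩ := mem_elementsAt.1 he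
  obtain ⟨heM', hse'⟩ := mem_elementsAt.1 he'
  refine (outerNormal_eq_or_neg (isSimplex heM) (isSimplex heM') hse hse' hs).resolve_left
    fun h => ?_
  have hH := hreg.hp_pos
  set ν := outerNormal e s with hν
  have hν1 : ‖ν‖ = 1 := norm_outerNormal (isSimplex heM) hse hs
  set r := M.hp p / (2 * K * (n + 1)) with hr
  have hr0 : 0 < r := by positivity
  set U : Set (Pt (n + 1)) :=
    {y | signedDist (barycentre s) ν y < 0} ∩ Metric.ball (barycentre s) r with hU
  have hUo : IsOpen U :=
    (isOpen_lt (continuous_signedDist _ _) continuous_const).inter Metric.isOpen_ball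
  have hUe : ∀ y ∈ U, y ∈ hull e ∧ y ∈ hull e' := fun y hy => by
    have hy1 : ‖y - barycentre s‖ ≤ r := (mem_ball_iff_norm.1 hy.2).le
    have hy2 : signedDist (barycentre s) ν y < 0 := hy.1
    exact ⟨mem_hull_near_side hreg hn hK hs hp he hy1 hy2.le,
      mem_hull_near_side hreg hn hK hs hp he' hy1 (by rw [h]; exact hy2.le)⟩
  have hmem : barycentre s - (r / 2) • ν ∈ U := by
    refine ⟨?_, ?_⟩
    · change signedDist _ _ _ < 0
      rw [sub_eq_add_neg, signedDist_add, signedDist_self, inner_neg_right, inner_smul_right,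
        inner_self_unit hν1]
      linarith
    · rw [mem_ball_iff_norm, sub_sub_cancel_left, norm_neg, norm_smul, hν1, mul_one,
        Real.norm_of_nonneg (by positivity)]
      linarith
  have h1 : U ⊆ interior (hull e) := interior_maximal (fun y hy => (hUe y hy).1) hUo
  have h2 : U ⊆ interior (hull e') := interior_maximal (fun y hy => (hUe y hy).2) hUo
  exact Set.disjoint_left.1 (disjoint_interior heM heM' hne) (h1 hmem) (h2 hmem)

/-- On the outer side of a boundary side, there are no elements close to the barycentre. -/
theorem exists_width_of_boundary (hE : M.elementsAt s = {e}) : ∃ η > 0, ∀ x ∈ M.closedDomain,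
    ‖x - barycentre s‖ ≤ M.hp p / (2 * K * (n + 1)) →
    signedDist (barycentre s) (outerNormal e s) x < η → x ∈ hull e := by
  have he : e ∈ M.elementsAt s := by rw [hE]; exact Finset.mem_singleton_self e
  obtain ⟨heM, hse⟩ := mem_elementsAt.1 he
  set m := barycentre s
  set ν := outerNormal e s
  have hν : ‖ν‖ = 1 := norm_outerNormal (isSimplex heM) hse hs
  set r := M.hp p / (2 * K * (n + 1))
  have hK0 : IsCompact (Metric.closedBall m r ∩ {y | signedDist m ν y ≤ 0}) :=
    (isCompact_closedBall m r).inter_right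
      (isClosed_le (continuous_signedDist m ν) continuous_const)
  have hclosed : IsClosed (⋃ e' ∈ M.elements.filter (· ≠ e), hull e') :=
    (M.elements.filter (· ≠ e)).finite_toSet.isClosed_biUnion fun e' _ => isClosed_hull e'
  -- The compact half ball behind the side misses the closed union of all other elements: an element
  -- meeting it contains all vertices of s and would share the side. Hence a whole neighbourhood of
  -- the half ball misses them.
  obtain ⟨η, hη, hsub⟩ := hK0.exists_thickening_subset_open hclosed.isOpen_compl (by
    intro y hy hy'
    obtain ⟨e', he', hye'⟩ := mem_iUnion₂.1 hy'
    obtain ⟨he'M, hne⟩ := Finset.mem_filter.1 he'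
    have hy1 : ‖y - m‖ ≤ r := mem_closedBall_iff_norm.1 hy.1
    have hye := mem_hull_near_side hreg hn hK hs hp he hy1 hy.2
    have : e' ∈ M.elementsAt s := mem_elementsAt.2 ⟨he'M, fun q hq =>
      mem_of_coord_pos heM he'M hye hye' (coord_pos_near_side hreg hn hK hs hp he hy1 hq)⟩
    rw [hE, Finset.mem_singleton] at this
    exact hne this)
  refine ⟨η, hη, fun x hx hxr hxη => ?_⟩
  rcases le_or_gt (signedDist m ν x) 0 with h0 | h0
  · exact mem_hull_near_side hreg hn hK hs hp he hxr h0
  · have hxt : x ∈ Metric.thickening η (Metric.closedBall m r ∩ {y | signedDist m ν y ≤ 0}) := by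
      -- A point in front of the side is compared with its projection to the plane, which is in the
      -- half ball and at distance less than η.
      refine Metric.mem_thickening_iff.2 ⟨planeProj m ν x, ⟨?_, (signedDist_planeProj hν x).le⟩, ?_⟩
      · exact mem_closedBall_iff_norm.2
          ((norm_planeProj_sub_le hν (barycentre_mem_plane e s) x).trans hxr)
      · rw [dist_eq_norm, norm_planeProj_sub hν, abs_of_pos h0]; exact hxη
    have hxU := hsub hxt
    obtain ⟨e', he', hxe'⟩ := mem_iUnion₂.1 hx
    by_cases hee : e' = e
    · rwa [hee] at hxe'
    · exact absurd (mem_iUnion₂.2 ⟨e', Finset.mem_filter.2 ⟨he', hee⟩, hxe'⟩) hxU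

/-- A bump function around a side that is supported in the elements sharing this side; its gradient
on the domain only depends on its width towards the interior. -/
theorem exists_sideBump (hcard : (M.elementsAt s).card = 1 ∨ (M.elementsAt s).card = 2)
    (he : e ∈ M.elementsAt s) (hb : 0 < b) : ∃ a, b ≤ a ∧
      (∀ x ∈ M.closedDomain,
        bump (barycentre s) (outerNormal e s) (M.hp p / (2 * K * (n + 1))) a b x ≠ 0 →
          ∃ e' ∈ M.elementsAt s, x ∈ hull e') ∧
      ∀ e' ∈ M.elementsAt s, ∀ x ∈ interior (hull e'),
        ‖gradient (bump (barycentre s) (outerNormal e s) (M.hp p / (2 * K * (n + 1))) a b) x‖ ≤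
          (M.hp p / (2 * K * (n + 1)))⁻¹ + b := by
  classical
  obtain ⟨heM, hse⟩ := mem_elementsAt.1 he
  have hH := hreg.hp_pos
  set m := barycentre s
  set ν := outerNormal e s with hνdef
  have hν : ‖ν‖ = 1 := norm_outerNormal (isSimplex heM) hse hs
  set r := M.hp p / (2 * K * (n + 1))
  have hr : 0 < r := by positivity
  have hnear : ∀ e' ∈ M.elementsAt s, ∀ x ∈ interior (hull e'), ∀ᶠ y in 𝓝 x,
      signedDist m (outerNormal e' s) y ≤ 0 := fun e' he' x hx => by
    filter_upwards [isOpen_interior.mem_nhds hx] with y hy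
    exact signedDist_nonpos_of_mem_hull hs he' (interior_subset hy)
  rcases hcard with h1 | h2
  · have hE : M.elementsAt s = {e} := by
      obtain ⟨e', he'⟩ := Finset.card_eq_one.1 h1
      rw [he', Finset.mem_singleton] at he
      rw [he', he]
    obtain ⟨η, hη, hw⟩ := exists_width_of_boundary hreg hn hK hs hp hE
    -- The outward slope η⁻¹ ends the bump before it can reach other elements beyond the boundary
    -- side. The width η depends on the mesh in an uncontrolled way, which is harmless since
    -- gradients inside e see b only.
    refine ⟨max b η⁻¹, le_max_left _ _, fun x hx hψ => ⟨e, he, ?_⟩, fun e' he' x hx => ?_⟩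
    · have h := bump_ne_zero hr (hb.le.trans (le_max_left _ _)) hb.le hψ
      refine hw x hx h.1.le ?_
      rcases le_or_gt (signedDist m ν x) 0 with h0 | h0
      · exact h0.trans_lt hη
      · have h3 : η⁻¹ * signedDist m ν x < 1 :=
          (mul_le_mul_of_nonneg_right (le_max_right _ _) h0.le).trans_lt h.2.1
        rwa [inv_mul_lt_iff₀ hη, mul_one] at h3
    · have := he'
      rw [hE, Finset.mem_singleton] at this
      subst this
      exact norm_gradient_bump_le_of_nonpos hν.le hr.le hb.le (hnear e' he' x hx)
  · have hother : ∀ e' ∈ M.elementsAt s, e' ≠ e → outerNormal e' s = -ν := fun e' he' hne =>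
      outerNormal_eq_neg hreg hn hK hs hp he he' hne.symm
    refine ⟨b, le_rfl, fun x hx hψ => ?_, fun e' he' x hx => ?_⟩
    · have h := bump_ne_zero hr hb.le hb.le hψ
      rcases le_total (signedDist m ν x) 0 with h0 | h0
      · exact ⟨e, he, mem_hull_near_side hreg hn hK hs hp he h.1.le h0⟩
      · obtain ⟨e', he', hne⟩ := Finset.exists_mem_ne (by omega : 1 < (M.elementsAt s).card) e
        refine ⟨e', he', mem_hull_near_side hreg hn hK hs hp he' h.1.le ?_⟩
        rw [hother e' he' hne, signedDist_neg]
        linarith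
    · by_cases hee : e' = e
      · subst hee
        exact norm_gradient_bump_le_of_nonpos hν.le hr.le hb.le (hnear e' he' x hx)
      · refine norm_gradient_bump_le_of_nonneg hν.le hr.le hb.le ?_
        filter_upwards [hnear e' he' x hx] with y hy
        rw [hother e' he' hee, signedDist_neg] at hy
        linarith

omit hs in
/-- Functions supported near the barycentre of a side, in the elements that share it. -/
theorem localTest_of_side (hsM : s ∈ M.sides) (hsD : s ∉ M.dirichletSides)
    (hψ : LipschitzWith L ψ) (hc : HasCompactSupport ψ)
    (hsupp : ∀ x ∈ M.closedDomain, ψ x ≠ 0 → ∃ e ∈ M.elementsAt s, x ∈ hull e)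
    (hnear : ∀ x, ψ x ≠ 0 → ‖x - barycentre s‖ ≤ M.hp p / (2 * K * (n + 1)))
    (hm : ψ (barycentre s) ≠ 0) :
    LocalTest M p (M.elementsAt s) ψ ∧
      ∀ s' ∈ M.sides, s' ≠ s → ∀ x ∈ hull s', ψ x = 0 := by
  obtain ⟨e₀, he₀, hse₀, hs⟩ := mem_sides.1 hsM
  -- All vertices of s carry a point of the support, so a side containing it contains s, and equals
  -- s by cardinality.
  have hside : ∀ s' : Finset (Pt (n + 1)), s'.card = n + 1 → (∃ e' ∈ M.elements, s' ⊆ e') →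
      s' ≠ s → ∀ x ∈ hull s', ψ x = 0 := by
    rintro s' hs' ⟨e', he', hse'⟩ hne x hx
    by_contra h
    have hxe' : x ∈ hull e' := convexHull_mono (by exact_mod_cast hse') hx
    obtain ⟨e, he, hxe⟩ := hsupp x (hull_subset_closedDomain he' hxe') h
    have hsub := subset_of_coord_pos (mem_elementsAt.1 he).1 he' hxe
      (fun q hq => coord_pos_near_side hreg hn hK hs hp he (hnear x h) hq) hse' hx
    exact hne (Finset.eq_of_subset_of_card_le hsub (by rw [hs, hs'])).symm
  refine ⟨⟨⟨L, hψ⟩, hc, ?_, elementsAt_subset_star hp, hsupp, ?_, ?_⟩, ?_⟩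
  · intro x hx
    obtain ⟨s', hs', hxs'⟩ := mem_iUnion₂.1 hx
    obtain ⟨e', he', -⟩ := M.dirichletSides_boundary s' hs'
    exact hside s' (M.dirichletSides_card s' hs') ⟨e', he'⟩ (fun h => hsD (h ▸ hs')) x hxs'
  · refine eq_zero_of_refinedPatch (E := M.elementsAt s)
      (fun e he => (mem_elementsAt.1 he).1) hsupp fun e he x _ hx q => ?_
    exact (hreg.coord_near_side hn hK hs hp he (hnear x hx)).2 q
  · exact ⟨e₀, mem_elementsAt.2 ⟨he₀, hse₀⟩, _,
      convexHull_mono (by exact_mod_cast hse₀) (barycentre_mem_hull (nonempty_of_card hs)), hm⟩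
  · intro s' hs' hne
    obtain ⟨e', he', hse', hs'c⟩ := mem_sides.1 hs'
    exact hside s' hs'c ⟨e', he', hse'⟩ hne

end SideBump

end Mesh

namespace Mesh

variable {n : ℕ} {M : Mesh (n + 1)} {s : Finset (Pt (n + 1))} {p : Pt (n + 1)}
  {ψ : Pt (n + 1) → ℝ} {L : ℝ≥0} {ε K : ℝ} {N : ℕ}
  {f π ϖ gm φm : Pt (n + 1) → ℝ} {φ : Jet (n + 1)}

/-! ### The side residuals -/

/-- The Neumann data of a side: `π` on Neumann sides and zero on interior sides. -/
def IsSideDatum (M : Mesh (n + 1)) (π : Pt (n + 1) → ℝ) (s : Finset (Pt (n + 1)))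
    (ϖ : Pt (n + 1) → ℝ) : Prop :=
  (s ∈ M.neumannSides ∧ ϖ = π) ∨ (s ∈ M.interiorSides ∧ ϖ = fun _ => 0)

theorem mem_neumannSides : s ∈ M.neumannSides ↔
    s ∈ M.sides ∧ (M.elementsAt s).card = 1 ∧ s ∉ M.dirichletSides := by
  simp [Mesh.neumannSides, Mesh.boundarySides, and_assoc]

theorem mem_interiorSides : s ∈ M.interiorSides ↔ s ∈ M.sides ∧ (M.elementsAt s).card = 2 := by
  simp [Mesh.interiorSides]

theorem hull_subset_ΓN (hs : s ∈ M.neumannSides) : hull s ⊆ M.ΓN := fun _ hx =>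
  mem_iUnion₂.2 ⟨s, hs, hx⟩

theorem measurableSet_ΓN : MeasurableSet M.ΓN :=
  M.neumannSides.measurableSet_biUnion fun s _ => measurableSet_hull s

namespace IsSideDatum

variable (h : M.IsSideDatum π s ϖ)
include h

theorem mem_sides : s ∈ M.sides := by
  rcases h with ⟨h, -⟩ | ⟨h, -⟩
  · exact (mem_neumannSides.1 h).1
  · exact (mem_interiorSides.1 h).1

theorem card : (M.elementsAt s).card = 1 ∨ (M.elementsAt s).card = 2 := by
  rcases h with ⟨h, -⟩ | ⟨h, -⟩
  · exact .inl (mem_neumannSides.1 h).2.1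
  · exact .inr (mem_interiorSides.1 h).2

theorem notMem_dirichletSides : s ∉ M.dirichletSides := by
  rcases h with ⟨h, -⟩ | ⟨h, -⟩
  · exact (mem_neumannSides.1 h).2.2
  -- A Dirichlet side belongs to exactly one element, an interior side to two.
  · intro hD
    obtain ⟨e, he, hu⟩ := M.dirichletSides_boundary s hD
    obtain ⟨a, ha, b, hb, hab⟩ := Finset.one_lt_card.1
      (by rw [(mem_interiorSides.1 h).2]; norm_num : 1 < (M.elementsAt s).card)
    exact hab ((hu a (mem_elementsAt.1 ha)).trans (hu b (mem_elementsAt.1 hb)).symm)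

theorem memLp (hπ : MemLp π 2 ((surf (n + 1)).restrict M.ΓN)) :
    MemLp ϖ 2 ((surf (n + 1)).restrict (hull s)) := by
  rcases h with ⟨h, rfl⟩ | ⟨-, rfl⟩
  · exact hπ.mono_measure (Measure.restrict_mono (hull_subset_ΓN h) le_rfl)
  · exact MemLp.zero'

/-- With the datum extended by zero to interior sides, the boundary integral has the same form for
both kinds of sides: the test function sees no side other than s. -/
theorem integral_ΓN (hother : ∀ s' ∈ M.sides, s' ≠ s → ∀ x ∈ hull s', ψ x = 0)
    (w : Pt (n + 1) → ℝ) :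
    ∫ x in M.ΓN, π x * (ψ x * w x) ∂surf (n + 1) =
      ∫ x in hull s, ϖ x * (ψ x * w x) ∂surf (n + 1) := by
  rcases h with ⟨h, rfl⟩ | ⟨h, rfl⟩
  · refine setIntegral_eq_of_subset_of_forall_sdiff_eq_zero measurableSet_ΓN (hull_subset_ΓN h)
      fun x hx => ?_
    obtain ⟨s', hs', hxs'⟩ := mem_iUnion₂.1 hx.1
    rw [hother s' (mem_neumannSides.1 hs').1 (fun h => hx.2 (h ▸ hxs')) x hxs']
    ring
  · simp only [zero_mul, integral_zero]
    refine setIntegral_eq_zero_of_forall_eq_zero fun x hx => ?_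
    obtain ⟨s', hs', hxs'⟩ := mem_iUnion₂.1 hx
    rw [hother s' (mem_neumannSides.1 hs').1 (fun h' => ?_) x hxs']
    · ring
    · have h1 := (mem_neumannSides.1 hs').2.1
      rw [h', (mem_interiorSides.1 h).2] at h1
      omega

end IsSideDatum

/-- On a side, the test function of width `δ`. -/
theorem exists_side_test_function (hn : 1 ≤ n) (hreg : M.PatchRegular p K N) (hK : 1 ≤ K)
    (hp : p ∈ s) (hϖ : M.IsSideDatum π s ϖ) {σ δ : ℝ} (hσ : |σ| = 1) (hδ : 0 < δ)
    (hδr : δ ≤ M.hp p / (2 * K * (n + 1))) :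
    ∃ (ψ : Pt (n + 1) → ℝ) (L : ℝ≥0), LipschitzWith L ψ ∧ LocalTest M p (M.elementsAt s) ψ ∧
      (∀ s' ∈ M.sides, s' ≠ s → ∀ x ∈ hull s', ψ x = 0) ∧
      (∀ x, ψ x ≠ 0 → ‖x - barycentre s‖ ≤ M.hp p / (2 * K * (n + 1))) ∧
      (∀ x, |ψ x| ≤ 1) ∧ (∀ x, 0 ≤ σ * ψ x) ∧
      (∀ x ∈ hull s, ‖x - barycentre s‖ ≤ M.hp p / (4 * K * (n + 1)) → 1 / 2 ≤ σ * ψ x) ∧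
      (∫ x in M.Ω, ψ x ^ 2) ≤ 2 * δ * (M.hp p ^ n * unitBallVolume n) ∧
      energyNorm ε M.Ω (.ofFun ψ) ≤
        Real.sqrt ((ε ^ 2 * (2 / δ) ^ 2 + 1) * (2 * δ * (M.hp p ^ n * unitBallVolume n))) := by
  obtain ⟨e, heM, hse, hs⟩ := Mesh.mem_sides.1 hϖ.mem_sides
  have he : e ∈ M.elementsAt s := mem_elementsAt.2 ⟨heM, hse⟩
  have hH := hreg.hp_pos
  have hω := unitBallVolume_pos n
  have hb : 0 < 1 / δ := by positivity
  -- The inner slope 1 / δ makes the bump as thin as δ; because a is at least as large, the width on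
  -- the other side is no larger.
  obtain ⟨a, hab, hsupp, hgrad⟩ := exists_sideBump hreg hn hK hs hp hϖ.card he hb
  have ha : 0 < a := hb.trans_le hab
  set m := barycentre s
  set ν := outerNormal e s
  have hν : ‖ν‖ = 1 := norm_outerNormal (isSimplex heM) hse hs
  set r := M.hp p / (2 * K * (n + 1)) with hrdef
  have hr : 0 < r := by positivity
  set B := bump m ν r a (1 / δ) with hB
  have hσ0 : σ ≠ 0 := fun h => by rw [h] at hσ; simp at hσ
  have hσ2 : σ * σ = 1 := by rw [← abs_mul_abs_self, hσ, one_mul]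
  have hBL : LipschitzWith _ B := lipschitz_bump hν.le hr.le ha.le hb.le
  have hψL : LipschitzWith (r⁻¹ + a + 1 / δ).toNNReal fun x => σ * B x := by
    refine LipschitzWith.of_dist_le_mul fun x y => ?_
    rw [Real.dist_eq, ← mul_sub, abs_mul, hσ, one_mul, ← Real.dist_eq]
    exact hBL.dist_le_mul x y
  have hBne : ∀ x, σ * B x ≠ 0 → B x ≠ 0 := fun x => right_ne_zero_of_mul
  have hψB : ∀ x, σ * (σ * B x) = B x := fun x => by rw [← mul_assoc, hσ2, one_mul]
  have hψ1 : ∀ x, |σ * B x| ≤ 1 := fun x => by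
    rw [abs_mul, hσ, one_mul, abs_of_nonneg (bump_nonneg x)]
    exact bump_le_one hr.le ha.le hb.le x
  have hnear : ∀ x, σ * B x ≠ 0 → ‖x - m‖ ≤ r := fun x hx =>
    (bump_ne_zero hr ha.le hb.le (hBne x hx)).1.le
  have hsupp' : ∀ x ∈ M.closedDomain, σ * B x ≠ 0 → ∃ e' ∈ M.elementsAt s, x ∈ hull e' :=
    fun x hx h => hsupp x hx (hBne x h)
  obtain ⟨hloc, hother⟩ := localTest_of_side hreg hn hK hp hϖ.mem_sides hϖ.notMem_dirichletSides
    hψL (hasCompactSupport_bump hr ha.le hb.le).mul_left hsupp' hnear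
    (mul_ne_zero hσ0 (by rw [hB, bump_center]; exact one_ne_zero))
  have hV : 2 * δ * (r ^ n * unitBallVolume n) ≤ 2 * δ * (M.hp p ^ n * unitBallVolume n) := by
    gcongr
    refine div_le_self hH.le ?_
    have hn' : (1 : ℝ) ≤ n := by exact_mod_cast hn
    nlinarith
  have hEN := energyNorm_le (M := M) (ε := ε) hψL hψ1
    (S := signedDist m ν ⁻¹' Ioo (-δ) δ ∩ Metric.closedBall m r)
    (((continuous_signedDist m ν).measurable measurableSet_Ioo).inter
      Metric.isClosed_closedBall.measurableSet) (V := 2 * δ * (r ^ n * unitBallVolume n))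
    (Λ := 2 / δ) (by positivity) (by
      refine (volume_slab_inter_closedBall_le hν (-δ) δ (barycentre_mem_plane e s) hr.le).trans ?_
      rw [← ENNReal.ofReal_mul (by linarith)]
      exact ENNReal.ofReal_le_ofReal (le_of_eq (by ring)))
    (Eventually.of_forall fun x hx => by
      have h0 : B x = 0 := by
        by_contra h
        obtain ⟨h1, h2, h3⟩ := bump_ne_zero hr ha.le hb.le h
        refine hx ⟨⟨?_, ?_⟩, mem_closedBall_iff_norm.2 h1.le⟩
        · rw [one_div, inv_mul_lt_iff₀ hδ, mul_one] at h3
          linarith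
        · by_contra hcon
          push Not at hcon
          have h4 : 1 / δ * δ ≤ a * signedDist m ν x := mul_le_mul hab hcon hδ.le ha.le
          rw [one_div, inv_mul_cancel₀ hδ.ne'] at h4
          linarith
      refine ⟨by rw [h0, mul_zero], ?_⟩
      rw [← norm_eq_zero, norm_gradient_const_mul hσ, gradient_bump_eq_zero h0, norm_zero])
    (by
      filter_upwards [ae_mem_interior_Ω] with x ⟨e', he', hx⟩
      rw [norm_gradient_const_mul hσ]
      by_cases heE : e' ∈ M.elementsAt s
      · refine (hgrad e' heE x hx).trans ?_
        -- Since δ ≤ r, the tangential slope is dominated by the normal one.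
        have : r⁻¹ ≤ 1 / δ := by rw [one_div]; exact inv_anti₀ hδ hδr
        calc r⁻¹ + 1 / δ ≤ 1 / δ + 1 / δ := by linarith
          _ = 2 / δ := by ring
      · have h0 : B x = 0 := eq_zero_of_inactive (fun e he => (mem_elementsAt.1 he).1) hsupp he' heE hx
        rw [gradient_bump_eq_zero h0, norm_zero]
        positivity)
  refine ⟨fun x => σ * B x, _, hψL, hloc, hother, hnear, hψ1, fun x => ?_, fun x hx hxm => ?_,
    hEN.1.trans hV, hEN.2.trans (Real.sqrt_le_sqrt ?_)⟩
  · simp only [hψB]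
    exact bump_nonneg x
  · simp only [hψB]
    refine half_le_bump hr (hxm.trans (le_of_eq ?_)) (signedDist_side hs hx)
    rw [hrdef]; field_simp; norm_num
  · gcongr

/-- With the sign of ϖ₀ − J, the squeezed bump turns the side residual into a positive quantity. The
test inequality bounds it by the error times the energy norm of the bump, by the volume residual on
the slab of width 2δ, and by the oscillation of the datum. A common factor √B is divided out at the
end. -/
theorem side_test (hn : 1 ≤ n) (hreg : M.PatchRegular p K N) (hK : 1 ≤ K)
    (hf : MemLp f 2 (volume.restrict M.Ω)) (hπ : MemLp π 2 ((surf (n + 1)).restrict M.ΓN))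
    (hφm : M.IsPA φm) (hφ : M.IsH1 φ)
    (hD : M.dualNorm ε (M.patch p)
      (fun ψ => M.residual ε f π φ ψ - M.quasiForce ε f π gm φm ψ) ≠ ∞)
    (hfc : ¬ M.IsFullContact ε f π gm φm p) (hp : p ∈ s) (hϖ : M.IsSideDatum π s ϖ) (ϖ₀ : ℝ)
    {δ : ℝ} (hδ : 0 < δ) (hδr : δ ≤ M.hp p / (2 * K * (n + 1))) :
    3 / (8 * ((n : ℝ) + 1)) * (1 / (4 * K * (n + 1))) ^ n * |ϖ₀ - ε ^ 2 * normalJump M φm s| *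
        Real.sqrt (M.hp p ^ n * unitBallVolume n) ≤
      (M.localError ε f π gm φm φ p).toReal * Real.sqrt ((ε ^ 2 * (2 / δ) ^ 2 + 1) * (2 * δ)) +
        Real.sqrt (∫ x in M.patch p, (f x - φm x) ^ 2) * Real.sqrt (2 * δ) +
        Real.sqrt (∫ x in hull s, (ϖ₀ - ϖ x) ^ 2 ∂surf (n + 1)) := by
  obtain ⟨e, heM, hse, hs⟩ := Mesh.mem_sides.1 hϖ.mem_sides
  have he : e ∈ M.elementsAt s := mem_elementsAt.2 ⟨heM, hse⟩
  have hH := hreg.hp_pos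
  have hω := unitBallVolume_pos n
  set B := M.hp p ^ n * unitBallVolume n with hBdef
  have hB : 0 < B := by positivity
  set J := ε ^ 2 * normalJump M φm s with hJ
  obtain ⟨σ, hσ, hσc⟩ : ∃ σ : ℝ, |σ| = 1 ∧ σ * (ϖ₀ - J) = |ϖ₀ - J| := by
    rcases le_total 0 (ϖ₀ - J) with h | h
    · exact ⟨1, abs_one, by rw [one_mul, abs_of_nonneg h]⟩
    · exact ⟨-1, by simp, by rw [abs_of_nonpos h]; ring⟩
  have hσ2 : σ * σ = 1 := by rw [← abs_mul_abs_self, hσ, one_mul]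
  obtain ⟨ψ, L, hψL, hloc, hother, hnear, hψ1, hσψ, hhalf, hψV, hEN⟩ :=
    exists_side_test_function (ε := ε) hn hreg hK hp hϖ hσ hδ hδr
  rw [← hBdef] at hψV hEN
  set θ := M.contactWeight ε f π gm φm with hθ
  have hsdom : hull s ⊆ M.closedDomain :=
    (convexHull_mono (by exact_mod_cast hse)).trans (hull_subset_closedDomain heM)
  have hfin : IsFiniteMeasure ((surf (n + 1)).restrict (hull s)) :=
    ⟨by simpa using surf_hull_lt_top (isSimplex heM) hse hs⟩
  have hϖL := hϖ.memLp hπ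
  have hψm : AEStronglyMeasurable ψ ((surf (n + 1)).restrict (hull s)) :=
    hψL.continuous.aestronglyMeasurable
  have hkL : Integrable (fun x => (ϖ x - J) * ψ x) ((surf (n + 1)).restrict (hull s)) :=
    ((hϖL.sub (memLp_const J)).integrable one_le_two).mul_bdd hψm (Eventually.of_forall hψ1)
  have hθdom : ∀ x ∈ M.closedDomain, 0 ≤ θ x ∧ θ x ≤ 1 := fun x hx => by
    obtain ⟨e', he', hxe'⟩ := mem_iUnion₂.1 hx
    exact ⟨contactWeight_nonneg he' hxe', contactWeight_le_one he' hxe'⟩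
  have htest := hloc.test_bound (gm := gm) (π := π) (Γ' := hull s)
    (k := fun x => (ϖ x - J) * ψ x) hf hφm hφ (measurableSet_hull s) hsdom hkL (fun w hw => by
      rw [residual_mulFun_side hf hφm hψL hloc.hasCompactSupport hs hloc.support
        (fun e' he' x hx h => mem_hull_near_side hreg hn hK hs hp he' (hnear x hx) h)
        (fun e' he' x h hx => mem_side_near_side hreg hn hK hs hp he' (hnear x hx) h) hw,
        hϖ.integral_ΓN hother, ← hJ, add_sub_assoc]
      congr 1
      obtain ⟨C, -, hC⟩ := hw.exists_bound
      have hψw : MemLp (fun x => ψ x * w x) 2 ((surf (n + 1)).restrict (hull s)) := by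
        refine MemLp.of_bound (hψm.mul ((hw.continuousOn.mono hsdom).aestronglyMeasurable
          (measurableSet_hull s))) (1 * C) ?_
        filter_upwards [ae_restrict_mem (measurableSet_hull s)] with x hx
        rw [norm_mul]
        exact mul_le_mul (hψ1 x) (hC x (hsdom hx)) (norm_nonneg _) zero_le_one
      have i1 : Integrable (fun x => ϖ x * (ψ x * w x)) ((surf (n + 1)).restrict (hull s)) :=
        hϖL.integrable_mul hψw
      rw [← integral_const_mul, ← integral_sub i1 ((hψw.integrable one_le_two).const_mul J)]
      congr 1; ext x; ring) hD
  have hψθL : MemLp (fun x => ψ x * θ x) 2 ((surf (n + 1)).restrict (hull s)) := by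
    refine MemLp.of_bound (hψm.mul ((continuousOn_contactWeight.mono hsdom).aestronglyMeasurable
      (measurableSet_hull s))) 1 ?_
    filter_upwards [ae_restrict_mem (measurableSet_hull s)] with x hx
    rw [norm_mul, Real.norm_of_nonneg (hθdom x (hsdom hx)).1]
    exact mul_le_one₀ (hψ1 x) (hθdom x (hsdom hx)).1 (hθdom x (hsdom hx)).2
  have hdL : MemLp (fun x => ϖ₀ - ϖ x) 2 ((surf (n + 1)).restrict (hull s)) :=
    (memLp_const ϖ₀).sub hϖL
  -- the side integral
  have hsplit : ∫ x in hull s, (ϖ x - J) * ψ x * θ x ∂surf (n + 1) =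
      (ϖ₀ - J) * (∫ x in hull s, ψ x * θ x ∂surf (n + 1)) -
        ∫ x in hull s, (ϖ₀ - ϖ x) * (ψ x * θ x) ∂surf (n + 1) := by
    have i1 : Integrable (fun x => (ϖ₀ - ϖ x) * (ψ x * θ x)) ((surf (n + 1)).restrict (hull s)) :=
      hdL.integrable_mul hψθL
    rw [← integral_const_mul, ← integral_sub ((hψθL.integrable one_le_two).const_mul _) i1]
    congr 1; ext x; ring
  have hosc : ∫ x in hull s, (ϖ₀ - ϖ x) * (ψ x * θ x) ∂surf (n + 1) ≤
      Real.sqrt (∫ x in hull s, (ϖ₀ - ϖ x) ^ 2 ∂surf (n + 1)) * Real.sqrt B := by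
    refine (le_abs_self _).trans ((integral_mul_le_sqrt hdL hψθL).trans ?_)
    refine mul_le_mul_of_nonneg_left (Real.sqrt_le_sqrt ?_) (Real.sqrt_nonneg _)
    calc ∫ x in hull s, (ψ x * θ x) ^ 2 ∂surf (n + 1) ≤ ∫ x in hull s, (1 : ℝ) ∂surf (n + 1) := by
          refine setIntegral_mono_on hψθL.integrable_sq (integrable_const _)
            (measurableSet_hull s) fun x hx => ?_
          rw [← sq_abs, abs_mul, abs_of_nonneg (hθdom x (hsdom hx)).1]
          exact pow_le_one₀ (mul_nonneg (abs_nonneg _) (hθdom x (hsdom hx)).1)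
            (mul_le_one₀ (hψ1 x) (hθdom x (hsdom hx)).1 (hθdom x (hsdom hx)).2)
      _ = (surf (n + 1) (hull s)).toReal := by
          rw [setIntegral_const, smul_eq_mul, mul_one]; rfl
      _ ≤ B := ENNReal.toReal_le_of_le_ofReal hB.le (surf_hull_le (isSimplex heM) hse hs
          ((Metric.diam_mono (convexHull_mono (by exact_mod_cast hse))
            (isCompact_hull e).isBounded).trans (hreg.diam_le e (elementsAt_subset_star hp he))))
  have hlow : 3 / (8 * ((n : ℝ) + 1)) * (1 / (4 * K * (n + 1))) ^ n * B ≤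
      ∫ x in hull s, σ * (ψ x * θ x) ∂surf (n + 1) := by
    set r := M.hp p / (4 * K * (n + 1)) with hr
    have hr0 : 0 ≤ r := by positivity
    set D := plane (barycentre s) (outerNormal e s) ∩ Metric.closedBall (barycentre s) r
    have hDr : ∀ x ∈ D, ‖x - barycentre s‖ ≤ M.hp p / (2 * K * (n + 1)) := fun x hx => by
      refine (mem_closedBall_iff_norm.1 hx.2).trans ?_
      rw [hr]
      gcongr
      norm_num
    have hDs : D ⊆ hull s := fun x hx => mem_side_near_side hreg hn hK hs hp he (hDr x hx) hx.1
    have hDm : MeasurableSet D :=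
      (measurableSet_plane _ _).inter Metric.isClosed_closedBall.measurableSet
    have hDv : (surf (n + 1) D).toReal = (1 / (4 * K * (n + 1))) ^ n * B := by
      rw [surf_plane_inter_closedBall (norm_outerNormal (isSimplex heM) hse hs)
        (barycentre_mem_plane e s) hr0, ENNReal.toReal_ofReal (by positivity), hBdef, ← mul_assoc,
        ← mul_pow, hr]
      congr 2; ring
    have hint : Integrable (fun x => σ * (ψ x * θ x)) ((surf (n + 1)).restrict (hull s)) :=
      (hψθL.integrable one_le_two).const_mul σ
    calc 3 / (8 * ((n : ℝ) + 1)) * (1 / (4 * K * (n + 1))) ^ n * B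
        -- On the disc of half the radius the bump is at least 1/2 and the contact weight at least 3
        -- / (4 (n + 1)).
        = ∫ x in D, (1 / 2 * (3 / (4 * ((n : ℝ) + 1)))) ∂surf (n + 1) := by
          have h8 : 3 / (8 * ((n : ℝ) + 1)) = 1 / 2 * (3 / (4 * ((n : ℝ) + 1))) := by
            field_simp; norm_num
          rw [setIntegral_const, Measure.real, hDv, smul_eq_mul, h8]; ring
      _ ≤ ∫ x in D, σ * (ψ x * θ x) ∂surf (n + 1) := by
          refine setIntegral_mono_on (integrableOn_const
            ((measure_mono hDs).trans_lt (surf_hull_lt_top (isSimplex heM) hse hs)).ne)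
            (hint.mono_measure (Measure.restrict_mono hDs le_rfl)) hDm fun x hx => ?_
          rw [← mul_assoc]
          have h1 := hhalf x (hDs hx) (mem_closedBall_iff_norm.1 hx.2)
          have hxe : x ∈ hull e := convexHull_mono (by exact_mod_cast hse) (hDs hx)
          have h2 : 3 / (4 * ((n : ℝ) + 1)) ≤ θ x :=
            ((hreg.coord_near_side hn hK hs hp he (hDr x hx)).1 p hp).trans
              (coord_le_contactWeight heM hxe (hse hp) hfc)
          exact mul_le_mul h1 h2 (by positivity) (by linarith)
      _ ≤ _ := by
          refine setIntegral_mono_set hint ?_ hDs.eventuallyLE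
          filter_upwards [ae_restrict_mem (measurableSet_hull s)] with x hx
          rw [Pi.zero_apply, ← mul_assoc]
          exact mul_nonneg (hσψ x) (hθdom x (hsdom hx)).1
  have hmain : 3 / (8 * ((n : ℝ) + 1)) * (1 / (4 * K * (n + 1))) ^ n * |ϖ₀ - J| * B ≤
      (ϖ₀ - J) * ∫ x in hull s, ψ x * θ x ∂surf (n + 1) := by
    rw [integral_const_mul] at hlow
    have h1 := mul_le_mul_of_nonneg_left hlow (abs_nonneg (ϖ₀ - J))
    have h2 : |ϖ₀ - J| * (σ * ∫ x in hull s, ψ x * θ x ∂surf (n + 1)) =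
        (ϖ₀ - J) * ∫ x in hull s, ψ x * θ x ∂surf (n + 1) := by
      rw [← hσc, ← mul_assoc, mul_right_comm σ, hσ2, one_mul]
    rw [h2] at h1
    linarith
  -- the volume integral
  have hvol : -(∫ x in M.Ω, ((f x - φm x) * ψ x) * θ x) ≤
      Real.sqrt (∫ x in M.patch p, (f x - φm x) ^ 2) * Real.sqrt (2 * δ * B) := by
    have hle : (volume : Measure (Pt (n + 1))).restrict (M.patch p) ≤ volume.restrict M.Ω :=
      Measure.restrict_mono patch_subset_Ω le_rfl
    have hpm : MeasurableSet (M.patch p) := isOpen_interior.measurableSet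
    have e1 : ∫ x in M.Ω, ((f x - φm x) * ψ x) * θ x =
        ∫ x in M.patch p, (f x - φm x) * (ψ x * θ x) := by
      simp only [mul_assoc]
      refine setIntegral_eq_of_subset_of_ae_sdiff_eq_zero measurableSet_Ω.nullMeasurableSet
        patch_subset_Ω ?_
      have := hloc.ae_zero_off_patch
      rw [ae_restrict_iff' measurableSet_Ω] at this
      filter_upwards [this] with x hx hx'
      rw [(hx hx'.1 hx'.2).1]; ring
    have hψθ : ∀ x ∈ M.Ω, |ψ x * θ x| ≤ |ψ x| := fun x hx => by
      obtain ⟨h0, h1⟩ := hθdom x (Ω_subset hx)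
      rw [abs_mul, abs_of_nonneg h0]
      exact mul_le_of_le_one_right (abs_nonneg _) h1
    have hψL2 : MemLp ψ 2 (volume.restrict M.Ω) := hloc.isTest.1.1
    have hψθ2 : MemLp (fun x => ψ x * θ x) 2 (volume.restrict M.Ω) := by
      refine hψL2.mono (hψL2.1.mul ((continuousOn_contactWeight.mono Ω_subset).aestronglyMeasurable
        measurableSet_Ω)) ?_
      filter_upwards [ae_restrict_mem measurableSet_Ω] with x hx using hψθ x hx
    rw [e1]
    refine (neg_le_abs _).trans ((integral_mul_le_sqrt ((hf.sub hφm.memLp).mono_measure hle)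
      (hψθ2.mono_measure hle)).trans ?_)
    refine mul_le_mul_of_nonneg_left (Real.sqrt_le_sqrt (le_trans ?_ hψV)) (Real.sqrt_nonneg _)
    calc ∫ x in M.patch p, (ψ x * θ x) ^ 2 ≤ ∫ x in M.Ω, (ψ x * θ x) ^ 2 :=
          setIntegral_mono_set hψθ2.integrable_sq (Eventually.of_forall fun x => sq_nonneg _)
            patch_subset_Ω.eventuallyLE
      _ ≤ ∫ x in M.Ω, ψ x ^ 2 :=
          setIntegral_mono_on hψθ2.integrable_sq hψL2.integrable_sq measurableSet_Ω
            fun x hx => sq_le_sq.2 (hψθ x hx)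
  have hErr : 0 ≤ (M.localError ε f π gm φm φ p).toReal := ENNReal.toReal_nonneg
  have hfinal := mul_le_mul_of_nonneg_left hEN hErr
  rw [← mul_assoc, Real.sqrt_mul (by positivity)] at hfinal
  rw [Real.sqrt_mul (by positivity)] at hvol
  rw [hsplit] at htest
  have hsB : 0 < Real.sqrt B := Real.sqrt_pos.2 hB
  refine le_of_mul_le_mul_right ?_ hsB
  rw [mul_assoc, Real.mul_self_sqrt hB.le]
  linarith

end Mesh

/-! ### Summation over elements and sides, and the conclusion -/

theorem sqrt_sum_le {ι : Type*} (S : Finset ι) {F : ι → ℝ} (hF : ∀ i, 0 ≤ F i) :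
    Real.sqrt (∑ i ∈ S, F i) ≤ ∑ i ∈ S, Real.sqrt (F i) := by
  classical
  induction S using Finset.induction_on with
  | empty => simp
  | insert a S ha ih =>
    rw [Finset.sum_insert ha, Finset.sum_insert ha]
    refine le_trans ?_ (add_le_add_right ih _)
    have h1 := hF a
    have h2 : 0 ≤ ∑ i ∈ S, F i := Finset.sum_nonneg fun i _ => hF i
    rw [Real.sqrt_le_left (by positivity), add_sq, Real.sq_sqrt h1, Real.sq_sqrt h2]
    have : 0 ≤ 2 * Real.sqrt (F a) * Real.sqrt (∑ i ∈ S, F i) := by positivity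
    linarith

theorem mul_sqrt_sum_le {ι : Type*} {S : Finset ι} {F : ι → ℝ} {w c : ℝ} {m : ℕ} (hw : 0 ≤ w)
    (hF : ∀ i, 0 ≤ F i) (hc : 0 ≤ c) (hm : S.card ≤ m) (h : ∀ i ∈ S, w * Real.sqrt (F i) ≤ c) :
    w * Real.sqrt (∑ i ∈ S, F i) ≤ m * c := by
  calc w * Real.sqrt (∑ i ∈ S, F i) ≤ w * ∑ i ∈ S, Real.sqrt (F i) :=
        mul_le_mul_of_nonneg_left (sqrt_sum_le S hF) hw
    _ = ∑ i ∈ S, w * Real.sqrt (F i) := Finset.mul_sum _ _ _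
    _ ≤ S.card • c := Finset.sum_le_card_nsmul _ _ _ h
    _ ≤ m * c := by
      rw [nsmul_eq_mul]
      exact mul_le_mul_of_nonneg_right (by exact_mod_cast hm) hc

namespace Mesh

variable {n : ℕ} {M : Mesh (n + 1)} {p : Pt (n + 1)} {ε K : ℝ} {N : ℕ}

/-- Every such side is one of the n + 2 sides of an element of the star. -/
theorem card_sides_le (hreg : M.PatchRegular p K N) {S : Finset (Finset (Pt (n + 1)))}
    (hS : ∀ s ∈ S, s ∈ M.sides ∧ p ∈ s) : S.card ≤ N * (n + 2) := by
  classical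
  have hsub : S ⊆ (M.star p).biUnion (·.powersetCard (n + 1)) := fun s hs => by
    obtain ⟨hsM, hps⟩ := hS s hs
    obtain ⟨e, he, hse, hcard⟩ := mem_sides.1 hsM
    exact Finset.mem_biUnion.2 ⟨e, mem_star.2 ⟨he, hse hps⟩, Finset.mem_powersetCard.2 ⟨hse, hcard⟩⟩
  refine (Finset.card_le_card hsub).trans ((Finset.card_biUnion_le_card_mul _ _ (n + 2)
    fun e he => ?_).trans (Nat.mul_le_mul_right _ hreg.card_le))
  rw [Finset.card_powersetCard, M.card_eq e (star_subset he)]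
  simp

/-- Robustness for sides: after squaring, the first product is 8T + 2α²/T and the second is 2α²/T.
The choice δ = αε/T is what cancels ε in both, and the second bound produces the weight of η₁. -/
theorem sqrt_weight_mul_sqrt (hε : 0 < ε) {δ T : ℝ} (hT : 1 ≤ T) (hα : 0 < M.weight ε p)
    (hδ : δ = M.weight ε p * ε / T) :
    Real.sqrt (M.weight ε p) * (Real.sqrt ε)⁻¹ *
        Real.sqrt ((ε ^ 2 * (2 / δ) ^ 2 + 1) * (2 * δ)) ≤ Real.sqrt (8 * T + 2) ∧
      Real.sqrt (M.weight ε p) * (Real.sqrt ε)⁻¹ * Real.sqrt (2 * δ) ≤ 2 * M.weight ε p := by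
  have hα1 : M.weight ε p ≤ 1 := weight_le_one p
  set α := M.weight ε p
  have hT0 : 0 < T := by linarith
  have hδ0 : 0 < δ := by rw [hδ]; positivity
  rw [← Real.sqrt_inv, ← Real.sqrt_mul hα.le, ← Real.sqrt_mul (by positivity),
    ← Real.sqrt_mul (by positivity)]
  have hsq : α ^ 2 / T ≤ α ^ 2 := div_le_self (sq_nonneg _) hT
  constructor
  · refine Real.sqrt_le_sqrt ?_
    have e1 : α * ε⁻¹ * ((ε ^ 2 * (2 / δ) ^ 2 + 1) * (2 * δ)) = 8 * T + 2 * (α ^ 2 / T) := by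
      rw [hδ]; field_simp; ring
    rw [e1]
    nlinarith
  · rw [Real.sqrt_le_left (by positivity)]
    have e1 : α * ε⁻¹ * (2 * δ) = 2 * (α ^ 2 / T) := by rw [hδ]; field_simp
    rw [e1]
    nlinarith [sq_nonneg α]

/-- The side residuals are bounded by the local error, the interior residual and the oscillation. -/
theorem exists_side_bound (hn : 1 ≤ n) {K : ℝ} (hK : 1 ≤ K) (N : ℕ) : ∃ C : ℝ, 0 ≤ C ∧
    ∀ (M : Mesh (n + 1)) (p : Pt (n + 1)), M.PatchRegular p K N → ∀ ε : ℝ, 0 < ε →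
    ∀ (f π gm φm : Pt (n + 1) → ℝ) (φ : Jet (n + 1)), MemLp f 2 (volume.restrict M.Ω) →
      MemLp π 2 ((surf (n + 1)).restrict M.ΓN) → M.IsPA φm → M.IsH1 φ →
      M.dualNorm ε (M.patch p)
        (fun ψ => M.residual ε f π φ ψ - M.quasiForce ε f π gm φm ψ) ≠ ∞ →
      ¬ M.IsFullContact ε f π gm φm p → ∀ s, p ∈ s → ∀ ϖ, M.IsSideDatum π s ϖ →
      Real.sqrt (M.weight ε p) * (Real.sqrt ε)⁻¹ * Real.sqrt (∫ x in hull s,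
          (ϖ x - ε ^ 2 * normalJump M φm s) ^ 2 ∂surf (n + 1)) ≤
        C * ((M.localError ε f π gm φm φ p).toReal + M.η₁ ε f φm p +
          Real.sqrt (M.weight ε p) * (Real.sqrt ε)⁻¹ * Real.sqrt (∫ x in hull s,
            ((⨍ y in hull s, ϖ y ∂surf (n + 1)) - ϖ x) ^ 2 ∂surf (n + 1))) := by
  set T : ℝ := 2 * K * (n + 1) with hT
  have hT1 : 1 ≤ T := by
    have : (1 : ℝ) ≤ n := by exact_mod_cast hn
    nlinarith
  set c1 : ℝ := 3 / (8 * ((n : ℝ) + 1)) * (1 / (4 * K * (n + 1))) ^ n with hc1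
  have hc10 : 0 < c1 := by positivity
  refine ⟨2 + 2 / c1 * (Real.sqrt (8 * T + 2) + 3), by positivity, ?_⟩
  intro M p hreg ε hε f π gm φm φ hf hπ hφm hφ hD hfc s hp ϖ hϖ
  obtain ⟨e, heM, hse, hs⟩ := Mesh.mem_sides.1 hϖ.mem_sides
  have he : e ∈ M.star p := mem_star.2 ⟨heM, hse hp⟩
  have hH := hreg.hp_pos
  have hα : 0 < M.weight ε p := lt_min (div_pos hH hε) one_pos
  set α := M.weight ε p with hαdef
  -- The width is admissible because αε ≤ h_p and T is the ratio of h_p to the radius of the side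
  -- bump.
  set δ := α * ε / T with hδ
  have hδ0 : 0 < δ := by positivity
  have hδr : δ ≤ M.hp p / (2 * K * (n + 1)) :=
    div_le_div_of_nonneg_right (weight_mul_le hε p) (by linarith)
  obtain ⟨hw1, hw2⟩ := sqrt_weight_mul_sqrt hε hT1 hα hδ
  rw [← hαdef] at hw1 hw2
  set w := Real.sqrt α * (Real.sqrt ε)⁻¹ with hwdef
  have hw : 0 ≤ w := by positivity
  set ϖ₀ := ⨍ y in hull s, ϖ y ∂surf (n + 1)
  set J := ε ^ 2 * normalJump M φm s with hJ
  have htest := side_test (gm := gm) (ε := ε) hn hreg hK hf hπ hφm hφ hD hfc hp hϖ ϖ₀ hδ0 hδr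
  rw [← hJ, ← hc1] at htest
  set B := M.hp p ^ n * unitBallVolume n
  have hB : 0 ≤ B := by have := unitBallVolume_pos n; positivity
  set Err := (M.localError ε f π gm φm φ p).toReal
  have hErr : 0 ≤ Err := ENNReal.toReal_nonneg
  set F := Real.sqrt (∫ x in M.patch p, (f x - φm x) ^ 2)
  have hF : 0 ≤ F := Real.sqrt_nonneg _
  have hη : M.η₁ ε f φm p = α * F := rfl
  set O := Real.sqrt (∫ x in hull s, (ϖ₀ - ϖ x) ^ 2 ∂surf (n + 1)) with hO
  have hO0 : 0 ≤ O := Real.sqrt_nonneg _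
  have hfin : IsFiniteMeasure ((surf (n + 1)).restrict (hull s)) :=
    ⟨by simpa using surf_hull_lt_top (isSimplex heM) hse hs⟩
  have hϖL := hϖ.memLp hπ
  have hd : MemLp (fun x => ϖ x - ϖ₀) 2 ((surf (n + 1)).restrict (hull s)) :=
    hϖL.sub (memLp_const ϖ₀)
  have htri := sqrt_integral_add_sq_le hd
    (memLp_const (μ := (surf (n + 1)).restrict (hull s)) (p := 2) (ϖ₀ - J))
  have e1 : ∫ x in hull s, (ϖ x - ϖ₀ + (ϖ₀ - J)) ^ 2 ∂surf (n + 1) =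
      ∫ x in hull s, (ϖ x - J) ^ 2 ∂surf (n + 1) := by
    congr 1; ext x; ring
  have e2 : ∫ x in hull s, (ϖ x - ϖ₀) ^ 2 ∂surf (n + 1) =
      ∫ x in hull s, (ϖ₀ - ϖ x) ^ 2 ∂surf (n + 1) := by
    congr 1; ext x; ring
  rw [e1, e2, ← hO] at htri
  have h1 : Real.sqrt (∫ x in hull s, (ϖ₀ - J) ^ 2 ∂surf (n + 1)) ≤
      |ϖ₀ - J| * Real.sqrt B := by
    rw [setIntegral_const, smul_eq_mul, mul_comm, Real.sqrt_mul (sq_nonneg _), Real.sqrt_sq_eq_abs]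
    refine mul_le_mul_of_nonneg_left (Real.sqrt_le_sqrt ?_) (abs_nonneg _)
    exact ENNReal.toReal_le_of_le_ofReal hB (surf_hull_le (isSimplex heM) hse hs
      ((Metric.diam_mono (convexHull_mono (by exact_mod_cast hse))
        (isCompact_hull e).isBounded).trans (hreg.diam_le e he)))
  set S1 := Real.sqrt ((ε ^ 2 * (2 / δ) ^ 2 + 1) * (2 * δ))
  set S2 := Real.sqrt (2 * δ)
  set R := Real.sqrt (8 * T + 2)
  have hR : 0 ≤ R := Real.sqrt_nonneg _
  have h2 : w * (|ϖ₀ - J| * Real.sqrt B) ≤ 1 / c1 * (R * Err + 2 * (α * F) + w * O) := by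
    rw [one_div, le_inv_mul_iff₀ hc10]
    calc c1 * (w * (|ϖ₀ - J| * Real.sqrt B)) = w * (c1 * |ϖ₀ - J| * Real.sqrt B) := by ring
      _ ≤ w * (Err * S1 + F * S2 + O) := mul_le_mul_of_nonneg_left htest hw
      _ = (w * S1) * Err + (w * S2) * F + w * O := by ring
      _ ≤ R * Err + (2 * α) * F + w * O := by gcongr
      _ = _ := by ring
  have hwO : 0 ≤ w * O := mul_nonneg hw hO0
  have hαF : 0 ≤ α * F := mul_nonneg hα.le hF
  rw [hη]
  calc w * Real.sqrt (∫ x in hull s, (ϖ x - J) ^ 2 ∂surf (n + 1))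
      ≤ w * (2 * (O + |ϖ₀ - J| * Real.sqrt B)) := by
        refine mul_le_mul_of_nonneg_left (htri.trans ?_) hw
        linarith
    _ = 2 * (w * O) + 2 * (w * (|ϖ₀ - J| * Real.sqrt B)) := by ring
    _ ≤ 2 * (w * O) + 2 * (1 / c1 * (R * Err + 2 * (α * F) + w * O)) := by gcongr
    _ = 2 * (w * O) + 2 / c1 * (R * Err + 2 * (α * F) + w * O) := by ring
    _ ≤ 2 * (Err + α * F + w * O) + 2 / c1 * ((R + 3) * (Err + α * F + w * O)) := by
        gcongr
        · linarith
        · nlinarith [mul_nonneg hR hαF, mul_nonneg hR hwO]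
    _ = _ := by ring

/-- Element bounds are summed over the at most N elements of the star, which gives η₁; inserted into
the side bounds, this leaves only the error and oscillations, summed over at most N (n + 2) sides.
-/
theorem exists_lower_bound (hn : 1 ≤ n) (κ : ℝ) : ∃ C : ℝ, 0 < C ∧
    ∀ M : Mesh (n + 1), M.ShapeRegular κ → ∀ ε : ℝ, 0 < ε →
    ∀ (f π gm φm : Pt (n + 1) → ℝ) (φ : Jet (n + 1)), MemLp f 2 (volume.restrict M.Ω) →
      MemLp π 2 ((surf (n + 1)).restrict M.ΓN) → M.IsPA φm → M.IsH1 φ →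
      ∀ p ∈ M.nodes, M.dualNorm ε (M.patch p)
        (fun ψ => M.residual ε f π φ ψ - M.quasiForce ε f π gm φm ψ) ≠ ∞ →
      ¬ M.IsFullContact ε f π gm φm p →
      ∀ η ∈ ({M.η₁ ε f φm p, M.η₂ ε φm p, M.η₃ ε π φm p} : Set ℝ),
        η ≤ C * ((M.localError ε f π gm φm φ p).toReal + M.oscForce ε f p +
          M.oscNeumann ε π p) := by
  obtain ⟨K, hK, N, hreg'⟩ := exists_patchRegular hn κ
  obtain ⟨C1, hC1, h1⟩ := exists_element_bound hn hK N
  obtain ⟨C2, hC2, h2⟩ := exists_side_bound hn hK N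
  set D1 : ℝ := N * C1
  set D2 : ℝ := (N * (n + 2) : ℕ) * (C2 * (1 + D1))
  have hD1 : 0 ≤ D1 := by positivity
  have hD2 : 0 ≤ D2 := by positivity
  refine ⟨1 + D1 + D2, by positivity, ?_⟩
  intro M hM ε hε f π gm φm φ hf hπ hφm hφ p hp hD hfc
  have hreg := hreg' M hM p hp
  have hα := weight_nonneg (M := M) hε p
  set Err := (M.localError ε f π gm φm φ p).toReal
  have hErr : 0 ≤ Err := ENNReal.toReal_nonneg
  have hO : 0 ≤ M.oscForce ε f p := mul_nonneg hα (Real.sqrt_nonneg _)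
  have hw : 0 ≤ Real.sqrt (M.weight ε p) * (Real.sqrt ε)⁻¹ := by positivity
  have hON : 0 ≤ M.oscNeumann ε π p := mul_nonneg hw (Real.sqrt_nonneg _)
  set X := Err + M.oscForce ε f p + M.oscNeumann ε π p with hX
  have hX0 : 0 ≤ X := by positivity
  have hη₁ : M.η₁ ε f φm p ≤ D1 * X := by
    have hd : Integrable (fun x => (f x - φm x) ^ 2) (volume.restrict M.Ω) :=
      (hf.sub hφm.memLp).integrable_sq
    rw [Mesh.η₁, Mesh.patch, setIntegral_union_hull star_subset
      (hd.mono_measure (Measure.restrict_mono patch_subset_Ω le_rfl))]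
    have := mul_sqrt_sum_le (S := M.star p) (F := fun e => ∫ x in hull e, (f x - φm x) ^ 2) hα
      (fun e => integral_nonneg fun x => sq_nonneg _) (c := C1 * X) (by positivity) hreg.card_le
      fun e he => (h1 M p hreg ε hε f π gm φm φ hf hφm hφ hD hfc e he).trans
        (mul_le_mul_of_nonneg_left (by linarith) hC1)
    rw [← mul_assoc] at this
    exact this
  have hside : ∀ s, p ∈ s → ∀ ϖ, M.IsSideDatum π s ϖ →
      Real.sqrt (M.weight ε p) * (Real.sqrt ε)⁻¹ * Real.sqrt (∫ x in hull s,
        (ϖ x - ε ^ 2 * normalJump M φm s) ^ 2 ∂surf (n + 1)) ≤ C2 * (1 + D1) * X := by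
    intro s hps ϖ hϖ
    refine (h2 M p hreg ε hε f π gm φm φ hf hπ hφm hφ hD hfc s hps ϖ hϖ).trans ?_
    rw [mul_assoc C2]
    refine mul_le_mul_of_nonneg_left ?_ hC2
    have hosc : Real.sqrt (M.weight ε p) * (Real.sqrt ε)⁻¹ * Real.sqrt (∫ x in hull s,
        ((⨍ y in hull s, ϖ y ∂surf (n + 1)) - ϖ x) ^ 2 ∂surf (n + 1)) ≤ M.oscNeumann ε π p := by
      rcases hϖ with ⟨hs, rfl⟩ | ⟨-, rfl⟩
      · refine mul_le_mul_of_nonneg_left (Real.sqrt_le_sqrt ?_) hw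
        have hmem : s ∈ M.neumannSidesAt p := Finset.mem_filter.2 ⟨hs, hps⟩
        exact Finset.single_le_sum (f := fun s => ∫ x in hull s,
          ((⨍ y in hull s, ϖ y ∂surf (n + 1)) - ϖ x) ^ 2 ∂surf (n + 1))
          (fun s _ => integral_nonneg fun x => sq_nonneg _) hmem
      · simpa using hON
    linarith
  have hη₃ : M.η₃ ε π φm p ≤ D2 * X := by
    have := mul_sqrt_sum_le (S := M.neumannSidesAt p)
      (F := fun s => ∫ x in hull s, (π x - ε ^ 2 * normalJump M φm s) ^ 2 ∂surf (n + 1)) hw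
      (fun e => integral_nonneg fun x => sq_nonneg _) (c := C2 * (1 + D1) * X) (by positivity)
      (card_sides_le hreg fun s hs => ⟨(mem_neumannSides.1 (Finset.mem_filter.1 hs).1).1,
        (Finset.mem_filter.1 hs).2⟩)
      fun s hs => hside s (Finset.mem_filter.1 hs).2 π (.inl ⟨(Finset.mem_filter.1 hs).1, rfl⟩)
    rw [← mul_assoc] at this
    exact this
  have hη₂ : M.η₂ ε φm p ≤ D2 * X := by
    have := mul_sqrt_sum_le (S := M.skeletonSides p)
      (F := fun s => ∫ _ in hull s, (ε ^ 2 * normalJump M φm s) ^ 2 ∂surf (n + 1)) hw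
      (fun e => integral_nonneg fun x => sq_nonneg _) (c := C2 * (1 + D1) * X) (by positivity)
      (card_sides_le hreg fun s hs => ⟨(mem_interiorSides.1 (Finset.mem_filter.1 hs).1).1,
        (Finset.mem_filter.1 hs).2⟩)
      fun s hs => by
        -- With zero datum the side residual is the jump up to sign, and its oscillation vanishes.
        have := hside s (Finset.mem_filter.1 hs).2 _ (.inr ⟨(Finset.mem_filter.1 hs).1, rfl⟩)
        simpa only [zero_sub, neg_sq] using this
    rw [← mul_assoc] at this
    exact this
  have hY1 : D1 * X ≤ (1 + D1 + D2) * X := mul_le_mul_of_nonneg_right (by linarith) hX0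
  have hY2 : D2 * X ≤ (1 + D1 + D2) * X := mul_le_mul_of_nonneg_right (by linarith) hX0
  rintro η (rfl | rfl | rfl)
  exacts [hη₁.trans hY1, hη₂.trans hY2, hη₃.trans hY2]

/-- An infinite local error makes the bound trivial, as C is positive; otherwise the dual norm is
finite and the real estimate applies. -/
theorem exists_ennreal_lower_bound (hn : 1 ≤ n) (κ : ℝ) : ∃ C : ℝ, 0 < C ∧
    ∀ M : Mesh (n + 1), M.ShapeRegular κ → ∀ ε : ℝ, 0 < ε →
    ∀ (f π gm φm : Pt (n + 1) → ℝ) (φ : Jet (n + 1)), MemLp f 2 (volume.restrict M.Ω) →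
      MemLp π 2 ((surf (n + 1)).restrict M.ΓN) → M.IsPA φm → M.IsH1 φ →
      ∀ p ∈ M.nodes, ¬ M.IsFullContact ε f π gm φm p →
      ∀ η ∈ ({M.η₁ ε f φm p, M.η₂ ε φm p, M.η₃ ε π φm p} : Set ℝ),
        ENNReal.ofReal η ≤ ENNReal.ofReal C * (M.localError ε f π gm φm φ p +
          ENNReal.ofReal (M.oscForce ε f p) + ENNReal.ofReal (M.oscNeumann ε π p)) := by
  obtain ⟨C, hC, h⟩ := exists_lower_bound hn κ
  refine ⟨C, hC, ?_⟩
  intro M hM ε hε f π gm φm φ hf hπ hφm hφ p hp hfc η hη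
  by_cases htop : M.localError ε f π gm φm φ p = ∞
  · rw [htop, top_add, top_add, ENNReal.mul_top (by simpa using hC)]
    exact le_top
  · have hD : M.dualNorm ε (M.patch p)
        (fun ψ => M.residual ε f π φ ψ - M.quasiForce ε f π gm φm ψ) ≠ ∞ := fun hD =>
      htop (by rw [Mesh.localError, hD, add_top])
    have hO : 0 ≤ M.oscForce ε f p := mul_nonneg (weight_nonneg hε p) (Real.sqrt_nonneg _)
    have hON : 0 ≤ M.oscNeumann ε π p := by rw [Mesh.oscNeumann]; positivity
    have := ENNReal.ofReal_le_ofReal (h M hM ε hε f π gm φm φ hf hπ hφm hφ p hp hD hfc η hη)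
    rwa [ENNReal.ofReal_mul hC.le, ENNReal.ofReal_add (by positivity) hON,
      ENNReal.ofReal_add ENNReal.toReal_nonneg hO, ENNReal.ofReal_toReal htop] at this

end Mesh

end ObstacleFEM

end

/-- Robust local lower bounds: the constant depends only on the dimension and on the
shape-regularity bound. -/
theorem mainTheorem2 (d : ℕ) (hd : d = 2 ∨ d = 3) (κ : ℝ) :
    ∃ C : ℝ, 0 < C ∧
      ∀ (M : ObstacleFEM.Mesh d), M.ShapeRegular κ →
      ∀ (ε : ℝ), 0 < ε →
      ∀ (f π φD gm φm : ObstacleFEM.Pt d → ℝ) (g φ : ObstacleFEM.Jet d),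
        MemLp f 2 (volume.restrict M.Ω) →
        MemLp π 2 ((ObstacleFEM.surf d).restrict M.ΓN) →
        M.IsDirichletDatum φD →
        M.IsH1 g → (∀ᵐ x ∂(ObstacleFEM.surf d).restrict M.ΓD, φD x ≤ g.tr x) →
        M.IsP1 gm → (∀ x ∈ M.ΓD, φD x ≤ gm x) →
        M.IsSolution ε f π φD g φ →
        M.IsDiscreteSolution ε f π φD gm φm →
        ∀ p ∈ M.nodes, ¬ M.IsFullContact ε f π gm φm p →
          ∀ η ∈ ({M.η₁ ε f φm p, M.η₂ ε φm p, M.η₃ ε π φm p} : Set ℝ),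
            ENNReal.ofReal η ≤ ENNReal.ofReal C *
              (M.localError ε f π gm φm φ p + ENNReal.ofReal (M.oscForce ε f p) +
                ENNReal.ofReal (M.oscNeumann ε π p)) := by
  -- Writing d = n + 1 makes the surface measure n-dimensional by definition; n ≥ 1 guarantees that
  -- a side has an edge.
  obtain ⟨n, hn, rfl⟩ : ∃ n : ℕ, 1 ≤ n ∧ d = n + 1 := by
    rcases hd with rfl | rfl
    exacts [⟨1, le_rfl, rfl⟩, ⟨2, by norm_num, rfl⟩]
  obtain ⟨C, hC, h⟩ := ObstacleFEM.Mesh.exists_ennreal_lower_bound hn κ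
  exact ⟨C, hC, fun M hM ε hε f π φD gm φm g φ hf hπ _ _ _ _ _ hφ hφm p hp hfc =>
    h M hM ε hε f π gm φm φ hf hπ hφm.1.1.isPA hφ.1.1 p hp hfc⟩
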